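/- **Riccati formalism for linear quadratic hybrid tracking.** *System.* Let $Q$ be a finite set of discrete states and $E$ a finite set of events, with a partial transition function $A:Q\times E\rightharpoonup Q$. The discrete state $q$ has continuous state space $\mathbb R^{n_q}$, control space $\mathbb R^{k_q}$, and dynamics $$\dot x=A_q(t)x+B_q(t)u+F_q(t),\qquad t\in[t_0,t_f].$$ An event $\sigma$ with $A(p,\sigma)=q$ has the jump map $x\mapsto P_\sigma x+J_\sigma$ from $\mathbb R^{n_p}$ to $\mathbb R^{n_q}$. Each ordered pair $(p,q)$ has a switching manifold $M_{pq}=\{x\in\mathbb R^{n_p}: m_{pq}^Tx+n_{pq}=0\}$, which is an affine hyperplane or empty, and $M_{pq}\cap M_{pq'}=\emptyset$ for $q\ne q'$. A hybrid initial state $(q_0,x_0)$ with $x_0\notin M_{q_0r}$ for all $r$ and a number $L\ge 0$ of switchings are given. *Admissible inputs and trajectories.* They consist of times $t_0<t_1<\dots<t_L<t_{L+1}=t_f$, discrete states $q_0,\dots,q_L$, events $\sigma_1,\dots,\sigma_L$ with $A(q_{j-1},\sigma_j)=q_j$, essentially bounded measurable controls $u_{q_i}$ on $[t_i,t_{i+1})$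 with values in $\mathbb R^{k_{q_i}}$, and states $x_{q_i}$ solving the dynamics of $q_i$ (in integrated form) on $[t_i,t_{i+1})$, with $x_{q_0}(t_0)=x_0$ and $x_{q_j}(t_j)=P_{\sigma_j}x_{q_{j-1}}(t_j-)+J_{\sigma_j}$, such that contact with a switching manifold is transversal and forces the switching: $x_{q_i}(t)\notin M_{q_ir}$ for $t_i<t<t_{i+1}$ and all $r$; $x_{q_L}(t_f)\notin M_{q_Lr}$ for all $r$; and if $x_{q_{j-1}}(t_j-)\in M_{q_{j-1}r}$, then $r=q_j$, the control has an (essential) left limit at $t_j$, and $m_{q_{j-1}q_j}^T\dot x_{q_{j-1}}(t_j-)\neq0$. The $j$-th switching is *autonomous* if $x_{q_{j-1}}(t_j-)\in M_{q_{j-1}q_j}$ and *controlled* otherwise. *Cost.* With $\|y\|_W^2=y^TWy$, let $$J=\sum_{i=0}^L\int_{t_i}^{t_{i+1}}\Big(\tfrac12\|x_{q_i}-r_{q_i}\|^2_{L_{q_i}}+\tfrac12\|u_{q_i}\|^2_{R_{q_i}}\Big)dt+\sum_{j=1}^L\tfrac12\|x_{q_{j-1}}(t_j-)-d^{\,j}_{q_{j-1}}\|^2_{C_{\sigma_j}}+\tfrac12\|x_{q_L}(t_f)-d^{\,L+1}_{q_L}\|^2_{G_{q_L}}.$$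 Here $A_q,B_q,F_q,L_q,R_q$ are $C^1$ and $r_q$ is continuous on $[t_0,t_f]$, the matrices $L_q(t),C_\sigma,G_q$ are symmetric positive semidefinite, $R_q(t)$ is symmetric positive definite, and the targets $d^{\,j}_q$ do not depend on the values of the switching times. *Claim.* Consider an admissible input and trajectory that minimizes $J$ among all admissible ones with $L$ switchings (switching times, events and controls are all free). Suppose that for all $1\le j\le L$ and all $r$, either $x_{q_j}(t_j)\notin M_{q_jr}$; or the jump map of $\sigma_j$ sends every state from which the switching can occur (all of $\mathbb R^{n_{q_{j-1}}}$ if the switching is controlled, $M_{q_{j-1}q_j}$ if it is autonomous) into $M_{q_jr}$, the control has an (essential) right limit at $t_j$, and $m_{q_jr}^T\dot x_{q_j}(t_j+)\ne0$. Then there are functions $K_{q_i}:[t_i,t_{i+1}]\to\mathbb R^{n_{q_i}\times n_{q_i}}$ and $s_{q_i}:[t_i,t_{i+1}]\to\mathbb R^{n_{q_i}}$ for $0\le i\le L$, and reals $p_1,\dots,p_L$ with $p_j=0$ whenever the $j$-th switching is controlled, such that: 1. $u_{q_i}(t)=-R_{q_i}^{-1}B_{q_i}^TK_{q_i}(t)x_{q_i}(t)-R_{q_i}^{-1}B_{q_i}^Ts_{q_i}(t)$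 for a.e. $t\in[t_i,t_{i+1})$, $0\le i\le L$. 2. On $[t_i,t_{i+1}]$ (with one-sided derivatives at the end points), $$\dot K_{q_i}=-L_{q_i}-K_{q_i}A_{q_i}-A_{q_i}^TK_{q_i}+K_{q_i}B_{q_i}R_{q_i}^{-1}B_{q_i}^TK_{q_i},$$ $$\dot s_{q_i}=-\big(A_{q_i}^T-K_{q_i}B_{q_i}R_{q_i}^{-1}B_{q_i}^T\big)s_{q_i}-K_{q_i}F_{q_i}+L_{q_i}r_{q_i}.$$ 3. $K_{q_L}(t_f)=G_{q_L}$ and $s_{q_L}(t_f)=-G_{q_L}d^{\,L+1}_{q_L}$. 4. For $1\le j\le L$, $$K_{q_{j-1}}(t_j)=P_{\sigma_j}^TK_{q_j}(t_j)P_{\sigma_j}+C_{\sigma_j},$$ $$s_{q_{j-1}}(t_j)=P_{\sigma_j}^Ts_{q_j}(t_j)+p_j\,m_{q_{j-1}q_j}-C_{\sigma_j}d^{\,j}_{q_{j-1}}+P_{\sigma_j}^TK_{q_j}(t_j)J_{\sigma_j}.$$ 5. For $t\in[t_i,t_{i+1}]$ and $x\in\mathbb R^{n_{q_i}}$, put $\lambda=K_{q_i}(t)x+s_{q_i}(t)$.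 The Hamiltonian $v\mapsto\lambda^T(A_{q_i}x+B_{q_i}v+F_{q_i})+\tfrac12\|x-r_{q_i}\|^2_{L_{q_i}}+\tfrac12\|v\|^2_{R_{q_i}}$ has minimum $$H_i^o(t,x)=\tfrac12\|x-r_{q_i}\|^2_{L_{q_i}}+\lambda^T\big(A_{q_i}x-\tfrac12B_{q_i}R_{q_i}^{-1}B_{q_i}^T\lambda+F_{q_i}\big),$$ and at the optimal switching times, for $1\le j\le L$, $$H_{j-1}^o\big(t_j,x_{q_{j-1}}(t_j-)\big)=H_j^o\big(t_j,P_{\sigma_j}x_{q_{j-1}}(t_j-)+J_{\sigma_j}\big).$$ -/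

import Mathlib

open Set Filter Topology MeasureTheory Matrix

namespace HybridLQ

/-- Data of a linear quadratic hybrid tracking problem with exactly `N` switchings on `[t₀, tf]`:
discrete states `Q`, transition events `E`, continuous state space `ℝ^(n q)` and control space
`ℝ^(k q)` in the discrete state `q`. -/
structure Problem (Q E : Type*) where
  t₀ : ℝ
  tf : ℝ
  /-- the number of switchings -/
  N : ℕ
  /-- dimension of the continuous state in each discrete state -/
  n : Q → ℕ
  /-- dimension of the control in each discrete state -/
  k : Q → ℕ
  /-- the initial hybrid state `(q₀, x₀)` -/
  h₀ : (q : Q) × (Fin (n q) → ℝ)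
  /-- the (partial) transition function of the automaton -/
  next : Q → E → Option Q
  A : (q : Q) → ℝ → Matrix (Fin (n q)) (Fin (n q)) ℝ
  B : (q : Q) → ℝ → Matrix (Fin (n q)) (Fin (k q)) ℝ
  F : (q : Q) → ℝ → Fin (n q) → ℝ
  /-- linear part of the jump map of the event `σ : p → q`; only used when
  `next p σ = some q`, and likewise for `J`. -/
  P : (p q : Q) → E → Matrix (Fin (n q)) (Fin (n p)) ℝ
  /-- constant part of the jump map -/
  J : (p q : Q) → E → Fin (n q) → ℝ
  /-- the switching manifold of the pair `(p, q)` is `{x | m p q ⬝ᵥ x + c p q = 0}`; a pair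
  without switching manifold has `m p q = 0` and `c p q ≠ 0`. -/
  m : (p q : Q) → Fin (n p) → ℝ
  c : Q → Q → ℝ
  /-- weight of the running tracking cost -/
  L : (q : Q) → ℝ → Matrix (Fin (n q)) (Fin (n q)) ℝ
  /-- weight of the control cost -/
  R : (q : Q) → ℝ → Matrix (Fin (k q)) (Fin (k q)) ℝ
  /-- reference to be tracked -/
  r : (q : Q) → ℝ → Fin (n q) → ℝ
  /-- weight of the switching cost of the event `σ` out of `p` -/
  C : (p : Q) → E → Matrix (Fin (n p)) (Fin (n p)) ℝ
  /-- weight of the terminal cost -/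
  G : (q : Q) → Matrix (Fin (n q)) (Fin (n q)) ℝ
  /-- `d i q` is the target for the state at the end of the `i`-th segment (counted from `0`)
  when the discrete state on this segment is `q` -/
  d : Fin (N + 1) → (q : Q) → Fin (n q) → ℝ

variable {Q E : Type*}

namespace Problem

variable (S : Problem Q E)

/-- The affine vector field `A x + B u + F`. -/
def field (q : Q) (t : ℝ) (x : Fin (S.n q) → ℝ) (u : Fin (S.k q) → ℝ) : Fin (S.n q) → ℝ :=
  S.A q t *ᵥ x + S.B q t *ᵥ u + S.F q t

/-- The affine jump map. -/
def jump (p q : Q) (σ : E) (x : Fin (S.n p) → ℝ) : Fin (S.n q) → ℝ :=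
  S.P p q σ *ᵥ x + S.J p q σ

/-- `x` lies on the switching manifold of the ordered pair `(p, q)`. -/
def OnManifold (p q : Q) (x : Fin (S.n p) → ℝ) : Prop :=
  S.m p q ⬝ᵥ x + S.c p q = 0

/-- The running cost. -/
noncomputable def runningCost (q : Q) (t : ℝ) (x : Fin (S.n q) → ℝ) (u : Fin (S.k q) → ℝ) : ℝ :=
  1 / 2 * ((x - S.r q t) ⬝ᵥ (S.L q t *ᵥ (x - S.r q t))) + 1 / 2 * (u ⬝ᵥ (S.R q t *ᵥ u))

/-- The Hamiltonian of the discrete state `q`. -/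
noncomputable def hamiltonian (q : Q) (t : ℝ) (x lam : Fin (S.n q) → ℝ)
    (u : Fin (S.k q) → ℝ) : ℝ :=
  lam ⬝ᵥ S.field q t x u + S.runningCost q t x u

/-- The minimized Hamiltonian at the state `x` and the adjoint `lam`, in closed form. -/
noncomputable def minHamiltonian (q : Q) (t : ℝ) (x lam : Fin (S.n q) → ℝ) : ℝ :=
  1 / 2 * ((x - S.r q t) ⬝ᵥ (S.L q t *ᵥ (x - S.r q t)))
    + lam ⬝ᵥ (S.A q t *ᵥ x
        - (1 / 2 : ℝ) • ((S.B q t * (S.R q t)⁻¹ * (S.B q t)ᵀ) *ᵥ lam) + S.F q t)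

/-- Standing assumptions on the data. -/
structure Valid : Prop where
  contDiff_A : ∀ q a b, ContDiffOn ℝ 1 (fun t => S.A q t a b) (Icc S.t₀ S.tf)
  contDiff_B : ∀ q a b, ContDiffOn ℝ 1 (fun t => S.B q t a b) (Icc S.t₀ S.tf)
  contDiff_F : ∀ q a, ContDiffOn ℝ 1 (fun t => S.F q t a) (Icc S.t₀ S.tf)
  contDiff_L : ∀ q a b, ContDiffOn ℝ 1 (fun t => S.L q t a b) (Icc S.t₀ S.tf)
  contDiff_R : ∀ q a b, ContDiffOn ℝ 1 (fun t => S.R q t a b) (Icc S.t₀ S.tf)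
  continuous_r : ∀ q, ContinuousOn (S.r q) (Icc S.t₀ S.tf)
  posSemidef_L : ∀ q, ∀ t ∈ Icc S.t₀ S.tf, (S.L q t).PosSemidef
  posDef_R : ∀ q, ∀ t ∈ Icc S.t₀ S.tf, (S.R q t).PosDef
  posSemidef_C : ∀ p σ, (S.C p σ).PosSemidef
  posSemidef_G : ∀ q, (S.G q).PosSemidef
  /-- each switching manifold is an affine hyperplane or empty -/
  manifold_codim : ∀ p q, S.m p q ≠ 0 ∨ S.c p q ≠ 0
  /-- the switching manifolds of a discrete state are pairwise disjoint -/
  manifold_disjoint : ∀ p q q', q ≠ q' → ∀ x, ¬ (S.OnManifold p q x ∧ S.OnManifold p q' x)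
  /-- the initial state lies on no switching manifold -/
  initial_off : ∀ q, ¬ S.OnManifold S.h₀.1 q S.h₀.2

end Problem

/-- A hybrid input together with a hybrid state process. The `i`-th segment is
`[t i.castSucc, t i.succ)`, with discrete state `q i`, control `u i` and continuous state `x i`,
and `x i` is extended to `t i.succ` by its left limit there. For `j : Fin N`, the event `σ j` takes
`q j.castSucc` to `q j.succ` at the end of the segment `j.castSucc`. -/
structure Execution (S : Problem Q E) where
  t : Fin (S.N + 2) → ℝ
  q : Fin (S.N + 1) → Q
  σ : Fin S.N → E
  u : (i : Fin (S.N + 1)) → ℝ → Fin (S.k (q i)) → ℝ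
  x : (i : Fin (S.N + 1)) → ℝ → Fin (S.n (q i)) → ℝ

namespace Execution

variable {S : Problem Q E} (ω : Execution S)

/-- Initial time of the `i`-th segment. -/
def tstart (i : Fin (S.N + 1)) : ℝ := ω.t i.castSucc

/-- Final time of the `i`-th segment. -/
def tend (i : Fin (S.N + 1)) : ℝ := ω.t i.succ

/-- The continuous state when the `i`-th segment is entered. -/
def xstart (i : Fin (S.N + 1)) : Fin (S.n (ω.q i)) → ℝ := ω.x i (ω.tstart i)

/-- The left limit of the continuous state at the end of the `i`-th segment. -/
def xend (i : Fin (S.N + 1)) : Fin (S.n (ω.q i)) → ℝ := ω.x i (ω.tend i)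

/-- The `j`-th switching is autonomous, i.e. it takes place on the switching manifold. The other
switchings are controlled. -/
def Autonomous (j : Fin S.N) : Prop :=
  S.OnManifold (ω.q j.castSucc) (ω.q j.succ) (ω.xend j.castSucc)

/-- The trajectory crosses transversally the switching manifold towards `p` at the end of the `i`-th
segment. The value `v` is the left limit of the control, as an element of `L^∞`. -/
def TransversalEnd (i : Fin (S.N + 1)) (p : Q) : Prop :=
  ∃ v : Fin (S.k (ω.q i)) → ℝ,
    Tendsto (ω.u i) (𝓝[<] (ω.tend i) ⊓ ae volume) (𝓝 v) ∧
      S.m (ω.q i) p ⬝ᵥ S.field (ω.q i) (ω.tend i) (ω.xend i) v ≠ 0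

/-- The analogous condition at the initial time of the `i`-th segment. -/
def TransversalStart (i : Fin (S.N + 1)) (p : Q) : Prop :=
  ∃ v : Fin (S.k (ω.q i)) → ℝ,
    Tendsto (ω.u i) (𝓝[>] (ω.tstart i) ⊓ ae volume) (𝓝 v) ∧
      S.m (ω.q i) p ⬝ᵥ S.field (ω.q i) (ω.tstart i) (ω.xstart i) v ≠ 0

/-- `ω` is an input-state trajectory of the hybrid system with exactly `N` switchings, starting at
the given initial hybrid state. A contact with a switching manifold, which has to be transversal,
forces the corresponding transition. -/
structure Admissible : Prop where
  strictMono : StrictMono ω.t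
  start : ω.t 0 = S.t₀
  finish : ω.t (Fin.last (S.N + 1)) = S.tf
  init : (⟨ω.q 0, ω.xstart 0⟩ : (q : Q) × (Fin (S.n q) → ℝ)) = S.h₀
  control : ∀ i, MemLp (ω.u i) ⊤ (volume.restrict (Ico (ω.tstart i) (ω.tend i)))
  continuous : ∀ i, ContinuousOn (ω.x i) (Icc (ω.tstart i) (ω.tend i))
  dynamics : ∀ i, ∀ t ∈ Icc (ω.tstart i) (ω.tend i),
    ω.x i t = ω.xstart i + ∫ τ in (ω.tstart i)..t, S.field (ω.q i) τ (ω.x i τ) (ω.u i τ)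
  event : ∀ j : Fin S.N, S.next (ω.q j.castSucc) (ω.σ j) = some (ω.q j.succ)
  jump : ∀ j : Fin S.N,
    ω.xstart j.succ = S.jump (ω.q j.castSucc) (ω.q j.succ) (ω.σ j) (ω.xend j.castSucc)
  no_contact : ∀ i, ∀ t ∈ Ioo (ω.tstart i) (ω.tend i), ∀ p, ¬ S.OnManifold (ω.q i) p (ω.x i t)
  no_contact_final : ∀ p, ¬ S.OnManifold (ω.q (Fin.last S.N)) p (ω.xend (Fin.last S.N))
  contact : ∀ (j : Fin S.N) (p : Q), S.OnManifold (ω.q j.castSucc) p (ω.xend j.castSucc) →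
    p = ω.q j.succ ∧ ω.TransversalEnd j.castSucc p

/-- The hybrid cost. -/
noncomputable def cost : ℝ :=
  ∑ i, (∫ t in (ω.tstart i)..(ω.tend i), S.runningCost (ω.q i) t (ω.x i t) (ω.u i t))
  + ∑ j : Fin S.N, 1 / 2 *
      ((ω.xend j.castSucc - S.d j.castSucc (ω.q j.castSucc)) ⬝ᵥ
        (S.C (ω.q j.castSucc) (ω.σ j) *ᵥ
          (ω.xend j.castSucc - S.d j.castSucc (ω.q j.castSucc))))
  + 1 / 2 *
      ((ω.xend (Fin.last S.N) - S.d (Fin.last S.N) (ω.q (Fin.last S.N))) ⬝ᵥ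
        (S.G (ω.q (Fin.last S.N)) *ᵥ
          (ω.xend (Fin.last S.N) - S.d (Fin.last S.N) (ω.q (Fin.last S.N)))))

/-- `ω` minimizes the hybrid cost among all hybrid inputs with `N` switchings: the switching times,
the events and the controls are free. -/
def IsOptimal : Prop :=
  ω.Admissible ∧ ∀ ω' : Execution S, ω'.Admissible → ω.cost ≤ ω'.cost

/-- After each switching the continuous state lies off the switching manifolds of the new discrete
state; or else the jump map sends every state from which this switching can occur (the whole
space if it is controlled, its switching manifold if it is autonomous) into the manifold on which
the state lies, and the trajectory leaves that manifold transversally. -/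
def RegularEntry : Prop :=
  ∀ (j : Fin S.N) (p : Q), S.OnManifold (ω.q j.succ) p (ω.xstart j.succ) →
    (∀ y : Fin (S.n (ω.q j.castSucc)) → ℝ,
      (ω.Autonomous j → S.OnManifold (ω.q j.castSucc) (ω.q j.succ) y) →
        S.OnManifold (ω.q j.succ) p (S.jump (ω.q j.castSucc) (ω.q j.succ) (ω.σ j) y)) ∧
    ω.TransversalStart j.succ p

end Execution

end HybridLQ

/-!
# Riccati formalism for linear quadratic hybrid tracking

The segments of an optimal execution are treated one by one, backwards in time. What a segment has
to know about its future is a first order upper bound for the excess cost of admissible ways to go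
on from a nearby time and state: `Execution.EntryBound i lam h` says that one can start the `i`-th
segment at the time `a` and the state `ξ`, and complete it to an admissible execution with the same
discrete states and events, at an excess cost of at most `lam ⬝ᵥ (ξ - ξ₀) - h (a - a₀)` up to an
error of smaller order. An upper bound suffices: optimality enters only through the fact that
completions from the unperturbed start have nonnegative excess cost (`HasTail.nonneg`).
Composition with the jump map turns it into a bound for the cost after the preceding segment
(`EntryBound.continuationBound`); this is where the regularity of the entry is used, since the
perturbed state has to stay on the switching manifold on which the new segment starts.

Given such a bound at the end of a segment, three steps give it at its start.

* With both times fixed, the cost is quadratic in a perturbation of the control. Vanishing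
  of its first variation, with a multiplier `p` for the condition that an autonomous switching stays
  on its manifold, makes the adjoint with the resulting end value satisfy `R u + Bᵀ λ = 0` almost
  everywhere (`Valid.ae_eq_law`). So the segment is an extremal (`IsOptimal.exists_isExtremalOn`),
  and its control and velocity have continuous representatives.
* Moving the end in time gives continuity of the Hamiltonian. A controlled switching can be moved
  freely. For an autonomous switching either some variation of the control moves the end off the
  manifold, and a multiple of it compensates the shift in time
  (`ExtremalSegment.minHamiltonian_tend_eq_of_variation`); or there is no such variation, the
  multiplier is arbitrary, and by transversality it can be chosen to give the Hamiltonian the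
  required value.
* Moving the start in time and space along solutions of the linearized dynamics, and letting the end
  return to the manifold, changes the cost to first order by the pairing with the adjoint minus
  the Hamiltonian times the shift in time (`ExtremalSegment.entryBound`).

That the perturbed trajectories meet no manifold prematurely is due to the transversality of the
contacts at both ends (`Problem.exists_forall_perturbed_no_contact`). Finally the matrix Riccati
equation is solvable on the whole segment for an end value with nonnegative quadratic form, because
the state part of the linear Hamiltonian flow stays invertible (`exists_riccati`); this property
of the end value is inherited by the preceding segment, and `s = λ - K x` solves its linear equation
by differentiation.
-/

namespace HybridLQ

/-! ### Linear differential equations -/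

section LinearODE

variable {E : Type*} [NormedAddCommGroup E] [NormedSpace ℝ E]

/-- A linear differential equation with continuous coefficients on a compact interval has a solution
on the whole interval, whatever the point at which the value is prescribed: an iterate of the Picard
map on `C([a, b], E)` is a contraction. -/
theorem exists_solution_linear [CompleteSpace E] {f : ℝ → E →L[ℝ] E} {g : ℝ → E} {a b t₀ : ℝ}
    (ht₀ : t₀ ∈ Icc a b) (hf : ContinuousOn f (Icc a b)) (hg : ContinuousOn g (Icc a b)) (ξ : E) :
    ∃ z : ℝ → E, z t₀ = ξ ∧
      ∀ t ∈ Icc a b, HasDerivWithinAt z (f t (z t) + g t) (Icc a b) t := by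
  have hab : a ≤ b := ht₀.1.trans ht₀.2
  obtain ⟨M, hM⟩ : ∃ M, ∀ t ∈ Icc a b, ‖f t‖ ≤ M :=
    isCompact_Icc.exists_bound_of_continuousOn hf
  have hM0 : 0 ≤ M := (norm_nonneg _).trans (hM t₀ ht₀)
  have hcont : ∀ z : ℝ → E, ContinuousOn z (Icc a b) →
      ContinuousOn (fun τ => f τ (z τ) + g τ) (Icc a b) := fun z hz => (hf.clm_apply hz).add hg
  have hint : ∀ z : ℝ → E, ContinuousOn z (Icc a b) → ∀ t ∈ Icc a b,
      IntervalIntegrable (fun τ => f τ (z τ) + g τ) volume t₀ t := fun z hz t ht =>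
    ((hcont z hz).mono (uIcc_subset_Icc ht₀ ht)).intervalIntegrable
  have hder : ∀ z : ℝ → E, ContinuousOn z (Icc a b) → ∀ t ∈ Icc a b,
      HasDerivWithinAt (fun t => ξ + ∫ τ in t₀..t, (f τ (z τ) + g τ)) (f t (z t) + g t)
        (Icc a b) t := by
    intro z hz t ht
    have : Fact (t ∈ Icc a b) := ⟨ht⟩
    exact (intervalIntegral.integral_hasDerivWithinAt_right (hint z hz t ht)
      ((hcont z hz).stronglyMeasurableAtFilter_nhdsWithin measurableSet_Icc t)
      (hcont z hz t ht)).const_add _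
  have hext : ∀ z : C(Icc a b, E), ContinuousOn (IccExtend hab z) (Icc a b) := fun z =>
    z.continuous.Icc_extend'.continuousOn
  let T : C(Icc a b, E) → C(Icc a b, E) := fun z =>
    ⟨fun t => ξ + ∫ τ in t₀..t, (f τ (IccExtend hab z τ) + g τ), by
      have h : ContinuousOn (fun t => ξ + ∫ τ in t₀..t, (f τ (IccExtend hab z τ) + g τ))
          (Icc a b) := fun t ht => (hder _ (hext z) t ht).continuousWithinAt
      exact continuousOn_iff_continuous_domRestrict.1 h⟩
  have hT : ∀ z t, T z t = ξ + ∫ τ in t₀..t, (f τ (IccExtend hab z τ) + g τ) := fun _ _ => rfl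
  have key : ∀ (n : ℕ) (z w : C(Icc a b, E)) (t : Icc a b),
      dist (T^[n] z t) (T^[n] w t) ≤ (M * |t.1 - t₀|) ^ n / n.factorial * dist z w := by
    intro n z w
    induction n with
    | zero => intro t; simpa using ContinuousMap.dist_apply_le_dist t
    | succ n ih =>
      intro t
      rw [Function.iterate_succ_apply', Function.iterate_succ_apply', dist_eq_norm, hT, hT,
        add_sub_add_left_eq_sub, ← intervalIntegral.integral_sub (hint _ (hext _) _ t.2)
        (hint _ (hext _) _ t.2)]
      calc
        _ ≤ ∫ τ in uIoc t₀ t.1, M ^ (n + 1) * |τ - t₀| ^ n / n.factorial * dist z w := by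
          rw [intervalIntegral.norm_intervalIntegral_eq]
          apply MeasureTheory.norm_integral_le_of_norm_le
            (Continuous.integrableOn_uIoc (by fun_prop))
          apply ae_restrict_mem measurableSet_Ioc |>.mono
          intro τ hτ
          have hτ' : τ ∈ Icc a b := uIcc_subset_Icc ht₀ t.2 (uIoc_subset_uIcc hτ)
          rw [add_sub_add_right_eq_sub, ← map_sub, IccExtend_of_mem _ _ hτ',
            IccExtend_of_mem _ _ hτ']
          refine (ContinuousLinearMap.le_opNorm _ _).trans ?_
          have h1 := ih ⟨τ, hτ'⟩
          rw [dist_eq_norm] at h1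
          calc _ ≤ M * ((M * |τ - t₀|) ^ n / n.factorial * dist z w) :=
                mul_le_mul (hM τ hτ') h1 (norm_nonneg _) hM0
            _ = _ := by rw [mul_pow, pow_succ]; ring
        _ ≤ _ := by
          apply le_of_abs_le
          rw [← intervalIntegral.abs_intervalIntegral_eq, intervalIntegral.integral_mul_const,
            intervalIntegral.integral_div, intervalIntegral.integral_const_mul, abs_mul, abs_div,
            abs_mul, intervalIntegral.abs_intervalIntegral_eq, integral_pow_abs_sub_uIoc, abs_div,
            abs_pow, abs_pow, abs_dist, abs_of_nonneg hM0, abs_abs, mul_div, div_div, ← abs_mul,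
            ← Nat.cast_succ, ← Nat.cast_mul, ← Nat.factorial_succ, Nat.abs_cast, ← mul_pow]
  obtain ⟨n, hn⟩ := (FloorSemiring.tendsto_pow_div_factorial_atTop (M * (b - a))).eventually
    (gt_mem_nhds zero_lt_one) |>.exists
  have hc0 : 0 ≤ (M * (b - a)) ^ n / n.factorial := by
    have := sub_nonneg.2 hab
    positivity
  have hcontr : ContractingWith ⟨_, hc0⟩ T^[n] := by
    refine ⟨hn, LipschitzWith.of_dist_le_mul fun z w => ?_⟩
    rw [ContinuousMap.dist_le (by positivity)]
    intro t
    refine (key n z w t).trans ?_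
    change _ ≤ (M * (b - a)) ^ n / n.factorial * dist z w
    have : |t.1 - t₀| ≤ b - a := by
      rw [abs_le]; constructor <;> linarith [t.2.1, t.2.2, ht₀.1, ht₀.2]
    gcongr
  have : Nonempty C(Icc a b, E) := ⟨0⟩
  have hfix : Function.IsFixedPt T (ContractingWith.fixedPoint _ hcontr) :=
    hcontr.isFixedPt_fixedPoint_iterate
  set z := ContractingWith.fixedPoint _ hcontr
  have hz : ∀ t ∈ Icc a b, IccExtend hab z t
      = ξ + ∫ τ in t₀..t, (f τ (IccExtend hab z τ) + g τ) := by
    intro t ht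
    rw [IccExtend_of_mem _ _ ht]
    exact (DFunLike.congr_fun hfix ⟨t, ht⟩).symm
  refine ⟨IccExtend hab z, by rw [hz t₀ ht₀]; simp, fun t ht => ?_⟩
  exact (hder _ (hext z) t ht).congr hz (hz t ht)

/-- Growth estimate for a linear differential inequality, forward in time. -/
theorem norm_le_of_linear_growth {a b M : ℝ} (hM : 0 < M) {z z' : ℝ → E}
    (hz : ∀ t ∈ Icc a b, HasDerivWithinAt z (z' t) (Icc a b) t)
    (hb : ∀ t ∈ Icc a b, ‖z' t‖ ≤ M * ‖z t‖) :
    ∀ t ∈ Icc a b, ‖z t‖ ≤ Real.exp (M * (b - a)) * ‖z a‖ := by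
  intro t ht
  have h := norm_le_gronwallBound_of_norm_deriv_right_le (f := z) (f' := z') (δ := ‖z a‖) (K := M)
    (ε := 0) (a := a) (b := b) (fun s hs => (hz s hs).continuousWithinAt)
    (fun s hs => ((hz s (Ico_subset_Icc_self hs)).mono_of_mem_nhdsWithin
      (Icc_mem_nhdsGE_of_mem hs))) le_rfl
    (fun s hs => by simpa using hb s (Ico_subset_Icc_self hs)) t ht
  rw [gronwallBound_ε0, mul_comm] at h
  refine h.trans (mul_le_mul_of_nonneg_right (Real.exp_le_exp.2 ?_) (norm_nonneg _))
  exact mul_le_mul_of_nonneg_left (by linarith [ht.2]) hM.le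

/-- Solutions of a linear differential equation that agree at the right end point agree. -/
theorem eqOn_of_linear_of_eq_right {f : ℝ → E →L[ℝ] E} {g z w : ℝ → E} {a b : ℝ}
    (hf : ContinuousOn f (Icc a b))
    (hz : ∀ t ∈ Icc a b, HasDerivWithinAt z (f t (z t) + g t) (Icc a b) t)
    (hw : ∀ t ∈ Icc a b, HasDerivWithinAt w (f t (w t) + g t) (Icc a b) t)
    (hb : z b = w b) : EqOn z w (Icc a b) := by
  obtain ⟨M, hM⟩ : ∃ M, ∀ t ∈ Icc a b, ‖f t‖ ≤ M :=
    isCompact_Icc.exists_bound_of_continuousOn hf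
  refine ODE_solution_unique_of_mem_Icc_left (v := fun t x => f t x + g t) (s := fun _ => univ)
    (K := M.toNNReal) (fun t ht => ?_) (fun t ht => (hz t ht).continuousWithinAt)
    (fun t ht => (hz t (Ioc_subset_Icc_self ht)).mono_of_mem_nhdsWithin
      (Icc_mem_nhdsLE_of_mem ht)) (fun _ _ => mem_univ _)
    (fun t ht => (hw t ht).continuousWithinAt)
    (fun t ht => (hw t (Ioc_subset_Icc_self ht)).mono_of_mem_nhdsWithin
      (Icc_mem_nhdsLE_of_mem ht)) (fun _ _ => mem_univ _) hb
  refine LipschitzWith.lipschitzOnWith (LipschitzWith.of_dist_le_mul fun x y => ?_)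
  rw [dist_add_right, dist_eq_norm, ← map_sub, dist_eq_norm]
  refine ((f t).le_opNorm _).trans ?_
  gcongr
  exact (hM t (Ioc_subset_Icc_self ht)).trans (Real.le_coe_toNNReal M)

end LinearODE

/-! ### Curves avoiding hyperplanes -/

/-- The difference quotients of `g` on `I` are bounded away from zero near `e`. -/
def HasSlopeBoundAt (g : ℝ → ℝ) (I : Set ℝ) (e : ℝ) : Prop :=
  ∃ κ > 0, ∃ δ > 0, ∀ s ∈ I, ∀ t ∈ I, |s - e| < δ → |t - e| < δ → κ * |t - s| ≤ |g t - g s|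

/-- A continuous function without zeros on `(a, b)`, which at an end point either does not vanish or
has a slope bounded away from zero there, keeps this property under a perturbation that is small,
has a small Lipschitz constant, and preserves the zeros at the end points. -/
theorem exists_forall_perturbed_ne_zero {g : ℝ → ℝ} {T₀ T₁ a b : ℝ}
    (hg : ContinuousOn g (Icc T₀ T₁)) (ha : a ∈ Icc T₀ T₁) (hb : b ∈ Icc T₀ T₁)
    (h0 : ∀ t ∈ Ioo a b, g t ≠ 0)
    (hsa : g a = 0 → HasSlopeBoundAt g (Icc T₀ T₁) a)
    (hsb : g b = 0 → HasSlopeBoundAt g (Icc T₀ T₁) b) :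
    ∃ δ > 0, ∀ (a' b' : ℝ) (h : ℝ → ℝ), a' ∈ Icc T₀ T₁ → b' ∈ Icc T₀ T₁ → |a' - a| < δ →
      |b' - b| < δ → (∀ t ∈ Icc a' b', |h t| ≤ δ) →
      (∀ s ∈ Icc a' b', ∀ t ∈ Icc a' b', |h t - h s| ≤ δ * |t - s|) →
      (g a = 0 → g a' + h a' = 0) → (g b = 0 → g b' + h b' = 0) →
      ∀ t ∈ Ioo a' b', g t + h t ≠ 0 := by
  -- near an end point `e`, only the perturbed contact itself is a zero
  have local_ : ∀ e ∈ Icc T₀ T₁, (g e = 0 → HasSlopeBoundAt g (Icc T₀ T₁) e) →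
      ∃ δ > 0, ∀ (a' b' e' : ℝ) (h : ℝ → ℝ), Icc a' b' ⊆ Icc T₀ T₁ → e' ∈ Icc a' b' →
      |e' - e| < δ →
      (∀ t ∈ Icc a' b', |h t| ≤ δ) →
      (∀ s ∈ Icc a' b', ∀ t ∈ Icc a' b', |h t - h s| ≤ δ * |t - s|) →
      (g e = 0 → g e' + h e' = 0) → ∀ t ∈ Icc a' b', t ≠ e' → |t - e| < δ → g t + h t ≠ 0 := by
    intro e he hs
    by_cases hge : g e = 0
    · obtain ⟨κ, hκ, δ, hδ, H⟩ := hs hge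
      refine ⟨min (κ / 2) δ, by positivity, ?_⟩
      intro a' b' e' h hsub he' hee' hh hlip hz t ht hte htd h00
      have h1 := H e' (hsub he') t (hsub ht) (hee'.trans_le (min_le_right _ _))
        (htd.trans_le (min_le_right _ _))
      have h2 := hlip e' he' t ht
      have h3 := hz hge
      have h4 : g t - g e' = -(h t - h e') := by linarith
      rw [h4, abs_neg] at h1
      have h5 : 0 < |t - e'| := abs_pos.2 (sub_ne_zero.2 hte)
      have h6 : min (κ / 2) δ * |t - e'| ≤ κ / 2 * |t - e'| :=
        mul_le_mul_of_nonneg_right (min_le_left _ _) h5.le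
      nlinarith
    · obtain ⟨δ, hδ, H⟩ := Metric.continuousWithinAt_iff.1 (hg e he) (|g e| / 2)
        (by positivity)
      refine ⟨min (|g e| / 4) δ, lt_min (by positivity) hδ, ?_⟩
      intro a' b' e' h hsub he' hee' hh hlip hz t ht hte htd h00
      have h1 := H (hsub ht) (by rw [Real.dist_eq]; exact htd.trans_le (min_le_right _ _))
      rw [Real.dist_eq] at h1
      have h2 := (hh t ht).trans (min_le_left _ _)
      have h3 : g t = - h t := by linarith
      rw [h3] at h1
      have h4 : |g e| ≤ |-h t - g e| + |h t| := by
        have := abs_sub_abs_le_abs_sub (g e) (-h t)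
        rw [abs_neg, abs_sub_comm] at this
        linarith
      have : 0 < |g e| := abs_pos.2 hge
      linarith
  obtain ⟨δa, hδa, Ha⟩ := local_ a ha hsa
  obtain ⟨δb, hδb, Hb⟩ := local_ b hb hsb
  -- away from the end points `g` is bounded away from zero
  have hmid : ∃ μ > 0, ∀ t ∈ Icc (a + δa / 2) (b - δb / 2), μ ≤ |g t| := by
    by_cases hne : (Icc (a + δa / 2) (b - δb / 2)).Nonempty
    · have hsub : Icc (a + δa / 2) (b - δb / 2) ⊆ Icc T₀ T₁ :=
        Icc_subset_Icc (by linarith [ha.1]) (by linarith [hb.2])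
      obtain ⟨t, ht, hmin⟩ := isCompact_Icc.exists_isMinOn hne ((hg.mono hsub).abs)
      exact ⟨|g t|, abs_pos.2 (h0 t ⟨by linarith [ht.1], by linarith [ht.2]⟩),
        fun s hs => hmin hs⟩
    · exact ⟨1, one_pos, fun t ht => (hne ⟨t, ht⟩).elim⟩
  obtain ⟨μ, hμ, hmid⟩ := hmid
  refine ⟨min (min (δa / 2) (δb / 2)) (μ / 2), by positivity, ?_⟩
  intro a' b' h ha' hb' haa hbb hh hlip hza hzb t ht
  set δ := min (min (δa / 2) (δb / 2)) (μ / 2) with hδ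
  have d1 : δ ≤ δa / 2 := (min_le_left _ _).trans (min_le_left _ _)
  have d2 : δ ≤ δb / 2 := (min_le_left _ _).trans (min_le_right _ _)
  have d3 : δ ≤ μ / 2 := min_le_right _ _
  have htI : t ∈ Icc a' b' := Ioo_subset_Icc_self ht
  have hle : a' ≤ b' := htI.1.trans htI.2
  have hsub : Icc a' b' ⊆ Icc T₀ T₁ := Icc_subset_Icc ha'.1 hb'.2
  rw [abs_lt] at haa hbb
  by_cases c1 : t < a + δa / 2
  · refine Ha a' b' a' h hsub (left_mem_Icc.2 hle) (by rw [abs_lt]; constructor <;> linarith)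
      (fun s hs => (hh s hs).trans (by linarith))
      (fun s hs r hr => (hlip s hs r hr).trans
        (mul_le_mul_of_nonneg_right (by linarith) (abs_nonneg _))) hza t htI ht.1.ne' ?_
    rw [abs_lt]; constructor <;> linarith [ht.1]
  by_cases c2 : b - δb / 2 < t
  · refine Hb a' b' b' h hsub (right_mem_Icc.2 hle) (by rw [abs_lt]; constructor <;> linarith)
      (fun s hs => (hh s hs).trans (by linarith))
      (fun s hs r hr => (hlip s hs r hr).trans
        (mul_le_mul_of_nonneg_right (by linarith) (abs_nonneg _))) hzb t htI ht.2.ne ?_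
    rw [abs_lt]; constructor <;> linarith [ht.2]
  · intro h00
    have h1 := hmid t ⟨not_lt.1 c1, not_lt.1 c2⟩
    have h2 := hh t htI
    have h3 : g t = - h t := by linarith
    rw [h3, abs_neg] at h1
    linarith

/-- A primitive of a function with an essential limit different from zero at `e` has slopes bounded
away from zero near `e`. -/
theorem exists_slope_bound_of_tendsto_ae {g γ : ℝ → ℝ} {T₀ T₁ e γ₀ : ℝ}
    (hg : ∀ s ∈ Icc T₀ T₁, ∀ t ∈ Icc T₀ T₁, g t - g s = ∫ τ in s..t, γ τ)
    (hγ : IntegrableOn γ (Icc T₀ T₁))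
    (hlim : Tendsto γ (𝓝[Icc T₀ T₁] e ⊓ ae volume) (𝓝 γ₀)) (h0 : γ₀ ≠ 0) :
    HasSlopeBoundAt g (Icc T₀ T₁) e := by
  have hp : 0 < |γ₀| := abs_pos.2 h0
  have h1 : ∀ᶠ τ in 𝓝[Icc T₀ T₁] e ⊓ ae volume, |γ₀| / 2 ≤ SignType.sign γ₀ * γ τ := by
    have : Tendsto (fun τ => (SignType.sign γ₀ : ℝ) * γ τ) (𝓝[Icc T₀ T₁] e ⊓ ae volume)
        (𝓝 (SignType.sign γ₀ * γ₀)) := hlim.const_mul _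
    rw [sign_mul_self] at this
    exact (this.eventually (lt_mem_nhds (half_lt_self hp))).mono fun _ h => h.le
  obtain ⟨U, hU, W, hW, hUW⟩ := Filter.eventually_inf.1 h1
  obtain ⟨δ, hδ, hball⟩ := Metric.mem_nhdsWithin_iff.1 hU
  have hle : ∀ s ∈ Icc T₀ T₁, ∀ t ∈ Icc T₀ T₁, |s - e| < δ → |t - e| < δ → s ≤ t →
      |γ₀| / 2 * (t - s) ≤ |g t - g s| := by
    intro s hs t ht hse hte hst
    have hint : IntervalIntegrable γ volume s t :=
      (intervalIntegrable_iff_integrableOn_Icc_of_le hst).2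
        (hγ.mono_set (Icc_subset_Icc hs.1 ht.2))
    have h2 : ∫ _τ in s..t, |γ₀| / 2 ≤ ∫ τ in s..t, (SignType.sign γ₀ : ℝ) * γ τ := by
      refine intervalIntegral.integral_mono_ae_restrict hst (by simp) (hint.const_mul _) ?_
      filter_upwards [ae_restrict_mem measurableSet_Icc, ae_restrict_of_ae hW] with τ hτ hτW
      refine hUW τ ⟨hball ⟨?_, Icc_subset_Icc hs.1 ht.2 hτ⟩, hτW⟩
      rw [Metric.mem_ball, Real.dist_eq, abs_lt]
      rw [abs_lt] at hse hte
      constructor <;> linarith [hτ.1, hτ.2]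
    rw [intervalIntegral.integral_const, intervalIntegral.integral_const_mul, ← hg s hs t ht,
      smul_eq_mul] at h2
    calc _ = (t - s) * (|γ₀| / 2) := by ring
      _ ≤ _ := h2
      _ ≤ |(SignType.sign γ₀ : ℝ) * (g t - g s)| := le_abs_self _
      _ ≤ _ := by
        rw [abs_mul]
        refine mul_le_of_le_one_left (abs_nonneg _) ?_
        rcases SignType.sign γ₀ <;> simp
  refine ⟨|γ₀| / 2, by positivity, δ, hδ, fun s hs t ht hse hte => ?_⟩
  rcases le_total s t with hst | hst
  · rw [abs_of_nonneg (sub_nonneg.2 hst)]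
    exact hle s hs t ht hse hte hst
  · rw [abs_sub_comm t s, abs_sub_comm (g t), abs_of_nonneg (sub_nonneg.2 hst)]
    exact hle t ht s hs hte hse hst

/-- A real number that bounds below all difference quotients at `0` has to vanish. -/
theorem eq_zero_of_forall_eventually_nonneg {D : ℝ}
    (h : ∀ ε > 0, ∀ᶠ e : ℝ in 𝓝 0, 0 ≤ e * D + ε * |e|) : D = 0 := by
  by_contra hD
  have hp : 0 < |D| := abs_pos.2 hD
  obtain ⟨δ, hδ, H⟩ := Metric.eventually_nhds_iff.1 (h (|D| / 2) (by positivity))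
  rcases lt_or_gt_of_ne hD with hD | hD
  · have := H (y := δ / 2) (by rw [Real.dist_eq, sub_zero, abs_of_pos (by positivity)]; linarith)
    rw [abs_of_neg hD, abs_of_pos (by positivity)] at this
    nlinarith
  · have := H (y := -(δ / 2)) (by
      rw [Real.dist_eq, sub_zero, abs_neg, abs_of_pos (by positivity)]; linarith)
    rw [abs_of_pos hD, abs_neg, abs_of_pos (by positivity : 0 < δ / 2)] at this
    nlinarith

/-- Dependent choice backwards along `Fin (N + 1)`. -/
theorem exists_backward_chain {N : ℕ} {D : Fin (N + 1) → Type*} {Good : ∀ i, D i → Prop}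
    {Link : ∀ j : Fin N, D j.castSucc → D j.succ → Prop} (hlast : ∃ d, Good (Fin.last N) d)
    (hstep : ∀ (j : Fin N) (d : D j.succ), Good j.succ d →
      ∃ d' : D j.castSucc, Good j.castSucc d' ∧ Link j d' d) :
    ∃ f : ∀ i, D i, (∀ i, Good i (f i)) ∧ ∀ j : Fin N, Link j (f j.castSucc) (f j.succ) := by
  choose nxt hnxt using hstep
  let F : ∀ i, {d : D i // Good i d} := fun i =>
    Fin.reverseInduction (motive := fun i => {d : D i // Good i d})
      ⟨hlast.choose, hlast.choose_spec⟩ (fun j d => ⟨nxt j d.1 d.2, (hnxt j d.1 d.2).1⟩) i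
  refine ⟨fun i => (F i).1, fun i => (F i).2, fun j => ?_⟩
  have : F j.castSucc = ⟨nxt j (F j.succ).1 (F j.succ).2, (hnxt j _ (F j.succ).2).1⟩ :=
    Fin.reverseInduction_castSucc ..
  change Link j (F j.castSucc).1 _
  rw [this]
  exact (hnxt j _ (F j.succ).2).2

/-! ### Calculus of matrix valued functions -/

section MatrixCalculus

variable {n k l : ℕ} {s : Set ℝ} {t : ℝ}

theorem hasDerivWithinAt_matrix_mul {X : ℝ → Matrix (Fin n) (Fin k) ℝ}
    {Y : ℝ → Matrix (Fin k) (Fin l) ℝ} {X' : Matrix (Fin n) (Fin k) ℝ}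
    {Y' : Matrix (Fin k) (Fin l) ℝ}
    (hX : ∀ a b, HasDerivWithinAt (fun t => X t a b) (X' a b) s t)
    (hY : ∀ a b, HasDerivWithinAt (fun t => Y t a b) (Y' a b) s t) (a : Fin n) (b : Fin l) :
    HasDerivWithinAt (fun t => (X t * Y t) a b) ((X' * Y t + X t * Y') a b) s t := by
  have := HasDerivWithinAt.fun_sum (u := Finset.univ) (fun i _ => (hX a i).mul (hY i b))
  simpa [Matrix.mul_apply, Finset.sum_add_distrib] using this

theorem hasDerivWithinAt_mulVec {X : ℝ → Matrix (Fin n) (Fin k) ℝ} {y : ℝ → Fin k → ℝ}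
    {X' : Matrix (Fin n) (Fin k) ℝ} {y' : Fin k → ℝ}
    (hX : ∀ a b, HasDerivWithinAt (fun t => X t a b) (X' a b) s t)
    (hy : HasDerivWithinAt y y' s t) :
    HasDerivWithinAt (fun t => X t *ᵥ y t) (X' *ᵥ y t + X t *ᵥ y') s t := by
  rw [hasDerivWithinAt_pi] at hy ⊢
  intro a
  have := HasDerivWithinAt.fun_sum (u := Finset.univ) (fun i _ => (hX a i).mul (hy i))
  simpa [Matrix.mulVec, dotProduct, Finset.sum_add_distrib] using this

theorem hasDerivWithinAt_dotProduct {x y : ℝ → Fin n → ℝ} {x' y' : Fin n → ℝ}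
    (hx : HasDerivWithinAt x x' s t) (hy : HasDerivWithinAt y y' s t) :
    HasDerivWithinAt (fun t => x t ⬝ᵥ y t) (x' ⬝ᵥ y t + x t ⬝ᵥ y') s t := by
  rw [hasDerivWithinAt_pi] at hx hy
  have := HasDerivWithinAt.fun_sum (u := Finset.univ) (fun i _ => (hx i).mul (hy i))
  simpa [dotProduct, Finset.sum_add_distrib] using this

theorem differentiableWithinAt_det {X : ℝ → Matrix (Fin n) (Fin n) ℝ}
    (hX : ∀ a b, DifferentiableWithinAt ℝ (fun t => X t a b) s t) :
    DifferentiableWithinAt ℝ (fun t => (X t).det) s t := by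
  simp only [Matrix.det_apply]
  fun_prop

theorem differentiableWithinAt_matrix_inv {X : ℝ → Matrix (Fin n) (Fin n) ℝ}
    (hX : ∀ a b, DifferentiableWithinAt ℝ (fun t => X t a b) s t) (h0 : (X t).det ≠ 0)
    (a b : Fin n) : DifferentiableWithinAt ℝ (fun t => (X t)⁻¹ a b) s t := by
  simp only [Matrix.inv_def, Ring.inverse_eq_inv', Matrix.smul_apply, smul_eq_mul,
    Matrix.adjugate_apply]
  refine ((differentiableWithinAt_det hX).inv h0).mul (differentiableWithinAt_det fun i j => ?_)
  by_cases h : i = b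
  · subst h
    simp only [Matrix.updateRow_self]
    exact differentiableWithinAt_const _
  · simpa [h, Matrix.updateRow_apply] using hX _ _

/-- Multiplication by a matrix as a continuous linear map. -/
noncomputable def mulVecCLM (M : Matrix (Fin n) (Fin k) ℝ) : (Fin k → ℝ) →L[ℝ] (Fin n → ℝ) :=
  (Matrix.mulVecLin M).toContinuousLinearMap

@[simp] theorem mulVecCLM_apply (M : Matrix (Fin n) (Fin k) ℝ) (v : Fin k → ℝ) :
    mulVecCLM M v = M *ᵥ v := rfl

theorem continuousOn_mulVecCLM {M : ℝ → Matrix (Fin n) (Fin k) ℝ} (hM : ContinuousOn M s) :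
    ContinuousOn (fun t => mulVecCLM (M t)) s := by
  rw [continuousOn_clm_apply]
  intro v
  simp only [mulVecCLM_apply]
  fun_prop

theorem dotProduct_mulVec_transpose (M : Matrix (Fin n) (Fin k) ℝ) (x : Fin n → ℝ)
    (y : Fin k → ℝ) : (Mᵀ *ᵥ x) ⬝ᵥ y = x ⬝ᵥ (M *ᵥ y) := by
  rw [Matrix.mulVec_transpose, Matrix.dotProduct_mulVec]

end MatrixCalculus

/-! ### The matrix Riccati equation -/

section Riccati

variable {n : ℕ} {A S L : ℝ → Matrix (Fin n) (Fin n) ℝ} {a b : ℝ}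

/-- The linear Hamiltonian vector field whose flow linearizes the Riccati equation. -/
noncomputable def hamiltonianCLM (A S L : Matrix (Fin n) (Fin n) ℝ) :
    ((Fin n → ℝ) × (Fin n → ℝ)) →L[ℝ] ((Fin n → ℝ) × (Fin n → ℝ)) :=
  ((mulVecCLM A).comp (.fst ℝ (Fin n → ℝ) (Fin n → ℝ))
    - (mulVecCLM S).comp (.snd ℝ (Fin n → ℝ) (Fin n → ℝ))).prod
    (-((mulVecCLM L).comp (.fst ℝ (Fin n → ℝ) (Fin n → ℝ)))
      - (mulVecCLM Aᵀ).comp (.snd ℝ (Fin n → ℝ) (Fin n → ℝ)))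

@[simp] theorem hamiltonianCLM_apply (A S L : Matrix (Fin n) (Fin n) ℝ)
    (z : (Fin n → ℝ) × (Fin n → ℝ)) :
    hamiltonianCLM A S L z = (A *ᵥ z.1 - S *ᵥ z.2, -(L *ᵥ z.1) - Aᵀ *ᵥ z.2) := rfl

theorem continuousOn_hamiltonianCLM {s : Set ℝ} (hA : ContinuousOn A s) (hS : ContinuousOn S s)
    (hL : ContinuousOn L s) : ContinuousOn (fun t => hamiltonianCLM (A t) (S t) (L t)) s := by
  rw [continuousOn_clm_apply]
  intro v
  simp only [hamiltonianCLM_apply]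
  fun_prop

theorem dotProduct_mulVec_self_nonneg {M : Matrix (Fin n) (Fin n) ℝ} (hM : M.PosSemidef)
    (x : Fin n → ℝ) : 0 ≤ x ⬝ᵥ (M *ᵥ x) := by
  simpa using hM.dotProduct_mulVec_nonneg x

/-- Along the linear Hamiltonian flow the pairing of state and adjoint does not increase. -/
theorem antitoneOn_pairing (hSp : ∀ t ∈ Icc a b, (S t).PosSemidef)
    (hLp : ∀ t ∈ Icc a b, (L t).PosSemidef) {x y : ℝ → Fin n → ℝ}
    (hx : ∀ t ∈ Icc a b, HasDerivWithinAt x (A t *ᵥ x t - S t *ᵥ y t) (Icc a b) t)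
    (hy : ∀ t ∈ Icc a b, HasDerivWithinAt y (-(L t *ᵥ x t) - (A t)ᵀ *ᵥ y t) (Icc a b) t) :
    (∀ t ∈ Icc a b, HasDerivWithinAt (fun t => x t ⬝ᵥ y t)
      (-(y t ⬝ᵥ (S t *ᵥ y t)) - x t ⬝ᵥ (L t *ᵥ x t)) (Icc a b) t) ∧
    AntitoneOn (fun t => x t ⬝ᵥ y t) (Icc a b) := by
  have hd : ∀ t ∈ Icc a b, HasDerivWithinAt (fun t => x t ⬝ᵥ y t)
      (-(y t ⬝ᵥ (S t *ᵥ y t)) - x t ⬝ᵥ (L t *ᵥ x t)) (Icc a b) t := by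
    intro t ht
    have h := hasDerivWithinAt_dotProduct (hx t ht) (hy t ht)
    convert h using 1
    have e1 : x t ⬝ᵥ ((A t)ᵀ *ᵥ y t) = (A t *ᵥ x t) ⬝ᵥ y t := by
      rw [dotProduct_comm, dotProduct_mulVec_transpose, dotProduct_comm]
    rw [sub_dotProduct, dotProduct_sub, dotProduct_neg, e1, dotProduct_comm (S t *ᵥ y t)]
    ring
  refine ⟨hd, antitoneOn_of_deriv_nonpos (convex_Icc a b)
    (fun t ht => (hd t ht).continuousWithinAt) (fun t ht => ?_) (fun t ht => ?_)⟩
  · rw [interior_Icc] at ht ⊢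
    exact ((hd t (Ioo_subset_Icc_self ht)).mono Ioo_subset_Icc_self).differentiableWithinAt
  · rw [interior_Icc] at ht
    rw [((hd t (Ioo_subset_Icc_self ht)).hasDerivAt (Icc_mem_nhds ht.1 ht.2)).deriv]
    linarith [dotProduct_mulVec_self_nonneg (hSp t (Ioo_subset_Icc_self ht)) (y t),
      dotProduct_mulVec_self_nonneg (hLp t (Ioo_subset_Icc_self ht)) (x t)]

/-- If the state of the linear Hamiltonian flow vanishes at one time, and the pairing of state and
adjoint is nonnegative at the final time, then the final state vanishes: the adjoint no longer
acts on the state. -/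
theorem state_eq_zero_of_pairing (hA : ContinuousOn A (Icc a b))
    (hSp : ∀ t ∈ Icc a b, (S t).PosSemidef)
    (hLp : ∀ t ∈ Icc a b, (L t).PosSemidef) {x y : ℝ → Fin n → ℝ}
    (hx : ∀ t ∈ Icc a b, HasDerivWithinAt x (A t *ᵥ x t - S t *ᵥ y t) (Icc a b) t)
    (hy : ∀ t ∈ Icc a b, HasDerivWithinAt y (-(L t *ᵥ x t) - (A t)ᵀ *ᵥ y t) (Icc a b) t)
    (hab : a < b) (ha : x a = 0) (hb : 0 ≤ x b ⬝ᵥ y b) : x b = 0 := by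
  obtain ⟨hd, hanti⟩ := antitoneOn_pairing hSp hLp hx hy
  have hzero : ∀ t ∈ Icc a b, x t ⬝ᵥ y t = 0 := by
    intro t ht
    have h1 := hanti (left_mem_Icc.2 hab.le) ht ht.1
    have h2 := hanti ht (right_mem_Icc.2 hab.le) ht.2
    simp only [ha, zero_dotProduct] at h1 h2
    linarith
  have hSy : ∀ t ∈ Icc a b, S t *ᵥ y t = 0 := by
    intro t ht
    have h1 : HasDerivWithinAt (fun t => x t ⬝ᵥ y t) 0 (Icc a b) t :=
      (hasDerivWithinAt_const t _ (0 : ℝ)).congr hzero (hzero t ht)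
    have h2 := (uniqueDiffOn_Icc hab t ht).eq_deriv _ h1 (hd t ht)
    have h3 := dotProduct_mulVec_self_nonneg (hSp t ht) (y t)
    have h4 := dotProduct_mulVec_self_nonneg (hLp t ht) (x t)
    have h5 : star (y t) ⬝ᵥ (S t *ᵥ y t) = 0 := by
      rw [star_trivial]; linarith
    exact (hSp t ht).dotProduct_mulVec_zero_iff _ |>.1 h5
  obtain ⟨M, hM⟩ : ∃ M, ∀ t ∈ Icc a b, ‖mulVecCLM (A t)‖ ≤ M :=
    isCompact_Icc.exists_bound_of_continuousOn (continuousOn_mulVecCLM hA)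
  refine eq_zero_of_abs_deriv_le_mul_abs_self_of_eq_zero_right (f := x)
    (f' := fun t => A t *ᵥ x t) (K := M) (a := a) (b := b)
    (fun t ht => (hx t ht).continuousWithinAt) (fun t ht => ?_) ha (fun t ht => ?_) b
    (right_mem_Icc.2 hab.le)
  · have h := hx t (Ico_subset_Icc_self ht)
    rw [hSy t (Ico_subset_Icc_self ht), sub_zero] at h
    exact h.mono_of_mem_nhdsWithin (Icc_mem_nhdsGE_of_mem ht)
  · refine ((mulVecCLM (A t)).le_opNorm (x t)).trans ?_
    exact mul_le_mul_of_nonneg_right (hM t (Ico_subset_Icc_self ht)) (norm_nonneg _)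

/-- Global solvability of the matrix Riccati equation, backwards from a terminal value with
nonnegative quadratic form; this property persists. The solution is `Y X⁻¹` for a matrix solution
`(X, Y)` of the linear Hamiltonian system. -/
theorem exists_riccati (hab : a < b) (hA : ContinuousOn A (Icc a b))
    (hS : ContinuousOn S (Icc a b)) (hL : ContinuousOn L (Icc a b))
    (hSp : ∀ t ∈ Icc a b, (S t).PosSemidef) (hLp : ∀ t ∈ Icc a b, (L t).PosSemidef)
    {G : Matrix (Fin n) (Fin n) ℝ} (hG : ∀ v, 0 ≤ v ⬝ᵥ (G *ᵥ v)) :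
    ∃ K : ℝ → Matrix (Fin n) (Fin n) ℝ, K b = G ∧ (∀ v, 0 ≤ v ⬝ᵥ (K a *ᵥ v)) ∧
      ∀ t ∈ Icc a b, ∀ i j, HasDerivWithinAt (fun τ => K τ i j)
        ((-L t - K t * A t - (A t)ᵀ * K t + K t * S t * K t) i j) (Icc a b) t := by
  have hb : b ∈ Icc a b := right_mem_Icc.2 hab.le
  have ha : a ∈ Icc a b := left_mem_Icc.2 hab.le
  choose z hzb hz using fun j : Fin n => exists_solution_linear (g := fun _ => 0) hb
    (continuousOn_hamiltonianCLM hA hS hL) continuousOn_const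
    ((1 : Matrix (Fin n) (Fin n) ℝ).col j, G.col j)
  let X : ℝ → Matrix (Fin n) (Fin n) ℝ := fun t => Matrix.of fun i j => (z j t).1 i
  let Y : ℝ → Matrix (Fin n) (Fin n) ℝ := fun t => Matrix.of fun i j => (z j t).2 i
  have hXb : X b = 1 := by ext i j; simp [X, hzb]
  have hYb : Y b = G := by ext i j; simp [Y, hzb]
  have hX : ∀ t ∈ Icc a b, ∀ i j, HasDerivWithinAt (fun τ => X τ i j)
      ((A t * X t - S t * Y t) i j) (Icc a b) t := by
    intro t ht i j
    have h := (hasDerivWithinAt_pi.1 (hz j t ht).fst) i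
    simpa [X, Y, Matrix.mul_apply, Matrix.mulVec, dotProduct] using h
  have hY : ∀ t ∈ Icc a b, ∀ i j, HasDerivWithinAt (fun τ => Y τ i j)
      ((-(L t * X t) - (A t)ᵀ * Y t) i j) (Icc a b) t := by
    intro t ht i j
    have h := (hasDerivWithinAt_pi.1 (hz j t ht).snd) i
    simpa [X, Y, Matrix.mul_apply, Matrix.mulVec, dotProduct] using h
  have hXv : ∀ v, ∀ t ∈ Icc a b, HasDerivWithinAt (fun τ => X τ *ᵥ v)
      (A t *ᵥ (X t *ᵥ v) - S t *ᵥ (Y t *ᵥ v)) (Icc a b) t := by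
    intro v t ht
    have h := hasDerivWithinAt_mulVec (hX t ht) (hasDerivWithinAt_const t (Icc a b) v)
    simpa [Matrix.sub_mulVec] using h
  have hYv : ∀ v, ∀ t ∈ Icc a b, HasDerivWithinAt (fun τ => Y τ *ᵥ v)
      (-(L t *ᵥ (X t *ᵥ v)) - (A t)ᵀ *ᵥ (Y t *ᵥ v)) (Icc a b) t := by
    intro v t ht
    have h := hasDerivWithinAt_mulVec (hY t ht) (hasDerivWithinAt_const t (Icc a b) v)
    simpa [Matrix.sub_mulVec, Matrix.neg_mulVec] using h
  -- a vector in the kernel of `X t` gives a flow line whose state vanishes at `t`, hence at `b`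
  have hdet : ∀ t ∈ Icc a b, (X t).det ≠ 0 := by
    intro t ht h0
    obtain ⟨v, hv, hv0⟩ := Matrix.exists_mulVec_eq_zero_iff.2 h0
    apply hv
    have hXbv : X b *ᵥ v = v := by rw [hXb, Matrix.one_mulVec]
    rcases eq_or_lt_of_le ht.2 with rfl | htb
    · rw [← hXbv, hv0]
    · have hsub : Icc t b ⊆ Icc a b := Icc_subset_Icc_left ht.1
      rw [← hXbv]
      refine state_eq_zero_of_pairing (hA.mono hsub) (fun τ hτ => hSp τ (hsub hτ))
        (fun τ hτ => hLp τ (hsub hτ)) (fun τ hτ => (hXv v τ (hsub hτ)).mono hsub)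
        (fun τ hτ => (hYv v τ (hsub hτ)).mono hsub) htb hv0 ?_
      rw [hXbv, hYb]
      exact hG v
  have hXZ : ∀ t ∈ Icc a b, X t * (X t)⁻¹ = 1 := fun t ht =>
    Matrix.mul_nonsing_inv _ (isUnit_iff_ne_zero.2 (hdet t ht))
  have hZX : ∀ t ∈ Icc a b, (X t)⁻¹ * X t = 1 := fun t ht =>
    Matrix.nonsing_inv_mul _ (isUnit_iff_ne_zero.2 (hdet t ht))
  refine ⟨fun t => Y t * (X t)⁻¹, by simp [hXb, hYb], fun v => ?_, fun t ht i j => ?_⟩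
  · set w := (X a)⁻¹ *ᵥ v
    have hw : X a *ᵥ w = v := by rw [Matrix.mulVec_mulVec, hXZ a ha, Matrix.one_mulVec]
    have h := (antitoneOn_pairing hSp hLp (hXv w) (hYv w)).2 ha hb hab.le
    simp only [hXb, hYb, Matrix.one_mulVec] at h
    rw [← Matrix.mulVec_mulVec]
    change 0 ≤ v ⬝ᵥ (Y a *ᵥ w)
    rw [← hw]
    exact (hG w).trans h
  · let Z' : Matrix (Fin n) (Fin n) ℝ := Matrix.of fun i j =>
      derivWithin (fun τ => (X τ)⁻¹ i j) (Icc a b) t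
    have hZ : ∀ i j, HasDerivWithinAt (fun τ => (X τ)⁻¹ i j) (Z' i j) (Icc a b) t :=
      fun i j => (differentiableWithinAt_matrix_inv
        (fun i j => (hX t ht i j).differentiableWithinAt) (hdet t ht) i j).hasDerivWithinAt
    have hprod : (A t * X t - S t * Y t) * (X t)⁻¹ + X t * Z' = 0 := by
      ext i j
      have h1 := hasDerivWithinAt_matrix_mul (hX t ht) hZ i j
      have h2 : HasDerivWithinAt (fun τ => (X τ * (X τ)⁻¹) i j) 0 (Icc a b) t :=
        (hasDerivWithinAt_const t _ ((1 : Matrix (Fin n) (Fin n) ℝ) i j)).congr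
          (fun τ hτ => by rw [hXZ τ hτ]) (by rw [hXZ t ht])
      exact (uniqueDiffOn_Icc hab t ht).eq_deriv _ h1 h2
    have hZ' : Z' = -((X t)⁻¹ * ((A t * X t - S t * Y t) * (X t)⁻¹)) := by
      have h := congrArg (fun M => (X t)⁻¹ * M) hprod
      simp only [mul_add, ← mul_assoc, hZX t ht, one_mul, mul_zero] at h
      rw [eq_neg_iff_add_eq_zero, add_comm]
      simpa [mul_assoc] using h
    convert hasDerivWithinAt_matrix_mul (hY t ht) hZ i j using 1
    refine congrFun (congrFun ?_ i) j
    have e : A t * X t * (X t)⁻¹ = A t := by rw [mul_assoc, hXZ t ht, mul_one]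
    have e' : L t * X t * (X t)⁻¹ = L t := by rw [mul_assoc, hXZ t ht, mul_one]
    rw [hZ', sub_mul, sub_mul, e, neg_mul, e']
    noncomm_ring

end Riccati

/-! ### The coefficients, the cost and the Hamiltonian -/

namespace Problem

variable {Q E : Type*} {S : Problem Q E} {q : Q} {t : ℝ}

theorem Valid.continuousOn_A (hS : S.Valid) (q : Q) : ContinuousOn (S.A q) (Icc S.t₀ S.tf) :=
  continuousOn_pi.2 fun a => continuousOn_pi.2 fun b => (hS.contDiff_A q a b).continuousOn

theorem Valid.continuousOn_B (hS : S.Valid) (q : Q) : ContinuousOn (S.B q) (Icc S.t₀ S.tf) :=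
  continuousOn_pi.2 fun a => continuousOn_pi.2 fun b => (hS.contDiff_B q a b).continuousOn

theorem Valid.continuousOn_F (hS : S.Valid) (q : Q) : ContinuousOn (S.F q) (Icc S.t₀ S.tf) :=
  continuousOn_pi.2 fun a => (hS.contDiff_F q a).continuousOn

theorem Valid.continuousOn_L (hS : S.Valid) (q : Q) : ContinuousOn (S.L q) (Icc S.t₀ S.tf) :=
  continuousOn_pi.2 fun a => continuousOn_pi.2 fun b => (hS.contDiff_L q a b).continuousOn

theorem Valid.continuousOn_R (hS : S.Valid) (q : Q) : ContinuousOn (S.R q) (Icc S.t₀ S.tf) :=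
  continuousOn_pi.2 fun a => continuousOn_pi.2 fun b => (hS.contDiff_R q a b).continuousOn

theorem Valid.continuousOn_R_inv (hS : S.Valid) (q : Q) :
    ContinuousOn (fun t => (S.R q t)⁻¹) (Icc S.t₀ S.tf) := by
  have h : ∀ t ∈ Icc S.t₀ S.tf, (S.R q t).det ≠ 0 := fun t ht => (hS.posDef_R q t ht).det_pos.ne'
  have hR := hS.continuousOn_R q
  simp only [Matrix.inv_def, Ring.inverse_eq_inv']
  fun_prop (disch := assumption)

variable (S) in
/-- The control that minimizes the Hamiltonian for the adjoint `lam`. -/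
noncomputable def law (q : Q) (t : ℝ) (lam : Fin (S.n q) → ℝ) : Fin (S.k q) → ℝ :=
  -(((S.R q t)⁻¹ * (S.B q t)ᵀ) *ᵥ lam)

theorem Valid.continuousOn_law (hS : S.Valid) {I : Set ℝ} (hI : I ⊆ Icc S.t₀ S.tf)
    {lam : ℝ → Fin (S.n q) → ℝ} (hl : ContinuousOn lam I) :
    ContinuousOn (fun t => S.law q t (lam t)) I := by
  have hR := (hS.continuousOn_R_inv q).mono hI
  have hB := (hS.continuousOn_B q).mono hI
  unfold law
  fun_prop

theorem Valid.continuousOn_field (hS : S.Valid) {I : Set ℝ} (hI : I ⊆ Icc S.t₀ S.tf)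
    {x : ℝ → Fin (S.n q) → ℝ} {u : ℝ → Fin (S.k q) → ℝ} (hx : ContinuousOn x I)
    (hu : ContinuousOn u I) : ContinuousOn (fun t => S.field q t (x t) (u t)) I := by
  have hA := (hS.continuousOn_A q).mono hI
  have hB := (hS.continuousOn_B q).mono hI
  have hF := (hS.continuousOn_F q).mono hI
  unfold field
  fun_prop

theorem Valid.continuousOn_runningCost (hS : S.Valid) {I : Set ℝ} (hI : I ⊆ Icc S.t₀ S.tf)
    {x : ℝ → Fin (S.n q) → ℝ} {u : ℝ → Fin (S.k q) → ℝ} (hx : ContinuousOn x I)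
    (hu : ContinuousOn u I) : ContinuousOn (fun t => S.runningCost q t (x t) (u t)) I := by
  have hL := (hS.continuousOn_L q).mono hI
  have hR := (hS.continuousOn_R q).mono hI
  have hr := (hS.continuous_r q).mono hI
  unfold runningCost
  fun_prop

theorem dotProduct_mulVec_comm_of_isHermitian {n : ℕ} {M : Matrix (Fin n) (Fin n) ℝ}
    (hM : M.IsHermitian) (x y : Fin n → ℝ) : x ⬝ᵥ (M *ᵥ y) = (M *ᵥ x) ⬝ᵥ y := by
  have hT : Mᵀ = M := by simpa using hM.eq
  rw [← dotProduct_mulVec_transpose, hT]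

/-- Second order expansion of a quadratic form. -/
theorem quadratic_expansion {n : ℕ} {M : Matrix (Fin n) (Fin n) ℝ} (hM : M.IsHermitian)
    (x y : Fin n → ℝ) : (x + y) ⬝ᵥ (M *ᵥ (x + y)) =
      x ⬝ᵥ (M *ᵥ x) + 2 * ((M *ᵥ x) ⬝ᵥ y) + y ⬝ᵥ (M *ᵥ y) := by
  rw [mulVec_add, add_dotProduct, dotProduct_add, dotProduct_add,
    dotProduct_mulVec_comm_of_isHermitian hM x y, dotProduct_comm y (M *ᵥ x)]
  ring

theorem Valid.runningCost_add (hS : S.Valid) (ht : t ∈ Icc S.t₀ S.tf) (x y : Fin (S.n q) → ℝ)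
    (u v : Fin (S.k q) → ℝ) : S.runningCost q t (x + y) (u + v) =
      S.runningCost q t x u + ((S.L q t *ᵥ (x - S.r q t)) ⬝ᵥ y + (S.R q t *ᵥ u) ⬝ᵥ v)
        + (1 / 2 * (y ⬝ᵥ (S.L q t *ᵥ y)) + 1 / 2 * (v ⬝ᵥ (S.R q t *ᵥ v))) := by
  unfold runningCost
  rw [show x + y - S.r q t = (x - S.r q t) + y by abel,
    quadratic_expansion (hS.posSemidef_L q t ht).isHermitian,
    quadratic_expansion (hS.posDef_R q t ht).isHermitian]
  ring

theorem field_add (x y : Fin (S.n q) → ℝ) (u v : Fin (S.k q) → ℝ) :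
    S.field q t (x + y) (u + v) = S.field q t x u + (S.A q t *ᵥ y + S.B q t *ᵥ v) := by
  unfold field
  rw [mulVec_add, mulVec_add]
  abel

theorem Valid.R_mulVec_law (hS : S.Valid) (ht : t ∈ Icc S.t₀ S.tf) (lam : Fin (S.n q) → ℝ) :
    S.R q t *ᵥ S.law q t lam = -((S.B q t)ᵀ *ᵥ lam) := by
  rw [law, mulVec_neg, mulVec_mulVec, ← Matrix.mul_assoc,
    Matrix.mul_nonsing_inv _ (isUnit_iff_ne_zero.2 (hS.posDef_R q t ht).det_pos.ne'),
    Matrix.one_mul]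

theorem Valid.eq_law_of_R_mulVec (hS : S.Valid) (ht : t ∈ Icc S.t₀ S.tf) {lam : Fin (S.n q) → ℝ}
    {u : Fin (S.k q) → ℝ} (h : S.R q t *ᵥ u + (S.B q t)ᵀ *ᵥ lam = 0) : u = S.law q t lam := by
  have h1 := congrArg (fun v => (S.R q t)⁻¹ *ᵥ v) h
  simp only [mulVec_add, mulVec_mulVec, mulVec_zero, Matrix.nonsing_inv_mul _
    (isUnit_iff_ne_zero.2 (hS.posDef_R q t ht).det_pos.ne'), one_mulVec] at h1
  rw [law]
  exact eq_neg_of_add_eq_zero_left h1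

/-- Completion of the square in the Hamiltonian. -/
theorem Valid.hamiltonian_eq (hS : S.Valid) (ht : t ∈ Icc S.t₀ S.tf) (x lam : Fin (S.n q) → ℝ)
    (u : Fin (S.k q) → ℝ) : S.hamiltonian q t x lam u = S.minHamiltonian q t x lam +
      1 / 2 * ((u - S.law q t lam) ⬝ᵥ (S.R q t *ᵥ (u - S.law q t lam))) := by
  set w := u - S.law q t lam with hw
  have hu : u = S.law q t lam + w := by rw [hw]; abel
  have e1 : (S.law q t lam) ⬝ᵥ (S.R q t *ᵥ S.law q t lam) =
      -(lam ⬝ᵥ (S.B q t *ᵥ S.law q t lam)) := by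
    rw [hS.R_mulVec_law ht, dotProduct_neg, dotProduct_comm, dotProduct_mulVec_transpose]
  have e2 : (S.B q t * (S.R q t)⁻¹ * (S.B q t)ᵀ) *ᵥ lam = -(S.B q t *ᵥ S.law q t lam) := by
    rw [law, mulVec_neg, neg_neg, mulVec_mulVec, Matrix.mul_assoc]
  rw [hu, hamiltonian, minHamiltonian, field, runningCost,
    quadratic_expansion (hS.posDef_R q t ht).isHermitian, e1, hS.R_mulVec_law ht, e2,
    mulVec_add]
  simp only [dotProduct_add, dotProduct_sub, dotProduct_smul, smul_eq_mul, dotProduct_neg,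
    neg_dotProduct, dotProduct_mulVec_transpose]
  ring

theorem Valid.hamiltonian_law (hS : S.Valid) (ht : t ∈ Icc S.t₀ S.tf) (x lam : Fin (S.n q) → ℝ) :
    S.hamiltonian q t x lam (S.law q t lam) = S.minHamiltonian q t x lam := by
  simp [hS.hamiltonian_eq ht]

theorem Valid.isLeast_hamiltonian (hS : S.Valid) (ht : t ∈ Icc S.t₀ S.tf)
    (x lam : Fin (S.n q) → ℝ) :
    IsLeast (range fun v => S.hamiltonian q t x lam v) (S.minHamiltonian q t x lam) := by
  refine ⟨⟨_, hS.hamiltonian_law ht x lam⟩, ?_⟩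
  rintro _ ⟨v, rfl⟩
  simp only [hS.hamiltonian_eq ht]
  linarith [dotProduct_mulVec_self_nonneg (hS.posDef_R q t ht).posSemidef (v - S.law q t lam)]

theorem Valid.posSemidef_gain (hS : S.Valid) (ht : t ∈ Icc S.t₀ S.tf) :
    (S.B q t * (S.R q t)⁻¹ * (S.B q t)ᵀ).PosSemidef := by
  simpa using (hS.posDef_R q t ht).inv.posSemidef.mul_mul_conjTranspose_same (S.B q t)

theorem Valid.continuousOn_gain (hS : S.Valid) (q : Q) :
    ContinuousOn (fun t => S.B q t * (S.R q t)⁻¹ * (S.B q t)ᵀ) (Icc S.t₀ S.tf) := by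
  have hR := hS.continuousOn_R_inv q
  have hB := hS.continuousOn_B q
  fun_prop

theorem field_law (x lam : Fin (S.n q) → ℝ) : S.field q t x (S.law q t lam) =
    S.A q t *ᵥ x - (S.B q t * (S.R q t)⁻¹ * (S.B q t)ᵀ) *ᵥ lam + S.F q t := by
  rw [field, law, mulVec_neg, mulVec_mulVec, Matrix.mul_assoc, sub_eq_add_neg]

/-! ### Extremals -/

variable (S) in
/-- A solution of the canonical equations on `I`: a state and an adjoint such that the control
minimizing the Hamiltonian generates the state. -/
structure IsExtremalOn (q : Q) (I : Set ℝ) (x lam : ℝ → Fin (S.n q) → ℝ) : Prop where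
  state : ∀ t ∈ I, HasDerivWithinAt x (S.field q t (x t) (S.law q t (lam t))) I t
  adjoint : ∀ t ∈ I,
    HasDerivWithinAt lam (-((S.A q t)ᵀ *ᵥ lam t) - S.L q t *ᵥ (x t - S.r q t)) I t

namespace IsExtremalOn

variable {I : Set ℝ} {x lam : ℝ → Fin (S.n q) → ℝ}

theorem continuousOn_state (h : S.IsExtremalOn q I x lam) : ContinuousOn x I :=
  fun t ht => (h.state t ht).continuousWithinAt

theorem continuousOn_adjoint (h : S.IsExtremalOn q I x lam) : ContinuousOn lam I :=
  fun t ht => (h.adjoint t ht).continuousWithinAt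

/-- An extremal on a subinterval extends to the whole time interval of the problem. -/
theorem exists_extension (hS : S.Valid) {a b : ℝ} (hab : a ≤ b) (hI : Icc a b ⊆ Icc S.t₀ S.tf)
    (h : S.IsExtremalOn q (Icc a b) x lam) :
    ∃ x' lam', S.IsExtremalOn q (Icc S.t₀ S.tf) x' lam' ∧ EqOn x' x (Icc a b) ∧
      EqOn lam' lam (Icc a b) := by
  have hf := continuousOn_hamiltonianCLM (hS.continuousOn_A q) (hS.continuousOn_gain q)
    (hS.continuousOn_L q)
  have hg : ContinuousOn (fun t => (S.F q t, S.L q t *ᵥ S.r q t)) (Icc S.t₀ S.tf) := by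
    have h1 := hS.continuousOn_F q
    have h2 := hS.continuousOn_L q
    have h3 := hS.continuous_r q
    fun_prop
  have hb : b ∈ Icc a b := right_mem_Icc.2 hab
  obtain ⟨z, hzb, hz⟩ := exists_solution_linear (hI hb) hf hg (x b, lam b)
  have e1 : ∀ (t : ℝ) (y l : Fin (S.n q) → ℝ), S.field q t y (S.law q t l) =
      S.A q t *ᵥ y - (S.B q t * (S.R q t)⁻¹ * (S.B q t)ᵀ) *ᵥ l + S.F q t := fun t y l =>
    field_law y l
  have e2 : ∀ (t : ℝ) (y l : Fin (S.n q) → ℝ),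
      -((S.A q t)ᵀ *ᵥ l) - S.L q t *ᵥ (y - S.r q t) =
      -(S.L q t *ᵥ y) - (S.A q t)ᵀ *ᵥ l + S.L q t *ᵥ S.r q t := fun t y l => by
    rw [mulVec_sub]; abel
  have heq : EqOn z (fun t => (x t, lam t)) (Icc a b) := by
    refine eqOn_of_linear_of_eq_right (hf.mono hI) (fun t ht => (hz t (hI ht)).mono hI)
      (fun t ht => ?_) hzb
    have h1 := (h.state t ht).prodMk (h.adjoint t ht)
    rw [e1, e2] at h1
    exact h1
  refine ⟨fun t => (z t).1, fun t => (z t).2, ⟨fun t ht => ?_, fun t ht => ?_⟩,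
    fun t ht => by simp only [heq ht], fun t ht => by simp only [heq ht]⟩
  · rw [e1]; exact (hz t ht).fst
  · rw [e2]; exact (hz t ht).snd

end IsExtremalOn

theorem integral_eq_sub_of_hasDerivWithinAt_Icc {V : Type*} [NormedAddCommGroup V]
    [NormedSpace ℝ V] [CompleteSpace V] {f f' : ℝ → V} {T₀ T₁ a b : ℝ} (ha : a ∈ Icc T₀ T₁)
    (hb : b ∈ Icc T₀ T₁) (hab : a ≤ b)
    (hf : ∀ t ∈ Icc T₀ T₁, HasDerivWithinAt f (f' t) (Icc T₀ T₁) t)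
    (hf' : IntervalIntegrable f' volume a b) : ∫ t in a..b, f' t = f b - f a := by
  have hsub : Icc a b ⊆ Icc T₀ T₁ := Icc_subset_Icc ha.1 hb.2
  exact intervalIntegral.integral_eq_sub_of_hasDerivAt_of_le hab
    (fun t ht => ((hf t (hsub ht)).continuousWithinAt.mono hsub))
    (fun t ht => ((hf t (hsub (Ioo_subset_Icc_self ht))).mono hsub).hasDerivAt
      (Icc_mem_nhds ht.1 ht.2)) hf'

/-- Derivative of the pairing of an adjoint with a linearized state. -/
theorem hasDerivWithinAt_adjoint_dotProduct {I : Set ℝ} {x lam y : ℝ → Fin (S.n q) → ℝ}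
    {v : Fin (S.k q) → ℝ}
    (hl : HasDerivWithinAt lam (-((S.A q t)ᵀ *ᵥ lam t) - S.L q t *ᵥ (x t - S.r q t)) I t)
    (hy : HasDerivWithinAt y (S.A q t *ᵥ y t + S.B q t *ᵥ v) I t) :
    HasDerivWithinAt (fun t => lam t ⬝ᵥ y t)
      (((S.B q t)ᵀ *ᵥ lam t) ⬝ᵥ v - (S.L q t *ᵥ (x t - S.r q t)) ⬝ᵥ y t) I t := by
  convert hasDerivWithinAt_dotProduct hl hy using 1
  simp only [sub_dotProduct, neg_dotProduct, dotProduct_mulVec_transpose, dotProduct_add]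
  ring

/-- Exact cost of a perturbed extremal: the first order terms are the boundary terms of the pairing
with the adjoint. -/
theorem IsExtremalOn.integral_runningCost_add (hS : S.Valid) {x lam y : ℝ → Fin (S.n q) → ℝ}
    {v : ℝ → Fin (S.k q) → ℝ} (h : S.IsExtremalOn q (Icc S.t₀ S.tf) x lam)
    (hv : ContinuousOn v (Icc S.t₀ S.tf))
    (hy : ∀ t ∈ Icc S.t₀ S.tf,
      HasDerivWithinAt y (S.A q t *ᵥ y t + S.B q t *ᵥ v t) (Icc S.t₀ S.tf) t)
    {a b : ℝ} (ha : a ∈ Icc S.t₀ S.tf) (hb : b ∈ Icc S.t₀ S.tf) (hab : a ≤ b) :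
    ∫ t in a..b, S.runningCost q t (x t + y t) (S.law q t (lam t) + v t) =
      (∫ t in a..b, S.runningCost q t (x t) (S.law q t (lam t)))
      + lam a ⬝ᵥ y a - lam b ⬝ᵥ y b
      + ∫ t in a..b, (1 / 2 * (y t ⬝ᵥ (S.L q t *ᵥ y t)) + 1 / 2 * (v t ⬝ᵥ (S.R q t *ᵥ v t))) := by
  have hsub : uIcc a b ⊆ Icc S.t₀ S.tf := uIcc_subset_Icc ha hb
  have hx := h.continuousOn_state.mono hsub
  have hl := h.continuousOn_adjoint.mono hsub
  have hyc : ContinuousOn y (uIcc a b) := fun t ht =>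
    (hy t (hsub ht)).continuousWithinAt.mono hsub
  have hvc := hv.mono hsub
  have hL := (hS.continuousOn_L q).mono hsub
  have hR := (hS.continuousOn_R q).mono hsub
  have hB := (hS.continuousOn_B q).mono hsub
  have hr := (hS.continuous_r q).mono hsub
  have hc := (hS.continuousOn_runningCost hsub hx (hS.continuousOn_law hsub hl)).intervalIntegrable
    (μ := volume)
  have hpc : ContinuousOn (fun t => ((S.B q t)ᵀ *ᵥ lam t) ⬝ᵥ v t
      - (S.L q t *ᵥ (x t - S.r q t)) ⬝ᵥ y t) (uIcc a b) := by fun_prop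
  have hqc : ContinuousOn (fun t => 1 / 2 * (y t ⬝ᵥ (S.L q t *ᵥ y t))
      + 1 / 2 * (v t ⬝ᵥ (S.R q t *ᵥ v t))) (uIcc a b) := by fun_prop
  have hp := hpc.intervalIntegrable (μ := volume)
  have hq := hqc.intervalIntegrable (μ := volume)
  have hpair := integral_eq_sub_of_hasDerivWithinAt_Icc ha hb hab
    (fun t ht => hasDerivWithinAt_adjoint_dotProduct (h.adjoint t ht) (hy t ht)) hp
  have hcongr : ∫ t in a..b, S.runningCost q t (x t + y t) (S.law q t (lam t) + v t) =
      ∫ t in a..b, (S.runningCost q t (x t) (S.law q t (lam t))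
        - (((S.B q t)ᵀ *ᵥ lam t) ⬝ᵥ v t - (S.L q t *ᵥ (x t - S.r q t)) ⬝ᵥ y t)
        + (1 / 2 * (y t ⬝ᵥ (S.L q t *ᵥ y t)) + 1 / 2 * (v t ⬝ᵥ (S.R q t *ᵥ v t)))) := by
    refine intervalIntegral.integral_congr fun t ht => ?_
    simp only [hS.runningCost_add (hsub ht), hS.R_mulVec_law (hsub ht), neg_dotProduct]
    ring
  rw [hcongr, intervalIntegral.integral_add (hc.sub hp) hq, intervalIntegral.integral_sub hc hp,
    hpair]
  ring

/-! ### Essentially bounded functions -/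

section EssBounded

variable {μ : Measure ℝ}

theorem memLp_top_dotProduct {n : ℕ} {x y : ℝ → Fin n → ℝ} (hx : MemLp x ⊤ μ) (hy : MemLp y ⊤ μ) :
    MemLp (fun t => x t ⬝ᵥ y t) ⊤ μ := by
  simp only [dotProduct]
  exact memLp_finsetSum _ fun i _ => (hy.eval i).mul (hx.eval i)

theorem memLp_top_mulVec {n k : ℕ} {M : ℝ → Matrix (Fin n) (Fin k) ℝ} {y : ℝ → Fin k → ℝ}
    (hM : ∀ i, MemLp (fun t => M t i) ⊤ μ) (hy : MemLp y ⊤ μ) :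
    MemLp (fun t => M t *ᵥ y t) ⊤ μ :=
  memLp_pi_iff.2 fun i => memLp_top_dotProduct (hM i) hy

theorem memLp_top_of_continuousOn {n : ℕ} {x : ℝ → Fin n → ℝ} {a b : ℝ}
    (hx : ContinuousOn x (Icc a b)) : MemLp x ⊤ (volume.restrict (Icc a b)) := by
  obtain ⟨C, hC⟩ := isCompact_Icc.exists_bound_of_continuousOn hx
  exact memLp_top_of_bound (hx.aestronglyMeasurable measurableSet_Icc) C
    ((ae_restrict_mem measurableSet_Icc).mono hC)

theorem memLp_top_row_of_continuousOn {n k : ℕ} {M : ℝ → Matrix (Fin n) (Fin k) ℝ} {a b : ℝ}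
    (hM : ContinuousOn M (Icc a b)) (i : Fin n) :
    MemLp (fun t => M t i) ⊤ (volume.restrict (Icc a b)) :=
  memLp_top_of_continuousOn (continuousOn_pi.1 hM i)

end EssBounded

variable {a b : ℝ} {x : ℝ → Fin (S.n q) → ℝ} {u : ℝ → Fin (S.k q) → ℝ}

theorem Valid.memLp_field (hS : S.Valid) (hI : Icc a b ⊆ Icc S.t₀ S.tf)
    (hx : ContinuousOn x (Icc a b)) (hu : MemLp u ⊤ (volume.restrict (Icc a b))) :
    MemLp (fun t => S.field q t (x t) (u t)) ⊤ (volume.restrict (Icc a b)) := by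
  have hA := (hS.continuousOn_A q).mono hI
  have hB := (hS.continuousOn_B q).mono hI
  have hF := (hS.continuousOn_F q).mono hI
  exact ((memLp_top_mulVec (memLp_top_row_of_continuousOn hA) (memLp_top_of_continuousOn hx)).add
    (memLp_top_mulVec (memLp_top_row_of_continuousOn hB) hu)).add (memLp_top_of_continuousOn hF)

theorem Valid.memLp_runningCost (hS : S.Valid) (hI : Icc a b ⊆ Icc S.t₀ S.tf)
    (hx : ContinuousOn x (Icc a b)) (hu : MemLp u ⊤ (volume.restrict (Icc a b))) :
    MemLp (fun t => S.runningCost q t (x t) (u t)) ⊤ (volume.restrict (Icc a b)) := by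
  have hL := (hS.continuousOn_L q).mono hI
  have hR := (hS.continuousOn_R q).mono hI
  have hr := (hS.continuous_r q).mono hI
  have h1 : MemLp (fun t => x t - S.r q t) ⊤ (volume.restrict (Icc a b)) :=
    memLp_top_of_continuousOn (hx.sub hr)
  exact ((memLp_top_dotProduct h1
    (memLp_top_mulVec (memLp_top_row_of_continuousOn hL) h1)).const_mul _).add
    ((memLp_top_dotProduct hu (memLp_top_mulVec (memLp_top_row_of_continuousOn hR)
      hu)).const_mul _)

theorem intervalIntegrable_of_memLp_top {V : Type*} [NormedAddCommGroup V] {f : ℝ → V}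
    (hab : a ≤ b) (hf : MemLp f ⊤ (volume.restrict (Icc a b))) :
    IntervalIntegrable f volume a b :=
  (intervalIntegrable_iff_integrableOn_Icc_of_le hab).2 (hf.integrable le_top)

end Problem

/-! ### Segments, tails and splicing -/

namespace Problem

variable {Q E : Type*} (S : Problem Q E)

/-- The conditions on a single segment of an admissible execution. -/
structure SegmentOK (q : Q) (a b : ℝ) (u : ℝ → Fin (S.k q) → ℝ) (x : ℝ → Fin (S.n q) → ℝ) :
    Prop where
  lt : a < b
  control : MemLp u ⊤ (volume.restrict (Ico a b))
  continuous : ContinuousOn x (Icc a b)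
  dynamics : ∀ t ∈ Icc a b, x t = x a + ∫ τ in a..t, S.field q τ (x τ) (u τ)
  no_contact : ∀ t ∈ Ioo a b, ∀ r, ¬ S.OnManifold q r (x t)

/-- The control has an essential left limit at `b` with which the state `ζ` moves transversally to
the switching manifold towards `r`. -/
def TransversalAt (q : Q) (u : ℝ → Fin (S.k q) → ℝ) (b : ℝ) (ζ : Fin (S.n q) → ℝ) (r : Q) : Prop :=
  ∃ v : Fin (S.k q) → ℝ, Tendsto u (𝓝[<] b ⊓ ae volume) (𝓝 v) ∧
    S.m q r ⬝ᵥ S.field q b ζ v ≠ 0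

/-- The conditions on a switching from `p` at the state `ζ` to `q` at the state `ζ'`. -/
structure LinkOK (p q : Q) (σ : E) (b : ℝ) (u : ℝ → Fin (S.k p) → ℝ) (ζ : Fin (S.n p) → ℝ)
    (ζ' : Fin (S.n q) → ℝ) : Prop where
  event : S.next p σ = some q
  jump : ζ' = S.jump p q σ ζ
  contact : ∀ r, S.OnManifold p r ζ → r = q ∧ S.TransversalAt p u b ζ r

/-- The cost of a segment, including the weight `W` on the distance to the target `d` at its end. -/
noncomputable def segmentCost (q : Q) (W : Matrix (Fin (S.n q)) (Fin (S.n q)) ℝ)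
    (d : Fin (S.n q) → ℝ) (a b : ℝ) (u : ℝ → Fin (S.k q) → ℝ) (x : ℝ → Fin (S.n q) → ℝ) : ℝ :=
  (∫ t in a..b, S.runningCost q t (x t) (u t)) + 1 / 2 * ((x b - d) ⬝ᵥ (W *ᵥ (x b - d)))

end Problem

namespace Execution

variable {Q E : Type*} {S : Problem Q E} (ω : Execution S)

/-- The weight of the cost at the end of a segment: a switching cost, or the terminal cost on the
last segment. -/
noncomputable def endWeight (i : Fin (S.N + 1)) :
    Matrix (Fin (S.n (ω.q i))) (Fin (S.n (ω.q i))) ℝ :=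
  if h : i = Fin.last S.N then S.G (ω.q i) else S.C (ω.q i) (ω.σ (i.castPred h))

@[simp] theorem endWeight_castSucc (j : Fin S.N) :
    ω.endWeight j.castSucc = S.C (ω.q j.castSucc) (ω.σ j) := by
  simp [endWeight, Fin.castSucc_ne_last]

@[simp] theorem endWeight_last : ω.endWeight (Fin.last S.N) = S.G (ω.q (Fin.last S.N)) := by
  simp [endWeight]

theorem endWeight_posSemidef (hS : S.Valid) (i : Fin (S.N + 1)) : (ω.endWeight i).PosSemidef := by
  unfold endWeight
  split_ifs
  · exact hS.posSemidef_G _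
  · exact hS.posSemidef_C _ _

/-- The part of the cost that arises on the `i`-th segment and at its end. -/
noncomputable def segCost (i : Fin (S.N + 1)) : ℝ :=
  S.segmentCost (ω.q i) (ω.endWeight i) (S.d i (ω.q i)) (ω.tstart i) (ω.tend i) (ω.u i) (ω.x i)

theorem cost_eq_sum_segCost : ω.cost = ∑ i, ω.segCost i := by
  unfold cost segCost Problem.segmentCost
  rw [Finset.sum_add_distrib, add_assoc]
  congr 1
  rw [Fin.sum_univ_castSucc]
  simp only [endWeight_castSucc, endWeight_last]
  rfl

/-- The execution with the same discrete states and events as `ω`, but with other switching times,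
controls and states. -/
def replace (t : Fin (S.N + 2) → ℝ) (u : (i : Fin (S.N + 1)) → ℝ → Fin (S.k (ω.q i)) → ℝ)
    (x : (i : Fin (S.N + 1)) → ℝ → Fin (S.n (ω.q i)) → ℝ) : Execution S :=
  ⟨t, ω.q, ω.σ, u, x⟩

/-- Admissibility of the part of an execution that starts with the `i`-th segment. -/
structure AdmissibleFrom (i : Fin (S.N + 1)) : Prop where
  seg : ∀ k, i ≤ k → S.SegmentOK (ω.q k) (ω.tstart k) (ω.tend k) (ω.u k) (ω.x k)
  link : ∀ j : Fin S.N, i ≤ j.castSucc → S.LinkOK (ω.q j.castSucc) (ω.q j.succ) (ω.σ j)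
    (ω.tend j.castSucc) (ω.u j.castSucc) (ω.xend j.castSucc) (ω.xstart j.succ)
  finish : ω.t (Fin.last (S.N + 1)) = S.tf
  off : ∀ r, ¬ S.OnManifold (ω.q (Fin.last S.N)) r (ω.xend (Fin.last S.N))

variable {ω}

theorem Admissible.segmentOK (h : ω.Admissible) (i : Fin (S.N + 1)) :
    S.SegmentOK (ω.q i) (ω.tstart i) (ω.tend i) (ω.u i) (ω.x i) :=
  ⟨h.strictMono i.castSucc_lt_succ, h.control i, h.continuous i, h.dynamics i,
    h.no_contact i⟩

theorem Admissible.linkOK (h : ω.Admissible) (j : Fin S.N) :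
    S.LinkOK (ω.q j.castSucc) (ω.q j.succ) (ω.σ j)
      (ω.tend j.castSucc) (ω.u j.castSucc) (ω.xend j.castSucc) (ω.xstart j.succ) :=
  ⟨h.event j, h.jump j, h.contact j⟩

theorem AdmissibleFrom.admissible (h : ω.AdmissibleFrom 0) (hs : ω.t 0 = S.t₀)
    (hi : (⟨ω.q 0, ω.xstart 0⟩ : (q : Q) × (Fin (S.n q) → ℝ)) = S.h₀) : ω.Admissible where
  strictMono := Fin.strictMono_iff_lt_succ.2 fun i => (h.seg i (Fin.zero_le _)).lt
  start := hs
  finish := h.finish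
  init := hi
  control i := (h.seg i (Fin.zero_le _)).control
  continuous i := (h.seg i (Fin.zero_le _)).continuous
  dynamics i := (h.seg i (Fin.zero_le _)).dynamics
  event j := (h.link j (Fin.zero_le _)).event
  jump j := (h.link j (Fin.zero_le _)).jump
  no_contact i := (h.seg i (Fin.zero_le _)).no_contact
  no_contact_final := h.off
  contact j := (h.link j (Fin.zero_le _)).contact

variable (ω)

/-- The hybrid system can be steered from the state `ξ` at the time `a`, in the `i`-th discrete
state of `ω`, through the remaining discrete states of `ω`, at a cost that exceeds the
corresponding part of the cost of `ω` by at most `c`. -/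
def HasTail (i : Fin (S.N + 1)) (a : ℝ) (ξ : Fin (S.n (ω.q i)) → ℝ) (c : ℝ) : Prop :=
  ∃ t u x, (ω.replace t u x).AdmissibleFrom i ∧ t i.castSucc = a ∧ x i a = ξ ∧
    ∑ k ∈ Finset.Ici i, (ω.replace t u x).segCost k - ∑ k ∈ Finset.Ici i, ω.segCost k ≤ c

/-- Completion of an execution after the end of the `i`-th segment, at the time `b`, the state `ζ`
and with the control `u` up to `b`; `c` bounds the excess cost after the segment. -/
inductive HasContinuation : (i : Fin (S.N + 1)) → ℝ → (ℝ → Fin (S.k (ω.q i)) → ℝ) →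
    (Fin (S.n (ω.q i)) → ℝ) → ℝ → Prop
  | last (u : ℝ → Fin (S.k (ω.q (Fin.last S.N))) → ℝ) (ζ : Fin (S.n (ω.q (Fin.last S.N))) → ℝ)
      (c : ℝ) (hζ : ∀ r, ¬ S.OnManifold (ω.q (Fin.last S.N)) r ζ) (hc : 0 ≤ c) :
      HasContinuation (Fin.last S.N) S.tf u ζ c
  | cons (j : Fin S.N) (b : ℝ) (u : ℝ → Fin (S.k (ω.q j.castSucc)) → ℝ)
      (ζ : Fin (S.n (ω.q j.castSucc)) → ℝ) (ζ' : Fin (S.n (ω.q j.succ)) → ℝ) (c : ℝ)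
      (hlink : S.LinkOK (ω.q j.castSucc) (ω.q j.succ) (ω.σ j) b u ζ ζ')
      (htail : ω.HasTail j.succ b ζ' c) : HasContinuation j.castSucc b u ζ c

variable {ω}

/-- A segment followed by a continuation is a tail. -/
theorem HasContinuation.hasTail {i : Fin (S.N + 1)} {a b c : ℝ} {u : ℝ → Fin (S.k (ω.q i)) → ℝ}
    {x : ℝ → Fin (S.n (ω.q i)) → ℝ} (hseg : S.SegmentOK (ω.q i) a b u x)
    (h : ω.HasContinuation i b u (x b) c) :
    ω.HasTail i a (x a) (c + (S.segmentCost (ω.q i) (ω.endWeight i) (S.d i (ω.q i)) a b u x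
      - ω.segCost i)) := by
  generalize hζ : x b = ζ at h
  induction h with
  | last u ζ c hoff hc =>
    have hIci : Finset.Ici (Fin.last S.N) = {Fin.last S.N} := by
      ext k; simp [Fin.last_le_iff]
    have hlast : ∀ k : Fin (S.N + 1), Fin.last S.N ≤ k → k = Fin.last S.N := fun k hk =>
      Fin.last_le_iff.1 hk
    have hne : (Fin.last S.N).castSucc ≠ (Fin.last S.N).succ := (Fin.castSucc_lt_succ).ne
    refine ⟨Function.update (fun _ => S.tf) (Fin.last S.N).castSucc a,
      Function.update ω.u (Fin.last S.N) u, Function.update ω.x (Fin.last S.N) x,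
      ⟨fun k hk => ?_, fun j hj => ?_, ?_, ?_⟩, ?_, ?_, ?_⟩
    · obtain rfl := hlast k hk
      have h1 : (Fin.last (S.N + 1)) ≠ (Fin.last S.N).castSucc := hne.symm
      simpa [replace, tstart, tend, Function.update_of_ne h1] using hseg
    · exact absurd (hlast _ hj) (Fin.castSucc_ne_last j)
    · simp only [replace]
      rw [← Fin.succ_last, Function.update_of_ne hne.symm]
    · intro r
      simp only [replace, xend, tend, Function.update_self, Function.update_of_ne hne.symm, hζ]
      exact hoff r
    · simp
    · simp
    · rw [hIci, Finset.sum_singleton, Finset.sum_singleton]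
      simp only [segCost, replace, tstart, tend, Function.update_self,
        Function.update_of_ne hne.symm]
      change S.segmentCost _ (ω.endWeight _) _ _ _ _ _ - _ ≤ _
      linarith
  | cons j b u ζ ζ' c hlink htail =>
    obtain ⟨t', u', x', hadm, ht', hx', hcost⟩ := htail
    have hIci : Finset.Ici j.castSucc = insert j.castSucc (Finset.Ici j.succ) := by
      ext k
      simp only [Finset.mem_Ici, Finset.mem_insert, Fin.le_def, Fin.ext_iff, Fin.val_castSucc,
        Fin.val_succ]
      omega
    have hnot : j.castSucc ∉ Finset.Ici j.succ := by
      simp only [Finset.mem_Ici, Fin.le_def, Fin.val_castSucc, Fin.val_succ]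
      omega
    have hk : ∀ k : Fin (S.N + 1), j.succ ≤ k → k ≠ j.castSucc ∧
        k.castSucc ≠ j.castSucc.castSucc ∧ k.succ ≠ j.castSucc.castSucc := by
      intro k hk
      simp only [Fin.le_def, Fin.val_succ] at hk
      simp only [ne_eq, Fin.ext_iff, Fin.val_castSucc, Fin.val_succ]
      omega
    have hcase : ∀ k : Fin (S.N + 1), j.castSucc ≤ k → k = j.castSucc ∨ j.succ ≤ k := by
      intro k hk
      simp only [Fin.le_def, Fin.val_succ, Fin.ext_iff, Fin.val_castSucc] at *
      omega
    have hne : j.castSucc.succ ≠ j.castSucc.castSucc := (Fin.castSucc_lt_succ).ne'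
    have hb : t' j.castSucc.succ = b := by rw [← ht', Fin.succ_castSucc]
    set ω' := ω.replace (Function.update t' j.castSucc.castSucc a)
      (Function.update u' j.castSucc u) (Function.update x' j.castSucc x) with hω'
    have e1 : ∀ k, j.succ ≤ k → ω'.tstart k = (ω.replace t' u' x').tstart k := fun k h => by
      simp only [hω', replace, tstart, Function.update_of_ne (hk k h).2.1]
    have e2 : ∀ k, j.succ ≤ k → ω'.tend k = (ω.replace t' u' x').tend k := fun k h => by
      simp only [hω', replace, tend, Function.update_of_ne (hk k h).2.2]
    have e3 : ∀ k, j.succ ≤ k → ω'.u k = (ω.replace t' u' x').u k := fun k h =>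
      Function.update_of_ne (hk k h).1 _ _
    have e4 : ∀ k, j.succ ≤ k → ω'.x k = (ω.replace t' u' x').x k := fun k h =>
      Function.update_of_ne (hk k h).1 _ _
    have f1 : ω'.tstart j.castSucc = a := by simp [hω', replace, tstart]
    have f2 : ω'.tend j.castSucc = b := by
      simp only [hω', replace, tend, Function.update_of_ne hne, hb]
    have f3 : ω'.u j.castSucc = u := Function.update_self _ _ _
    have f4 : ω'.x j.castSucc = x := Function.update_self _ _ _
    refine ⟨Function.update t' j.castSucc.castSucc a, Function.update u' j.castSucc u,
      Function.update x' j.castSucc x, ⟨fun k hk' => ?_, fun l hl => ?_, ?_, ?_⟩, f1, ?_, ?_⟩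
    · change S.SegmentOK (ω.q k) (ω'.tstart k) (ω'.tend k) (ω'.u k) (ω'.x k)
      rcases hcase k hk' with rfl | h
      · rw [f1, f2, f3, f4]
        exact hseg
      · rw [e1 k h, e2 k h, e3 k h, e4 k h]
        exact hadm.seg k h
    · change S.LinkOK (ω.q l.castSucc) (ω.q l.succ) (ω.σ l) (ω'.tend l.castSucc)
        (ω'.u l.castSucc) (ω'.x l.castSucc (ω'.tend l.castSucc)) (ω'.x l.succ (ω'.tstart l.succ))
      have hls : j.succ ≤ l.succ := by
        simp only [Fin.le_def, Fin.val_castSucc, Fin.val_succ] at *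
        omega
      rw [e1 _ hls, e4 _ hls]
      rcases hcase _ hl with h | h
      · obtain rfl : l = j := Fin.castSucc_injective _ h
        rw [f2, f3, f4, hζ]
        have : (ω.replace t' u' x').x l.succ ((ω.replace t' u' x').tstart l.succ) = ζ' := by
          rw [← hx', ← ht']; rfl
        rw [this]
        exact hlink
      · rw [e2 _ h, e3 _ h, e4 _ h]
        exact hadm.link l h
    · have : (Fin.last (S.N + 1)) ≠ j.castSucc.castSucc := by
        simp only [ne_eq, Fin.ext_iff, Fin.val_castSucc, Fin.val_last]
        omega
      simp only [replace, Function.update_of_ne this]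
      exact hadm.finish
    · intro r
      have h : j.succ ≤ Fin.last S.N := Fin.le_last _
      change ¬ S.OnManifold _ r (ω'.x (Fin.last S.N) (ω'.tend (Fin.last S.N)))
      rw [e2 _ h, e4 _ h]
      exact hadm.off r
    · simp
    · change ∑ k ∈ Finset.Ici j.castSucc, ω'.segCost k - _ ≤ _
      rw [hIci, Finset.sum_insert hnot, Finset.sum_insert hnot]
      have h1 : ∑ k ∈ Finset.Ici j.succ, ω'.segCost k =
          ∑ k ∈ Finset.Ici j.succ, (ω.replace t' u' x').segCost k := by
        refine Finset.sum_congr rfl fun k hk' => ?_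
        have h := Finset.mem_Ici.1 hk'
        change S.segmentCost (ω.q k) (ω.endWeight k) (S.d k (ω.q k)) (ω'.tstart k)
          (ω'.tend k) (ω'.u k) (ω'.x k) =
            S.segmentCost (ω.q k) (ω.endWeight k) (S.d k (ω.q k)) _ _ _ _
        rw [e1 k h, e2 k h, e3 k h, e4 k h]
      have h2 : ω'.segCost j.castSucc = S.segmentCost (ω.q j.castSucc) (ω.endWeight j.castSucc)
          (S.d j.castSucc (ω.q j.castSucc)) a b u x := by
        change S.segmentCost (ω.q _) (ω.endWeight _) (S.d _ (ω.q _)) (ω'.tstart _) (ω'.tend _)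
          (ω'.u _) (ω'.x _) = _
        rw [f1, f2, f3, f4]
      rw [h1, h2]
      linarith

/-- A tail that starts like the `i`-th segment of an optimal execution is not cheaper. -/
theorem HasTail.nonneg (hopt : ω.IsOptimal) {i : Fin (S.N + 1)} {c : ℝ}
    (h : ω.HasTail i (ω.tstart i) (ω.xstart i) c) : 0 ≤ c := by
  obtain ⟨t, u, x, hadm, ht, hx, hcost⟩ := h
  have had := hopt.1
  -- follow `ω` up to the start of the `i`-th segment, and the tail from there on
  let t' : Fin (S.N + 2) → ℝ := fun k => if k ≤ i.castSucc then ω.t k else t k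
  let ω' := ω.replace t' (fun k => if k < i then ω.u k else u k)
    (fun k => if k < i then ω.x k else x k)
  have ht1 : ∀ k, k ≤ i.castSucc → t' k = ω.t k := fun k hk => if_pos hk
  have ht2 : ∀ k, i.castSucc ≤ k → t' k = t k := by
    intro k hk
    rcases eq_or_lt_of_le hk with rfl | hk
    · rw [ht1 _ le_rfl, ht]; rfl
    · exact if_neg (not_le.2 hk)
  have g1 : ∀ k, k < i → ω'.tstart k = ω.tstart k := fun k hk =>
    ht1 _ (Fin.castSucc_le_castSucc_iff.2 hk.le)
  have g2 : ∀ k, k < i → ω'.tend k = ω.tend k := fun k hk => ht1 _ (by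
    simp only [Fin.le_def, Fin.lt_def, Fin.val_castSucc, Fin.val_succ] at *; omega)
  have g3 : ∀ k, k < i → ω'.u k = ω.u k := fun k hk => if_pos hk
  have g4 : ∀ k, k < i → ω'.x k = ω.x k := fun k hk => if_pos hk
  have e1 : ∀ k, i ≤ k → ω'.tstart k = (ω.replace t u x).tstart k := fun k hk =>
    ht2 _ (Fin.castSucc_le_castSucc_iff.2 hk)
  have e2 : ∀ k, i ≤ k → ω'.tend k = (ω.replace t u x).tend k := fun k hk => ht2 _ (by
    simp only [Fin.le_def, Fin.val_castSucc, Fin.val_succ] at *; omega)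
  have e3 : ∀ k, i ≤ k → ω'.u k = (ω.replace t u x).u k := fun k hk => if_neg (not_lt.2 hk)
  have e4 : ∀ k, i ≤ k → ω'.x k = (ω.replace t u x).x k := fun k hk => if_neg (not_lt.2 hk)
  have hxs : ∀ k, k ≤ i → ω'.x k (ω'.tstart k) = ω.xstart k := by
    intro k hk
    rcases eq_or_lt_of_le hk with rfl | hk
    · rw [e1 _ le_rfl, e4 _ le_rfl]
      change x k (t k.castSucc) = _
      rw [ht, hx]
    · rw [g1 _ hk, g4 _ hk]; rfl
  have hadm' : ω'.AdmissibleFrom 0 := by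
    refine ⟨fun k _ => ?_, fun l _ => ?_, ?_, fun r => ?_⟩
    · change S.SegmentOK (ω.q k) (ω'.tstart k) (ω'.tend k) (ω'.u k) (ω'.x k)
      rcases lt_or_ge k i with hk | hk
      · rw [g1 k hk, g2 k hk, g3 k hk, g4 k hk]
        exact had.segmentOK k
      · rw [e1 k hk, e2 k hk, e3 k hk, e4 k hk]
        exact hadm.seg k hk
    · change S.LinkOK (ω.q l.castSucc) (ω.q l.succ) (ω.σ l) (ω'.tend l.castSucc)
        (ω'.u l.castSucc) (ω'.x l.castSucc (ω'.tend l.castSucc)) (ω'.x l.succ (ω'.tstart l.succ))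
      rcases lt_or_ge l.castSucc i with hk | hk
      · rw [g2 _ hk, g3 _ hk, g4 _ hk, hxs l.succ (by
          simp only [Fin.le_def, Fin.lt_def, Fin.val_castSucc, Fin.val_succ] at *; omega)]
        exact had.linkOK l
      · have hls : i ≤ l.succ := hk.trans (Fin.castSucc_lt_succ).le
        rw [e1 _ hls, e2 _ hk, e3 _ hk, e4 _ hk, e4 _ hls]
        exact hadm.link l hk
    · exact (ht2 _ (Fin.le_last _)).trans hadm.finish
    · change ¬ S.OnManifold _ r (ω'.x (Fin.last S.N) (ω'.tend (Fin.last S.N)))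
      rw [e2 _ (Fin.le_last _), e4 _ (Fin.le_last _)]
      exact hadm.off r
  have hinit : (⟨ω'.q 0, ω'.xstart 0⟩ : (q : Q) × (Fin (S.n q) → ℝ)) = S.h₀ := by
    rw [← had.init]
    congr 1
    exact hxs 0 (Fin.zero_le _)
  have hle := hopt.2 ω' (hadm'.admissible ((ht1 _ (Fin.zero_le _)).trans had.start) hinit)
  rw [cost_eq_sum_segCost, cost_eq_sum_segCost] at hle
  have hsplit : ∀ f : Fin (S.N + 1) → ℝ,
      ∑ k, f k = ∑ k ∈ Finset.Iio i, f k + ∑ k ∈ Finset.Ici i, f k := by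
    intro f
    rw [← Finset.sum_union]
    · congr 1
      ext k
      simp [lt_or_ge]
    · rw [Finset.disjoint_left]
      intro k hk hk'
      exact absurd (Finset.mem_Iio.1 hk) (not_lt.2 (Finset.mem_Ici.1 hk'))
  rw [hsplit, hsplit] at hle
  have h1 : ∑ k ∈ Finset.Iio i, ω'.segCost k = ∑ k ∈ Finset.Iio i, ω.segCost k := by
    refine Finset.sum_congr rfl fun k hk' => ?_
    have hk := Finset.mem_Iio.1 hk'
    change S.segmentCost (ω.q k) (ω.endWeight k) (S.d k (ω.q k)) (ω'.tstart k)
      (ω'.tend k) (ω'.u k) (ω'.x k) =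
            S.segmentCost (ω.q k) (ω.endWeight k) (S.d k (ω.q k)) _ _ _ _
    rw [g1 k hk, g2 k hk, g3 k hk, g4 k hk]
  have h2 : ∑ k ∈ Finset.Ici i, ω'.segCost k =
      ∑ k ∈ Finset.Ici i, (ω.replace t u x).segCost k := by
    refine Finset.sum_congr rfl fun k hk' => ?_
    have h := Finset.mem_Ici.1 hk'
    change S.segmentCost (ω.q k) (ω.endWeight k) (S.d k (ω.q k)) (ω'.tstart k)
      (ω'.tend k) (ω'.u k) (ω'.x k) =
            S.segmentCost (ω.q k) (ω.endWeight k) (S.d k (ω.q k)) _ _ _ _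
    rw [e1 k h, e2 k h, e3 k h, e4 k h]
  rw [h1, h2] at hle
  linarith

theorem HasTail.mono {i : Fin (S.N + 1)} {a : ℝ} {ξ : Fin (S.n (ω.q i)) → ℝ} {c c' : ℝ}
    (h : ω.HasTail i a ξ c) (hc : c ≤ c') : ω.HasTail i a ξ c' := by
  obtain ⟨t, u, x, h1, h2, h3, h4⟩ := h
  exact ⟨t, u, x, h1, h2, h3, h4.trans hc⟩

end Execution

/-! ### Perturbed contacts -/

theorem abs_dotProduct_le {n : ℕ} (m v : Fin n → ℝ) : |m ⬝ᵥ v| ≤ (∑ i, |m i|) * ‖v‖ := by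
  rw [dotProduct, Finset.sum_mul]
  refine (Finset.abs_sum_le_sum_abs _ _).trans (Finset.sum_le_sum fun i _ => ?_)
  rw [abs_mul]
  exact mul_le_mul_of_nonneg_left (norm_le_pi_norm v i) (abs_nonneg _)

/-- The pairing with a fixed vector as a continuous linear map. -/
noncomputable def dotCLM {n : ℕ} (m : Fin n → ℝ) : (Fin n → ℝ) →L[ℝ] ℝ :=
  LinearMap.toContinuousLinearMap
    { toFun := fun v => m ⬝ᵥ v
      map_add' := fun v w => dotProduct_add m v w
      map_smul' := fun c v => by simp }

theorem exists_pos_forall_le {ι : Type*} [Finite ι] {f : ι → ℝ} (hf : ∀ i, 0 < f i) :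
    ∃ δ > 0, ∀ i, δ ≤ f i := by
  have h1 : ∀ᶠ δ in 𝓝[>] (0 : ℝ), ∀ i, δ ≤ f i := eventually_all.2 fun i =>
    (eventually_nhdsWithin_of_eventually_nhds (ge_mem_nhds (hf i)))
  obtain ⟨δ, hδ, hδ0⟩ := (h1.and self_mem_nhdsWithin).exists
  exact ⟨δ, hδ0, hδ⟩

namespace Problem

variable {Q E : Type*} {S : Problem Q E} {q : Q}

/-- A state near `x` lies on no other switching manifolds than `x` does. -/
theorem exists_onManifold_of_near [Finite Q] (S : Problem Q E) (q : Q) (x : Fin (S.n q) → ℝ) :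
    ∃ δ > 0, ∀ ζ, ‖ζ - x‖ < δ → ∀ r, S.OnManifold q r ζ → S.OnManifold q r x := by
  have h1 : ∀ r, ∃ δ > 0, ∀ ζ, ‖ζ - x‖ < δ → S.OnManifold q r ζ → S.OnManifold q r x := by
    intro r
    by_cases hr : S.OnManifold q r x
    · exact ⟨1, one_pos, fun _ _ _ => hr⟩
    · have hc : Continuous fun ζ : Fin (S.n q) → ℝ => S.m q r ⬝ᵥ ζ + S.c q r := by fun_prop
      obtain ⟨δ, hδ, H⟩ := Metric.eventually_nhds_iff.1 (hc.continuousAt.eventually_ne (x := x) hr)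
      exact ⟨δ, hδ, fun ζ hζ hr' => absurd hr' (H (by rwa [dist_eq_norm]))⟩
  choose f hf H using h1
  obtain ⟨δ, hδ, hle⟩ := exists_pos_forall_le hf
  exact ⟨δ, hδ, fun ζ hζ r => H r ζ (hζ.trans_le (hle r))⟩

/-- Small perturbations of a curve that meets switching manifolds only at its end points, and there
transversally, have the same property, if they preserve the contacts at the end points. -/
theorem exists_forall_perturbed_no_contact [Finite Q] {T₀ T₁ a b : ℝ} {x : ℝ → Fin (S.n q) → ℝ}
    (hx : ContinuousOn x (Icc T₀ T₁)) (ha : a ∈ Icc T₀ T₁) (hb : b ∈ Icc T₀ T₁)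
    (h0 : ∀ t ∈ Ioo a b, ∀ r, ¬ S.OnManifold q r (x t))
    (hsa : ∀ r, S.OnManifold q r (x a) →
      HasSlopeBoundAt (fun t => S.m q r ⬝ᵥ x t + S.c q r) (Icc T₀ T₁) a)
    (hsb : ∀ r, S.OnManifold q r (x b) →
      HasSlopeBoundAt (fun t => S.m q r ⬝ᵥ x t + S.c q r) (Icc T₀ T₁) b) :
    ∃ δ > 0, ∀ (a' b' : ℝ) (y : ℝ → Fin (S.n q) → ℝ), a' ∈ Icc T₀ T₁ → b' ∈ Icc T₀ T₁ →
      |a' - a| < δ → |b' - b| < δ → (∀ t ∈ Icc a' b', ‖y t‖ ≤ δ) →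
      (∀ s ∈ Icc a' b', ∀ t ∈ Icc a' b', ‖y t - y s‖ ≤ δ * |t - s|) →
      (∀ r, S.OnManifold q r (x a) → S.OnManifold q r (x a' + y a')) →
      (∀ r, S.OnManifold q r (x b) → S.OnManifold q r (x b' + y b')) →
      ∀ t ∈ Ioo a' b', ∀ r, ¬ S.OnManifold q r (x t + y t) := by
  have h1 : ∀ r, ∃ δ > 0, ∀ (a' b' : ℝ) (y : ℝ → Fin (S.n q) → ℝ), a' ∈ Icc T₀ T₁ →
      b' ∈ Icc T₀ T₁ → |a' - a| < δ → |b' - b| < δ → (∀ t ∈ Icc a' b', ‖y t‖ ≤ δ) →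
      (∀ s ∈ Icc a' b', ∀ t ∈ Icc a' b', ‖y t - y s‖ ≤ δ * |t - s|) →
      (S.OnManifold q r (x a) → S.OnManifold q r (x a' + y a')) →
      (S.OnManifold q r (x b) → S.OnManifold q r (x b' + y b')) →
      ∀ t ∈ Ioo a' b', ¬ S.OnManifold q r (x t + y t) := by
    intro r
    obtain ⟨δ, hδ, H⟩ := exists_forall_perturbed_ne_zero
      (g := fun t => S.m q r ⬝ᵥ x t + S.c q r) (by fun_prop) ha hb
      (fun t ht => h0 t ht r) (hsa r) (hsb r)
    set C := ∑ i, |S.m q r i| with hC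
    have hC0 : 0 ≤ C := Finset.sum_nonneg fun _ _ => abs_nonneg _
    have hle1 : δ / (C + 1) ≤ δ := div_le_self hδ.le (by linarith)
    have hle2 : C * (δ / (C + 1)) ≤ δ := by
      rw [mul_div_assoc', div_le_iff₀ (by linarith)]
      nlinarith
    have e1 : ∀ (y z : Fin (S.n q) → ℝ), S.OnManifold q r (y + z) ↔
        S.m q r ⬝ᵥ y + S.c q r + S.m q r ⬝ᵥ z = 0 := by
      intro y z
      rw [OnManifold, dotProduct_add, add_right_comm]
    refine ⟨δ / (C + 1), by positivity, ?_⟩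
    intro a' b' y ha' hb' haa hbb hy hlip hza hzb t ht
    rw [e1] at hza hzb ⊢
    refine H a' b' (fun t => S.m q r ⬝ᵥ y t) ha' hb' (haa.trans_le hle1) (hbb.trans_le hle1)
      (fun t ht => ?_) (fun s hs t ht => ?_) hza hzb t ht
    · exact (abs_dotProduct_le _ _).trans ((mul_le_mul_of_nonneg_left (hy t ht) hC0).trans hle2)
    · rw [← dotProduct_sub]
      refine (abs_dotProduct_le _ _).trans
        ((mul_le_mul_of_nonneg_left (hlip s hs t ht) hC0).trans ?_)
      rw [← mul_assoc]
      exact mul_le_mul_of_nonneg_right hle2 (abs_nonneg _)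
  choose f hf H using h1
  obtain ⟨δ, hδ, hle⟩ := exists_pos_forall_le hf
  refine ⟨δ, hδ, ?_⟩
  intro a' b' y ha' hb' haa hbb hy hlip hza hzb t ht r
  exact H r a' b' y ha' hb' (haa.trans_le (hle r)) (hbb.trans_le (hle r))
    (fun t ht => (hy t ht).trans (hle r))
    (fun s hs t ht => (hlip s hs t ht).trans (mul_le_mul_of_nonneg_right (hle r) (abs_nonneg _)))
    (hza r) (hzb r) t ht

theorem Valid.sub_eq_integral_field (hS : S.Valid) {a b : ℝ} (hI : Icc a b ⊆ Icc S.t₀ S.tf)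
    {u : ℝ → Fin (S.k q) → ℝ} {x : ℝ → Fin (S.n q) → ℝ} (hx : ContinuousOn x (Icc a b))
    (hu : MemLp u ⊤ (volume.restrict (Icc a b)))
    (hdyn : ∀ t ∈ Icc a b, x t = x a + ∫ τ in a..t, S.field q τ (x τ) (u τ))
    {s t : ℝ} (hs : s ∈ Icc a b) (ht : t ∈ Icc a b) :
    x t - x s = ∫ τ in s..t, S.field q τ (x τ) (u τ) := by
  have hint : ∀ s ∈ Icc a b, IntervalIntegrable (fun τ => S.field q τ (x τ) (u τ)) volume a s :=
    fun s hs => (intervalIntegrable_of_memLp_top (hs.1.trans hs.2)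
      (hS.memLp_field hI hx hu)).mono_set (by
        rw [uIcc_of_le hs.1, uIcc_of_le (hs.1.trans hs.2)]; exact Icc_subset_Icc_right hs.2)
  rw [hdyn t ht, hdyn s hs, add_sub_add_left_eq_sub,
    intervalIntegral.integral_interval_sub_left (hint t ht) (hint s hs)]

/-- A transversal essential limit of the velocity at an end point bounds the slopes of the distance
to the switching manifold. -/
theorem Valid.hasSlopeBoundAt_of_tendsto (hS : S.Valid) {a b e : ℝ}
    (hI : Icc a b ⊆ Icc S.t₀ S.tf) (he : e ∈ Icc a b) {F : Filter ℝ}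
    (hF : 𝓝[Icc a b] e ⊓ ae volume ≤ F)
    {u : ℝ → Fin (S.k q) → ℝ} {x : ℝ → Fin (S.n q) → ℝ} (hx : ContinuousOn x (Icc a b))
    (hu : MemLp u ⊤ (volume.restrict (Icc a b)))
    (hdyn : ∀ t ∈ Icc a b, x t = x a + ∫ τ in a..t, S.field q τ (x τ) (u τ))
    {v : Fin (S.k q) → ℝ} (hv : Tendsto u F (𝓝 v)) {r : Q}
    (hr : S.m q r ⬝ᵥ S.field q e (x e) v ≠ 0) :
    HasSlopeBoundAt (fun t => S.m q r ⬝ᵥ x t + S.c q r) (Icc a b) e := by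
  have hfi := hS.memLp_field hI hx hu
  have hab : a ≤ b := he.1.trans he.2
  refine exists_slope_bound_of_tendsto_ae
    (γ := fun τ => S.m q r ⬝ᵥ S.field q τ (x τ) (u τ)) (γ₀ := S.m q r ⬝ᵥ S.field q e (x e) v)
    (fun s hs t ht => ?_) ?_ ?_ hr
  · rw [add_sub_add_right_eq_sub, ← dotProduct_sub, hS.sub_eq_integral_field hI hx hu hdyn hs ht]
    have hint : IntervalIntegrable (fun τ => S.field q τ (x τ) (u τ)) volume s t :=
      (intervalIntegrable_of_memLp_top hab hfi).mono_set (by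
        rw [uIcc_of_le hab]; exact uIcc_subset_Icc hs ht)
    exact ((dotCLM (S.m q r)).intervalIntegral_comp_comm hint).symm
  · exact (dotCLM (S.m q r)).integrable_comp (hfi.integrable le_top)
  · have hle : 𝓝[Icc a b] e ⊓ ae volume ≤ 𝓝[Icc a b] e := inf_le_left
    have hA : Tendsto (S.A q) (𝓝[Icc a b] e ⊓ ae volume) (𝓝 (S.A q e)) :=
      ((hS.continuousOn_A q).mono hI e he).mono_left hle
    have hB : Tendsto (S.B q) (𝓝[Icc a b] e ⊓ ae volume) (𝓝 (S.B q e)) :=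
      ((hS.continuousOn_B q).mono hI e he).mono_left hle
    have hF' : Tendsto (S.F q) (𝓝[Icc a b] e ⊓ ae volume) (𝓝 (S.F q e)) :=
      ((hS.continuousOn_F q).mono hI e he).mono_left hle
    have hx' : Tendsto x (𝓝[Icc a b] e ⊓ ae volume) (𝓝 (x e)) := (hx e he).mono_left hle
    have hu' := hv.mono_left hF
    have hcont : Continuous fun z : Matrix (Fin (S.n q)) (Fin (S.n q)) ℝ ×
        Matrix (Fin (S.n q)) (Fin (S.k q)) ℝ × (Fin (S.n q) → ℝ) × (Fin (S.n q) → ℝ) ×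
          (Fin (S.k q) → ℝ) =>
        S.m q r ⬝ᵥ (z.1 *ᵥ z.2.2.2.1 + z.2.1 *ᵥ z.2.2.2.2 + z.2.2.1) := by fun_prop
    have hprod := hA.prodMk_nhds (hB.prodMk_nhds (hF'.prodMk_nhds (hx'.prodMk_nhds hu')))
    have hlim := (hcont.tendsto _).comp hprod
    simp only [Function.comp_def] at hlim
    unfold field
    exact hlim

end Problem

/-! ### First order bounds for the cost to come -/

namespace Execution

variable {Q E : Type*} {S : Problem Q E} {ω : Execution S}

theorem Admissible.Icc_subset (h : ω.Admissible) (i : Fin (S.N + 1)) :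
    Icc (ω.tstart i) (ω.tend i) ⊆ Icc S.t₀ S.tf := by
  rw [← h.start, ← h.finish]
  exact Icc_subset_Icc (h.strictMono.monotone (Fin.zero_le _))
    (h.strictMono.monotone (Fin.le_last _))

theorem Admissible.tstart_lt_tend (h : ω.Admissible) (i : Fin (S.N + 1)) :
    ω.tstart i < ω.tend i := h.strictMono i.castSucc_lt_succ

theorem Admissible.memLp (h : ω.Admissible) (i : Fin (S.N + 1)) :
    MemLp (ω.u i) ⊤ (volume.restrict (Icc (ω.tstart i) (ω.tend i))) := by
  rw [← Measure.restrict_congr_set Ico_ae_eq_Icc]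
  exact h.control i

theorem Admissible.transversalStart (hS : S.Valid) (h : ω.Admissible) (hreg : ω.RegularEntry)
    (i : Fin (S.N + 1)) {r : Q} (hr : S.OnManifold (ω.q i) r (ω.xstart i)) :
    ω.TransversalStart i r := by
  induction i using Fin.cases with
  | zero =>
    have := hS.initial_off r
    rw [← h.init] at this
    exact absurd hr this
  | succ j => exact (hreg j r hr).2

theorem Admissible.transversalAt (h : ω.Admissible)
    (i : Fin (S.N + 1)) {r : Q} (hr : S.OnManifold (ω.q i) r (ω.xend i)) :
    S.TransversalAt (ω.q i) (ω.u i) (ω.tend i) (ω.xend i) r := by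
  induction i using Fin.lastCases with
  | last => exact absurd hr (h.no_contact_final r)
  | cast j => exact (h.contact j r hr).2

theorem nhdsWithin_Icc_inf_ae_le_right {a b : ℝ} :
    𝓝[Icc a b] a ⊓ ae volume ≤ 𝓝[>] a ⊓ ae volume := by
  refine le_inf ?_ inf_le_right
  have h1 : ae (volume : Measure ℝ) ≤ 𝓟 {a}ᶜ := le_principal_iff.2 (by
    rw [mem_ae_iff, compl_compl]; exact Real.volume_singleton)
  calc 𝓝[Icc a b] a ⊓ ae volume ≤ 𝓝[≥] a ⊓ 𝓟 {a}ᶜ :=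
        inf_le_inf (nhdsWithin_mono _ Icc_subset_Ici_self) h1
    _ = 𝓝[>] a := by
        rw [nhdsWithin, inf_assoc, inf_principal, nhdsWithin]
        congr 2
        ext t
        simp only [mem_inter_iff, mem_Ici, mem_compl_iff, mem_singleton_iff, mem_Ioi]
        exact ⟨fun h => lt_of_le_of_ne h.1 (Ne.symm h.2), fun h => ⟨h.le, h.ne'⟩⟩

theorem nhdsWithin_Icc_inf_ae_le_left {a b : ℝ} :
    𝓝[Icc a b] b ⊓ ae volume ≤ 𝓝[<] b ⊓ ae volume := by
  refine le_inf ?_ inf_le_right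
  have h1 : ae (volume : Measure ℝ) ≤ 𝓟 {b}ᶜ := le_principal_iff.2 (by
    rw [mem_ae_iff, compl_compl]; exact Real.volume_singleton)
  calc 𝓝[Icc a b] b ⊓ ae volume ≤ 𝓝[≤] b ⊓ 𝓟 {b}ᶜ :=
        inf_le_inf (nhdsWithin_mono _ Icc_subset_Iic_self) h1
    _ = 𝓝[<] b := by
        rw [nhdsWithin, inf_assoc, inf_principal, nhdsWithin]
        congr 2
        ext t
        simp only [mem_inter_iff, mem_Iic, mem_compl_iff, mem_singleton_iff, mem_Iio]
        exact ⟨fun h => lt_of_le_of_ne h.1 h.2, fun h => ⟨h.le, h.ne⟩⟩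

variable (ω) in
/-- First order bound, with the coefficients `μ` and `-h`, for the excess cost after the end of the
`i`-th segment, as a function of the state and the time at this end. The end has to stay on
the switching manifold on which it lies, and on the last segment the time is fixed. -/
def ContinuationBound (i : Fin (S.N + 1)) (μ : Fin (S.n (ω.q i)) → ℝ) (h : ℝ) : Prop :=
  ∀ ε > 0, ∃ δ > 0, ∀ (b : ℝ) (ζ : Fin (S.n (ω.q i)) → ℝ) (u : ℝ → Fin (S.k (ω.q i)) → ℝ),
    |b - ω.tend i| < δ → ‖ζ - ω.xend i‖ < δ → (i = Fin.last S.N → b = S.tf) →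
    (∀ r, S.OnManifold (ω.q i) r (ω.xend i) →
      S.OnManifold (ω.q i) r ζ ∧ S.TransversalAt (ω.q i) u b ζ r) →
    ω.HasContinuation i b u ζ
      (μ ⬝ᵥ (ζ - ω.xend i) - h * (b - ω.tend i) + ε * (|b - ω.tend i| + ‖ζ - ω.xend i‖))

variable (ω) in
/-- First order bound, with the coefficients `lam` and `-h`, for the excess cost of the tails from
the `i`-th segment on, as a function of the state and the time at their start. The start has to
stay on the switching manifolds on which it lies. -/
def EntryBound (i : Fin (S.N + 1)) (lam : Fin (S.n (ω.q i)) → ℝ) (h : ℝ) : Prop :=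
  ∀ ε > 0, ∃ δ > 0, ∀ (a : ℝ) (ξ : Fin (S.n (ω.q i)) → ℝ),
    |a - ω.tstart i| < δ → ‖ξ - ω.xstart i‖ < δ →
    (∀ r, S.OnManifold (ω.q i) r (ω.xstart i) → S.OnManifold (ω.q i) r ξ) →
    ω.HasTail i a ξ
      (lam ⬝ᵥ (ξ - ω.xstart i) - h * (a - ω.tstart i) + ε * (|a - ω.tstart i| + ‖ξ - ω.xstart i‖))

theorem Admissible.continuationBound_last [Finite Q] (hadm : ω.Admissible) :
    ω.ContinuationBound (Fin.last S.N) 0 0 := by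
  intro ε hε
  obtain ⟨δ, hδ, H⟩ := S.exists_onManifold_of_near (ω.q (Fin.last S.N)) (ω.xend (Fin.last S.N))
  refine ⟨δ, hδ, fun b ζ u _ hζ hlast _ => ?_⟩
  obtain rfl := hlast rfl
  refine .last _ _ _ (fun r hr => hadm.no_contact_final r (H ζ hζ r hr)) ?_
  rw [zero_dotProduct, zero_mul, sub_zero, zero_add]
  positivity

/-- The bound after a switching results from the bound for the tails after it by composition with
the jump map. -/
theorem EntryBound.continuationBound [Finite Q] (hadm : ω.Admissible) (hreg : ω.RegularEntry)
    {j : Fin S.N} {lam : Fin (S.n (ω.q j.succ)) → ℝ} {h : ℝ} (he : ω.EntryBound j.succ lam h) :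
    ω.ContinuationBound j.castSucc
      ((S.P (ω.q j.castSucc) (ω.q j.succ) (ω.σ j))ᵀ *ᵥ lam) h := by
  intro ε hε
  set P := S.P (ω.q j.castSucc) (ω.q j.succ) (ω.σ j)
  set C := ‖mulVecCLM P‖ + 1 with hC
  have hC1 : 1 ≤ C := by have := norm_nonneg (mulVecCLM P); linarith
  obtain ⟨δ₁, hδ₁, H₁⟩ := S.exists_onManifold_of_near (ω.q j.castSucc) (ω.xend j.castSucc)
  obtain ⟨δ₂, hδ₂, H₂⟩ := he (ε / C) (by positivity)
  refine ⟨min δ₁ (δ₂ / C), lt_min hδ₁ (by positivity), fun b ζ u hb hζ _ hman => ?_⟩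
  have hts : ω.tstart j.succ = ω.tend j.castSucc := rfl
  have hjump : S.jump (ω.q j.castSucc) (ω.q j.succ) (ω.σ j) ζ - ω.xstart j.succ =
      P *ᵥ (ζ - ω.xend j.castSucc) := by
    rw [hadm.jump j, Problem.jump, Problem.jump, mulVec_sub]
    abel
  have hnorm : ‖P *ᵥ (ζ - ω.xend j.castSucc)‖ ≤ C * ‖ζ - ω.xend j.castSucc‖ := by
    refine ((mulVecCLM P).le_opNorm _).trans (mul_le_mul_of_nonneg_right ?_ (norm_nonneg _))
    linarith
  have hδ2 : δ₂ / C ≤ δ₂ := div_le_self hδ₂.le hC1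
  refine .cons j b u ζ (S.jump (ω.q j.castSucc) (ω.q j.succ) (ω.σ j) ζ) _
    ⟨hadm.event j, rfl, fun r hr => ?_⟩ ?_
  · have hr' := H₁ ζ (hζ.trans_le (min_le_left _ _)) r hr
    exact ⟨(hadm.contact j r hr').1, (hman r hr').2⟩
  · refine (H₂ b _ ?_ ?_ (fun r hr => ?_)).mono ?_
    · rw [hts]
      exact hb.trans_le ((min_le_right _ _).trans hδ2)
    · rw [hjump]
      refine hnorm.trans_lt ?_
      have := hζ.trans_le (min_le_right _ _)
      rwa [lt_div_iff₀ (by positivity), mul_comm] at this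
    · exact (hreg j r hr).1 ζ fun haut => (hman _ haut).1
    · rw [hjump, hts, dotProduct_mulVec_transpose]
      have e1 : ε / C * |b - ω.tend j.castSucc| ≤ ε * |b - ω.tend j.castSucc| :=
        mul_le_mul_of_nonneg_right (div_le_self hε.le hC1) (abs_nonneg _)
      have e2 : ε / C * ‖P *ᵥ (ζ - ω.xend j.castSucc)‖ ≤ ε * ‖ζ - ω.xend j.castSucc‖ := by
        calc _ ≤ ε / C * (C * ‖ζ - ω.xend j.castSucc‖) :=
              mul_le_mul_of_nonneg_left hnorm (by positivity)
          _ = _ := by field_simp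
      linarith [mul_add (ε / C) |b - ω.tend j.castSucc| ‖P *ᵥ (ζ - ω.xend j.castSucc)‖,
        mul_add ε |b - ω.tend j.castSucc| ‖ζ - ω.xend j.castSucc‖]

end Execution

/-! ### Variations of the control -/

namespace Problem

variable {Q E : Type*} {S : Problem Q E} {q : Q}

variable (S) in
/-- A solution `y` of the linearized dynamics on `[a, b]` for the variation `w` of the control. -/
structure IsVariation (q : Q) (a b : ℝ) (w : ℝ → Fin (S.k q) → ℝ) (y : ℝ → Fin (S.n q) → ℝ) :
    Prop where
  continuous : Continuous w
  deriv : ∀ t ∈ Icc a b, HasDerivWithinAt y (S.A q t *ᵥ y t + S.B q t *ᵥ w t) (Icc a b) t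

namespace IsVariation

variable {a b : ℝ} {w w' : ℝ → Fin (S.k q) → ℝ} {y y' : ℝ → Fin (S.n q) → ℝ}

theorem continuousOn (h : S.IsVariation q a b w y) : ContinuousOn y (Icc a b) :=
  fun t ht => (h.deriv t ht).continuousWithinAt

theorem zero : S.IsVariation q a b 0 0 :=
  ⟨continuous_zero, fun t _ => by
    have e : S.A q t *ᵥ (0 : ℝ → Fin (S.n q) → ℝ) t
        + S.B q t *ᵥ (0 : ℝ → Fin (S.k q) → ℝ) t = 0 := by simp
    rw [e]
    exact hasDerivWithinAt_const t (Icc a b) 0⟩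

theorem const_smul (h : S.IsVariation q a b w y) (e : ℝ) : S.IsVariation q a b (e • w) (e • y) :=
  ⟨h.continuous.const_smul e, fun t ht => by
    have := (h.deriv t ht).const_smul e
    simpa [mulVec_smul, smul_add] using this⟩

theorem add (h : S.IsVariation q a b w y) (h' : S.IsVariation q a b w' y') :
    S.IsVariation q a b (w + w') (y + y') :=
  ⟨h.continuous.add h'.continuous, fun t ht => by
    have e : S.A q t *ᵥ (y + y') t + S.B q t *ᵥ (w + w') t =
        (S.A q t *ᵥ y t + S.B q t *ᵥ w t) + (S.A q t *ᵥ y' t + S.B q t *ᵥ w' t) := by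
      rw [Pi.add_apply, Pi.add_apply, mulVec_add, mulVec_add, add_add_add_comm]
    rw [e]
    exact (h.deriv t ht).add (h'.deriv t ht)⟩

theorem continuousOn_velocity (hS : S.Valid) (hI : Icc a b ⊆ Icc S.t₀ S.tf)
    (h : S.IsVariation q a b w y) :
    ContinuousOn (fun t => S.A q t *ᵥ y t + S.B q t *ᵥ w t) (Icc a b) := by
  have hA := (hS.continuousOn_A q).mono hI
  have hB := (hS.continuousOn_B q).mono hI
  have hy := h.continuousOn
  have hw := h.continuous.continuousOn (s := Icc a b)
  fun_prop

theorem exists_solution (hS : S.Valid) (hI : Icc a b ⊆ Icc S.t₀ S.tf) {c : ℝ} (hc : c ∈ Icc a b)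
    (hw : Continuous w) (ξ : Fin (S.n q) → ℝ) : ∃ y, y c = ξ ∧ S.IsVariation q a b w y := by
  have hA := continuousOn_mulVecCLM ((hS.continuousOn_A q).mono hI)
  have hB := (hS.continuousOn_B q).mono hI
  have hw' := hw.continuousOn (s := Icc a b)
  obtain ⟨y, hy, hd⟩ := exists_solution_linear (g := fun t => S.B q t *ᵥ w t) hc hA
    (by fun_prop) ξ
  exact ⟨y, hy, hw, hd⟩

/-- The linearized state is bounded and Lipschitz. -/
theorem exists_bound (hS : S.Valid) (hI : Icc a b ⊆ Icc S.t₀ S.tf)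
    (h : S.IsVariation q a b w y) : ∃ C > 0, (∀ t ∈ Icc a b, ‖y t‖ ≤ C) ∧
      ∀ s ∈ Icc a b, ∀ t ∈ Icc a b, ‖y t - y s‖ ≤ C * |t - s| := by
  obtain ⟨C₁, h1⟩ := isCompact_Icc.exists_bound_of_continuousOn h.continuousOn
  obtain ⟨C₂, h2⟩ := isCompact_Icc.exists_bound_of_continuousOn (h.continuousOn_velocity hS hI)
  refine ⟨max 1 (max C₁ C₂), lt_max_of_lt_left one_pos, fun t ht => (h1 t ht).trans
    ((le_max_left _ _).trans (le_max_right _ _)), fun s hs t ht => ?_⟩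
  exact (convex_Icc a b).norm_image_sub_le_of_norm_hasDerivWithin_le h.deriv
    (fun t ht => (h2 t ht).trans ((le_max_right _ _).trans (le_max_right _ _))) hs ht

end IsVariation

/-- On a closed interval on which the control is almost everywhere equal to a continuous function,
the essential limits of the control are the values of this function. -/
theorem eq_of_tendsto_of_ae_eq {V : Type*} [TopologicalSpace V] [T2Space V] {a b e : ℝ}
    (hab : a < b) (he : e ∈ Icc a b) {F : Filter ℝ}
    (hF : 𝓝[Icc a b] e ⊓ ae volume ≤ F) {u û : ℝ → V} {v : V}
    (hv : Tendsto u F (𝓝 v)) (hc : ContinuousOn û (Icc a b))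
    (hu : ∀ᵐ t ∂(volume.restrict (Icc a b)), u t = û t) : v = û e := by
  have hne : (𝓝[Icc a b] e ⊓ ae volume).NeBot := by
    rw [inf_neBot_iff_frequently_left]
    intro P hP
    obtain ⟨U, hU, heU, hsub⟩ := mem_nhdsWithin.1 hP
    refine frequently_ae_iff.2 fun h0 => ?_
    have hmem : e ∈ closure (Ioo a b) := by rwa [closure_Ioo hab.ne]
    have hpos := (hU.inter isOpen_Ioo).measure_pos volume (mem_closure_iff.1 hmem U hU heU)
    exact hpos.ne' (measure_mono_null (fun t ht => hsub ⟨ht.1, Ioo_subset_Icc_self ht.2⟩) h0)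
  refine tendsto_nhds_unique (hv.mono_left hF) (((hc e he).mono_left inf_le_left).congr' ?_)
  have h3 : ∀ᶠ t in ae (volume : Measure ℝ), t ∈ Icc a b → u t = û t :=
    (ae_restrict_iff' measurableSet_Icc).1 hu
  filter_upwards [Filter.mem_inf_of_right h3, Filter.mem_inf_of_left self_mem_nhdsWithin]
    with t ht hmem
  exact (ht hmem).symm

variable {a b : ℝ} {u w : ℝ → Fin (S.k q) → ℝ} {x y : ℝ → Fin (S.n q) → ℝ}

/-- A perturbed segment satisfies the dynamics. -/
theorem SegmentOK.add (hS : S.Valid) (hI : Icc a b ⊆ Icc S.t₀ S.tf) (h : S.SegmentOK q a b u x)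
    (hy : S.IsVariation q a b w y)
    (hcontact : ∀ t ∈ Ioo a b, ∀ r, ¬ S.OnManifold q r (x t + y t)) :
    S.SegmentOK q a b (u + w) (x + y) := by
  have hu : MemLp u ⊤ (volume.restrict (Icc a b)) := by
    rw [← Measure.restrict_congr_set Ico_ae_eq_Icc]; exact h.control
  refine ⟨h.lt, ?_, h.continuous.add hy.continuousOn, fun t ht => ?_, hcontact⟩
  · rw [Measure.restrict_congr_set Ico_ae_eq_Icc]
    exact hu.add (memLp_top_of_continuousOn hy.continuous.continuousOn)
  · have hsub : uIcc a t ⊆ Icc a b := by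
      rw [uIcc_of_le ht.1]; exact Icc_subset_Icc_right ht.2
    have hsub' : Icc a b = uIcc a b := (uIcc_of_le h.lt.le).symm
    have h1 : IntervalIntegrable (fun τ => S.field q τ (x τ) (u τ)) volume a t :=
      (intervalIntegrable_of_memLp_top h.lt.le (hS.memLp_field hI h.continuous hu)).mono_set
        (hsub' ▸ hsub)
    have h2 : IntervalIntegrable (fun τ => S.A q τ *ᵥ y τ + S.B q τ *ᵥ w τ) volume a t :=
      ((hy.continuousOn_velocity hS hI).mono hsub).intervalIntegrable
    have h3 := integral_eq_sub_of_hasDerivWithinAt_Icc (left_mem_Icc.2 h.lt.le) ht ht.1 hy.deriv h2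
    change x t + y t = x a + y a + ∫ τ in a..t, S.field q τ (x τ + y τ) (u τ + w τ)
    simp only [field_add]
    rw [intervalIntegral.integral_add h1 h2, h3, h.dynamics t ht]
    abel

/-- First order part of the cost of a perturbed segment. -/
noncomputable def firstVariation (S : Problem Q E) (q : Q)
    (W : Matrix (Fin (S.n q)) (Fin (S.n q)) ℝ) (d : Fin (S.n q) → ℝ) (a b : ℝ)
    (u : ℝ → Fin (S.k q) → ℝ) (x : ℝ → Fin (S.n q) → ℝ)
    (w : ℝ → Fin (S.k q) → ℝ) (y : ℝ → Fin (S.n q) → ℝ) : ℝ :=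
  (∫ t in a..b, ((S.L q t *ᵥ (x t - S.r q t)) ⬝ᵥ y t + (S.R q t *ᵥ u t) ⬝ᵥ w t))
    + (W *ᵥ (x b - d)) ⬝ᵥ y b

/-- Second order part of the cost of a perturbed segment. -/
noncomputable def secondVariation (S : Problem Q E) (q : Q)
    (W : Matrix (Fin (S.n q)) (Fin (S.n q)) ℝ) (a b : ℝ)
    (w : ℝ → Fin (S.k q) → ℝ) (y : ℝ → Fin (S.n q) → ℝ) : ℝ :=
  (∫ t in a..b, (1 / 2 * (y t ⬝ᵥ (S.L q t *ᵥ y t)) + 1 / 2 * (w t ⬝ᵥ (S.R q t *ᵥ w t))))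
    + 1 / 2 * (y b ⬝ᵥ (W *ᵥ y b))

section

variable {W : Matrix (Fin (S.n q)) (Fin (S.n q)) ℝ} {d : Fin (S.n q) → ℝ}

theorem Valid.memLp_firstVariation (hS : S.Valid) (hI : Icc a b ⊆ Icc S.t₀ S.tf)
    (hx : ContinuousOn x (Icc a b)) (hu : MemLp u ⊤ (volume.restrict (Icc a b)))
    (hy : S.IsVariation q a b w y) :
    MemLp (fun t => (S.L q t *ᵥ (x t - S.r q t)) ⬝ᵥ y t + (S.R q t *ᵥ u t) ⬝ᵥ w t) ⊤
      (volume.restrict (Icc a b)) := by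
  have hL := (hS.continuousOn_L q).mono hI
  have hR := (hS.continuousOn_R q).mono hI
  have hr := (hS.continuous_r q).mono hI
  have h1 : MemLp (fun t => x t - S.r q t) ⊤ (volume.restrict (Icc a b)) :=
    memLp_top_of_continuousOn (hx.sub hr)
  exact (memLp_top_dotProduct (memLp_top_mulVec (memLp_top_row_of_continuousOn hL) h1)
    (memLp_top_of_continuousOn hy.continuousOn)).add
      (memLp_top_dotProduct (memLp_top_mulVec (memLp_top_row_of_continuousOn hR) hu)
        (memLp_top_of_continuousOn hy.continuous.continuousOn))

theorem Valid.segmentCost_add (hS : S.Valid) (hab : a ≤ b) (hI : Icc a b ⊆ Icc S.t₀ S.tf)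
    (hW : W.IsHermitian) (hx : ContinuousOn x (Icc a b))
    (hu : MemLp u ⊤ (volume.restrict (Icc a b))) (hy : S.IsVariation q a b w y) :
    S.segmentCost q W d a b (u + w) (x + y) = S.segmentCost q W d a b u x
      + S.firstVariation q W d a b u x w y + S.secondVariation q W a b w y := by
  have hIu : uIcc a b = Icc a b := uIcc_of_le hab
  have hL := (hS.continuousOn_L q).mono hI
  have hR := (hS.continuousOn_R q).mono hI
  have hyc := hy.continuousOn
  have hwc := hy.continuous.continuousOn (s := Icc a b)
  have h1 := intervalIntegrable_of_memLp_top hab (hS.memLp_runningCost hI hx hu)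
  have h2 := intervalIntegrable_of_memLp_top hab (hS.memLp_firstVariation hI hx hu hy)
  have h3 : IntervalIntegrable (fun t => 1 / 2 * (y t ⬝ᵥ (S.L q t *ᵥ y t))
      + 1 / 2 * (w t ⬝ᵥ (S.R q t *ᵥ w t))) volume a b := by
    apply ContinuousOn.intervalIntegrable
    rw [hIu]
    fun_prop
  have hcongr : ∫ t in a..b, S.runningCost q t (x t + y t) (u t + w t) =
      ∫ t in a..b, (S.runningCost q t (x t) (u t)
        + ((S.L q t *ᵥ (x t - S.r q t)) ⬝ᵥ y t + (S.R q t *ᵥ u t) ⬝ᵥ w t)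
        + (1 / 2 * (y t ⬝ᵥ (S.L q t *ᵥ y t)) + 1 / 2 * (w t ⬝ᵥ (S.R q t *ᵥ w t)))) :=
    intervalIntegral.integral_congr fun t ht => hS.runningCost_add (hI (hIu ▸ ht)) _ _ _ _
  unfold segmentCost firstVariation secondVariation
  simp only [Pi.add_apply]
  rw [hcongr, intervalIntegral.integral_add (h1.add h2) h3, intervalIntegral.integral_add h1 h2,
    show x b + y b - d = (x b - d) + y b by abel, quadratic_expansion hW]
  ring

theorem firstVariation_const_smul (e : ℝ) : S.firstVariation q W d a b u x (e • w) (e • y) =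
    e * S.firstVariation q W d a b u x w y := by
  unfold firstVariation
  simp only [Pi.smul_apply, dotProduct_smul, smul_eq_mul, mul_add,
    ← intervalIntegral.integral_const_mul]

theorem secondVariation_const_smul (e : ℝ) : S.secondVariation q W a b (e • w) (e • y) =
    e ^ 2 * S.secondVariation q W a b w y := by
  unfold secondVariation
  simp only [Pi.smul_apply, dotProduct_smul, smul_dotProduct, mulVec_smul, smul_eq_mul, mul_add,
    ← intervalIntegral.integral_const_mul]
  congr 1
  · refine intervalIntegral.integral_congr fun t _ => ?_
    ring
  · ring

theorem Valid.firstVariation_add (hS : S.Valid) (hab : a ≤ b) (hI : Icc a b ⊆ Icc S.t₀ S.tf)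
    (hx : ContinuousOn x (Icc a b)) (hu : MemLp u ⊤ (volume.restrict (Icc a b)))
    {w' : ℝ → Fin (S.k q) → ℝ} {y' : ℝ → Fin (S.n q) → ℝ} (hy : S.IsVariation q a b w y)
    (hy' : S.IsVariation q a b w' y') :
    S.firstVariation q W d a b u x (w + w') (y + y') =
      S.firstVariation q W d a b u x w y + S.firstVariation q W d a b u x w' y' := by
  unfold firstVariation
  rw [add_add_add_comm, ← intervalIntegral.integral_add
    (intervalIntegrable_of_memLp_top hab (hS.memLp_firstVariation hI hx hu hy))
    (intervalIntegrable_of_memLp_top hab (hS.memLp_firstVariation hI hx hu hy'))]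
  simp only [Pi.add_apply, dotProduct_add]
  congr 1
  refine intervalIntegral.integral_congr fun t _ => ?_
  ring

/-- A transversal contact stays transversal under small variations. -/
theorem TransversalAt.eventually_add {ζ η : Fin (S.n q) → ℝ} {r : Q}
    (h : S.TransversalAt q u b ζ r) (hw : Continuous w) :
    ∀ᶠ e in 𝓝 (0 : ℝ), S.TransversalAt q (u + e • w) b (ζ + e • η) r := by
  obtain ⟨v, hv, hr⟩ := h
  have hc : Continuous fun e : ℝ => S.m q r ⬝ᵥ S.field q b (ζ + e • η) (v + e • w b) := by
    unfold field
    fun_prop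
  have h0 : S.m q r ⬝ᵥ S.field q b (ζ + (0 : ℝ) • η) (v + (0 : ℝ) • w b) ≠ 0 := by simpa using hr
  filter_upwards [hc.continuousAt.eventually_ne h0] with e he
  refine ⟨v + e • w b, hv.add ?_, he⟩
  exact (((hw.const_smul e).tendsto b).mono_left (inf_le_left.trans nhdsWithin_le_nhds))

/-- The fundamental lemma of the calculus of variations for the linear quadratic problem: if the
first variation is the pairing with the end value of an adjoint, the control minimizes the
Hamiltonian. -/
theorem Valid.ae_eq_law (hS : S.Valid) (hab : a < b) (hI : Icc a b ⊆ Icc S.t₀ S.tf)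
    (hx : ContinuousOn x (Icc a b)) (hu : MemLp u ⊤ (volume.restrict (Icc a b)))
    {lam : ℝ → Fin (S.n q) → ℝ} {η : Fin (S.n q) → ℝ}
    (hlam : ∀ t ∈ Icc a b, HasDerivWithinAt lam
      (-((S.A q t)ᵀ *ᵥ lam t) - S.L q t *ᵥ (x t - S.r q t)) (Icc a b) t)
    (hη : lam b = W *ᵥ (x b - d) + η)
    (h : ∀ w y, S.IsVariation q a b w y → y a = 0 →
      S.firstVariation q W d a b u x w y + η ⬝ᵥ y b = 0) :
    ∀ᵐ t ∂(volume.restrict (Icc a b)), u t = S.law q t (lam t) := by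
  have hIu : uIcc a b = Icc a b := uIcc_of_le hab.le
  have hL := (hS.continuousOn_L q).mono hI
  have hR := (hS.continuousOn_R q).mono hI
  have hB := (hS.continuousOn_B q).mono hI
  have hr := (hS.continuous_r q).mono hI
  have hlc : ContinuousOn lam (Icc a b) := fun t ht => (hlam t ht).continuousWithinAt
  have hBl : ContinuousOn (fun t => (S.B q t)ᵀ *ᵥ lam t) (Icc a b) := by fun_prop
  set f : ℝ → Fin (S.k q) → ℝ := fun t => S.R q t *ᵥ u t + (S.B q t)ᵀ *ᵥ lam t with hf
  have hfL : MemLp f ⊤ (volume.restrict (Icc a b)) :=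
    (memLp_top_mulVec (memLp_top_row_of_continuousOn hR) hu).add (memLp_top_of_continuousOn hBl)
  have hortho : ∀ w : ℝ → Fin (S.k q) → ℝ, Continuous w → ∫ t in a..b, f t ⬝ᵥ w t = 0 := by
    intro w hw
    obtain ⟨y, hya, hy⟩ := IsVariation.exists_solution hS hI (left_mem_Icc.2 hab.le) hw 0
    have hyc := hy.continuousOn
    have hwc := hw.continuousOn (s := Icc a b)
    have hpc : IntervalIntegrable (fun t => ((S.B q t)ᵀ *ᵥ lam t) ⬝ᵥ w t
        - (S.L q t *ᵥ (x t - S.r q t)) ⬝ᵥ y t) volume a b := by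
      apply ContinuousOn.intervalIntegrable
      rw [hIu]
      fun_prop
    have h1 := integral_eq_sub_of_hasDerivWithinAt_Icc (left_mem_Icc.2 hab.le)
      (right_mem_Icc.2 hab.le) hab.le
      (fun t ht => hasDerivWithinAt_adjoint_dotProduct (hlam t ht) (hy.deriv t ht)) hpc
    have h2 := h w y hy hya
    rw [firstVariation, add_assoc, ← add_dotProduct, ← hη] at h2
    rw [hya, dotProduct_zero, sub_zero] at h1
    rw [← h1, ← intervalIntegral.integral_add (intervalIntegrable_of_memLp_top hab.le
      (hS.memLp_firstVariation hI hx hu hy)) hpc] at h2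
    rw [← h2]
    refine intervalIntegral.integral_congr fun t _ => ?_
    simp only [hf, add_dotProduct]
    ring
  have hzero : ∀ c, ∀ᵐ t ∂volume, t ∈ Ioo a b → f t c = 0 := by
    intro c
    have hfc : IntegrableOn (fun t => f t c) (Icc a b) := (hfL.eval c).integrable le_top
    refine isOpen_Ioo.ae_eq_zero_of_integral_contDiff_smul_eq_zero
      (hfc.mono_set Ioo_subset_Icc_self).locallyIntegrableOn fun g hg _ hsupp => ?_
    have h1 := hortho (fun t => g t • Pi.single c 1) (hg.continuous.smul continuous_const)
    rw [intervalIntegral.integral_of_le hab.le] at h1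
    rw [← setIntegral_eq_integral_of_forall_compl_eq_zero (s := Ioc a b), ← h1]
    · simp [dotProduct_smul]
    · intro t ht
      rw [image_eq_zero_of_notMem_tsupport fun h' => ht (Ioo_subset_Ioc_self (hsupp h')), zero_smul]
  rw [← Measure.restrict_congr_set Ioo_ae_eq_Icc]
  refine (ae_restrict_iff' measurableSet_Ioo).2 ?_
  filter_upwards [ae_all_iff.2 hzero] with t ht hmem
  exact hS.eq_law_of_R_mulVec (hI (Ioo_subset_Icc_self hmem)) (funext fun c => ht c hmem)

/-- A state generated by the minimizing control of its adjoint is an extremal. -/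
theorem Valid.isExtremalOn (hS : S.Valid) (hI : Icc a b ⊆ Icc S.t₀ S.tf)
    (hx : ContinuousOn x (Icc a b))
    (hdyn : ∀ t ∈ Icc a b, x t = x a + ∫ τ in a..t, S.field q τ (x τ) (u τ))
    {lam : ℝ → Fin (S.n q) → ℝ}
    (hlam : ∀ t ∈ Icc a b, HasDerivWithinAt lam
      (-((S.A q t)ᵀ *ᵥ lam t) - S.L q t *ᵥ (x t - S.r q t)) (Icc a b) t)
    (hlaw : ∀ᵐ t ∂(volume.restrict (Icc a b)), u t = S.law q t (lam t)) :
    S.IsExtremalOn q (Icc a b) x lam := by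
  refine ⟨fun t ht => ?_, hlam⟩
  have hlc : ContinuousOn lam (Icc a b) := fun t ht => (hlam t ht).continuousWithinAt
  have hfc := hS.continuousOn_field hI hx (hS.continuousOn_law hI hlc)
  have heq : ∀ t ∈ Icc a b, x t = x a + ∫ τ in a..t, S.field q τ (x τ) (S.law q τ (lam τ)) := by
    intro t ht
    rw [hdyn t ht]
    congr 1
    refine intervalIntegral.integral_congr_ae ?_
    filter_upwards [(ae_restrict_iff' measurableSet_Icc).1 hlaw] with τ hτ hmem
    rw [uIoc_of_le ht.1] at hmem
    rw [hτ ⟨hmem.1.le, hmem.2.trans ht.2⟩]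
  have hd : HasDerivWithinAt (fun t => x a + ∫ τ in a..t, S.field q τ (x τ) (S.law q τ (lam τ)))
      (S.field q t (x t) (S.law q t (lam t))) (Icc a b) t := by
    have : Fact (t ∈ Icc a b) := ⟨ht⟩
    refine (intervalIntegral.integral_hasDerivWithinAt_right
      (((hfc.mono (Icc_subset_Icc_right ht.2)).intervalIntegrable_of_Icc ht.1))
      (s := Icc a b) (t := Icc a b) ?_ (hfc t ht)).const_add (x a)
    exact hfc.stronglyMeasurableAtFilter_nhdsWithin measurableSet_Icc t
  exact hd.congr heq (heq t ht)

end

end Problem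

/-! ### First variation at fixed switching times -/

namespace Execution

variable {Q E : Type*} {S : Problem Q E} {ω : Execution S}

theorem Admissible.hasSlopeBoundAt_start (hS : S.Valid) (h : ω.Admissible) (hreg : ω.RegularEntry)
    (i : Fin (S.N + 1)) {r : Q} (hr : S.OnManifold (ω.q i) r (ω.xstart i)) :
    HasSlopeBoundAt (fun t => S.m (ω.q i) r ⬝ᵥ ω.x i t + S.c (ω.q i) r)
      (Icc (ω.tstart i) (ω.tend i)) (ω.tstart i) := by
  obtain ⟨v, hv, hne⟩ := h.transversalStart hS hreg i hr
  exact hS.hasSlopeBoundAt_of_tendsto (h.Icc_subset i) (left_mem_Icc.2 (h.tstart_lt_tend i).le)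
    nhdsWithin_Icc_inf_ae_le_right (h.continuous i) (h.memLp i) (h.dynamics i) hv hne

theorem Admissible.hasSlopeBoundAt_end (hS : S.Valid) (h : ω.Admissible)
    (i : Fin (S.N + 1)) {r : Q} (hr : S.OnManifold (ω.q i) r (ω.xend i)) :
    HasSlopeBoundAt (fun t => S.m (ω.q i) r ⬝ᵥ ω.x i t + S.c (ω.q i) r)
      (Icc (ω.tstart i) (ω.tend i)) (ω.tend i) := by
  obtain ⟨v, hv, hne⟩ := h.transversalAt i hr
  exact hS.hasSlopeBoundAt_of_tendsto (h.Icc_subset i) (right_mem_Icc.2 (h.tstart_lt_tend i).le)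
    nhdsWithin_Icc_inf_ae_le_left (h.continuous i) (h.memLp i) (h.dynamics i) hv hne

/-- The first variation of the cost vanishes for the variations of the control that keep the start
of the segment fixed and its end, to first order, on the switching manifold. -/
theorem IsOptimal.firstVariation_eq_zero [Finite Q] (hS : S.Valid) (hopt : ω.IsOptimal)
    (hreg : ω.RegularEntry) {i : Fin (S.N + 1)} {μ : Fin (S.n (ω.q i)) → ℝ} {h : ℝ}
    (hc : ω.ContinuationBound i μ h)
    {w : ℝ → Fin (S.k (ω.q i)) → ℝ} {y : ℝ → Fin (S.n (ω.q i)) → ℝ}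
    (hy : S.IsVariation (ω.q i) (ω.tstart i) (ω.tend i) w y) (hya : y (ω.tstart i) = 0)
    (hyb : ∀ r, S.OnManifold (ω.q i) r (ω.xend i) → S.m (ω.q i) r ⬝ᵥ y (ω.tend i) = 0) :
    S.firstVariation (ω.q i) (ω.endWeight i) (S.d i (ω.q i)) (ω.tstart i) (ω.tend i) (ω.u i)
      (ω.x i) w y + μ ⬝ᵥ y (ω.tend i) = 0 := by
  have hadm := hopt.1
  have hlt := hadm.tstart_lt_tend i
  have hI := hadm.Icc_subset i
  have hae : ω.tstart i ∈ Icc (ω.tstart i) (ω.tend i) := left_mem_Icc.2 hlt.le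
  have hbe : ω.tend i ∈ Icc (ω.tstart i) (ω.tend i) := right_mem_Icc.2 hlt.le
  refine eq_zero_of_forall_eventually_nonneg fun ε hε => ?_
  obtain ⟨Y, hY, hyY, hyL⟩ := hy.exists_bound hS hI
  obtain ⟨δ₁, hδ₁, H₁⟩ := hc (ε / (2 * Y)) (by positivity)
  obtain ⟨δ₂, hδ₂, H₂⟩ := Problem.exists_forall_perturbed_no_contact (hadm.continuous i) hae hbe
    (hadm.no_contact i) (fun r hr => hadm.hasSlopeBoundAt_start hS hreg i hr)
    (fun r hr => hadm.hasSlopeBoundAt_end hS i hr)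
  set q2 := S.secondVariation (ω.q i) (ω.endWeight i) (ω.tstart i) (ω.tend i) w y
  have hsmall : ∀ (C η : ℝ), 0 < η → ∀ᶠ e in 𝓝 (0 : ℝ), |e| * C < η := fun C η hη => by
    have hcont : Continuous fun e : ℝ => |e| * C := by fun_prop
    exact hcont.continuousAt.eventually_lt continuousAt_const (by simpa using hη)
  have htrans : ∀ᶠ e in 𝓝 (0 : ℝ), ∀ r, S.OnManifold (ω.q i) r (ω.xend i) →
      S.TransversalAt (ω.q i) (ω.u i + e • w) (ω.tend i) (ω.xend i + e • y (ω.tend i)) r :=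
    eventually_all.2 fun r => by
      by_cases hr : S.OnManifold (ω.q i) r (ω.xend i)
      · filter_upwards [(hadm.transversalAt i hr).eventually_add (η := y (ω.tend i))
          hy.continuous] with e he _ using he
      · exact Eventually.of_forall fun e h => absurd h hr
  filter_upwards [hsmall Y δ₁ hδ₁, hsmall Y δ₂ hδ₂, hsmall |q2| (ε / 2) (half_pos hε), htrans]
    with e he1 he2 he3 he4
  have hey := hy.const_smul e
  have hbound : ∀ t ∈ Icc (ω.tstart i) (ω.tend i), ‖(e • y) t‖ ≤ |e| * Y := fun t ht => by
    rw [Pi.smul_apply, norm_smul, Real.norm_eq_abs]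
    exact mul_le_mul_of_nonneg_left (hyY t ht) (abs_nonneg e)
  have hman : ∀ r, S.OnManifold (ω.q i) r (ω.xend i) →
      S.OnManifold (ω.q i) r (ω.xend i + e • y (ω.tend i)) := fun r hr => by
    unfold Problem.OnManifold at hr ⊢
    rw [dotProduct_add, dotProduct_smul, hyb r hr, smul_zero, add_zero, hr]
  have hseg := (hadm.segmentOK i).add hS hI hey (H₂ _ _ _ hae hbe (by simpa using hδ₂)
    (by simpa using hδ₂) (fun t ht => (hbound t ht).trans he2.le) (fun s hs t ht => by
      rw [Pi.smul_apply, Pi.smul_apply, ← smul_sub, norm_smul, Real.norm_eq_abs]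
      calc |e| * ‖y t - y s‖ ≤ |e| * (Y * |t - s|) :=
            mul_le_mul_of_nonneg_left (hyL s hs t ht) (abs_nonneg e)
        _ = |e| * Y * |t - s| := (mul_assoc _ _ _).symm
        _ ≤ δ₂ * |t - s| := mul_le_mul_of_nonneg_right he2.le (abs_nonneg _))
    (fun r hr => by simpa [hya] using hr) hman)
  have hζ : (ω.x i + e • y) (ω.tend i) - ω.xend i = e • y (ω.tend i) := add_sub_cancel_left _ _
  have hcont := H₁ (ω.tend i) ((ω.x i + e • y) (ω.tend i)) (ω.u i + e • w) (by simpa using hδ₁)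
    (by rw [hζ]; exact (hbound _ hbe).trans_lt he1)
    (fun hi => by subst hi; exact hadm.finish) (fun r hr => ⟨hman r hr, he4 r hr⟩)
  have hstart : (ω.x i + e • y) (ω.tstart i) = ω.xstart i := by
    simp [hya, xstart]
  have htail := hcont.hasTail hseg
  rw [hstart, hζ] at htail
  have hnn := htail.nonneg hopt
  rw [hS.segmentCost_add hlt.le hI (ω.endWeight_posSemidef hS i).isHermitian (hadm.continuous i)
    (hadm.memLp i) hey, Problem.firstVariation_const_smul, Problem.secondVariation_const_smul,
    segCost, dotProduct_smul, smul_eq_mul, sub_self, abs_zero, mul_zero, sub_zero, zero_add] at hnn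
  have h1 : ε / (2 * Y) * ‖e • y (ω.tend i)‖ ≤ ε / 2 * |e| := by
    calc _ ≤ ε / (2 * Y) * (|e| * Y) :=
          mul_le_mul_of_nonneg_left (hbound _ hbe) (by positivity)
      _ = _ := by field_simp
  have h2 : e ^ 2 * q2 ≤ ε / 2 * |e| := by
    calc e ^ 2 * q2 ≤ |e| ^ 2 * |q2| := by
          rw [sq_abs]; exact mul_le_mul_of_nonneg_left (le_abs_self _) (sq_nonneg _)
      _ = |e| * |q2| * |e| := by ring
      _ ≤ _ := mul_le_mul_of_nonneg_right he3.le (abs_nonneg _)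
  linarith

/-- Lagrange multipliers for the condition that the end stays on a hyperplane with normal `m`.
Either this condition is void for the variations of the control, and the multiplier is arbitrary; or
it is not, and there is a multiplier. -/
theorem IsOptimal.exists_multiplier [Finite Q] (hS : S.Valid) (hopt : ω.IsOptimal)
    (hreg : ω.RegularEntry) {i : Fin (S.N + 1)} {μ : Fin (S.n (ω.q i)) → ℝ} {h : ℝ}
    (hc : ω.ContinuationBound i μ h) {m : Fin (S.n (ω.q i)) → ℝ}
    (hm : ∀ r, S.OnManifold (ω.q i) r (ω.xend i) → S.m (ω.q i) r = m) :
    (∀ p : ℝ, ∀ w y, S.IsVariation (ω.q i) (ω.tstart i) (ω.tend i) w y → y (ω.tstart i) = 0 →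
      S.firstVariation (ω.q i) (ω.endWeight i) (S.d i (ω.q i)) (ω.tstart i) (ω.tend i) (ω.u i)
        (ω.x i) w y + (μ + p • m) ⬝ᵥ y (ω.tend i) = 0) ∨
    ((∃ w y, S.IsVariation (ω.q i) (ω.tstart i) (ω.tend i) w y ∧ y (ω.tstart i) = 0 ∧
      m ⬝ᵥ y (ω.tend i) ≠ 0) ∧
     ∃ p : ℝ, ∀ w y, S.IsVariation (ω.q i) (ω.tstart i) (ω.tend i) w y → y (ω.tstart i) = 0 →
      S.firstVariation (ω.q i) (ω.endWeight i) (S.d i (ω.q i)) (ω.tstart i) (ω.tend i) (ω.u i)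
        (ω.x i) w y + (μ + p • m) ⬝ᵥ y (ω.tend i) = 0) := by
  have hadm := hopt.1
  have hlt := hadm.tstart_lt_tend i
  have hI := hadm.Icc_subset i
  have key : ∀ w y, S.IsVariation (ω.q i) (ω.tstart i) (ω.tend i) w y → y (ω.tstart i) = 0 →
      m ⬝ᵥ y (ω.tend i) = 0 →
      S.firstVariation (ω.q i) (ω.endWeight i) (S.d i (ω.q i)) (ω.tstart i) (ω.tend i) (ω.u i)
        (ω.x i) w y + μ ⬝ᵥ y (ω.tend i) = 0 := fun w y hy hya hyb =>
    hopt.firstVariation_eq_zero hS hreg hc hy hya fun r hr => by rw [hm r hr, hyb]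
  by_cases hcase : ∃ w y, S.IsVariation (ω.q i) (ω.tstart i) (ω.tend i) w y ∧
      y (ω.tstart i) = 0 ∧ m ⬝ᵥ y (ω.tend i) ≠ 0
  · right
    refine ⟨hcase, ?_⟩
    obtain ⟨w₀, y₀, hy₀, hya₀, hyb₀⟩ := hcase
    set D₀ := S.firstVariation (ω.q i) (ω.endWeight i) (S.d i (ω.q i)) (ω.tstart i) (ω.tend i)
      (ω.u i) (ω.x i) w₀ y₀ with hD₀
    refine ⟨-(D₀ + μ ⬝ᵥ y₀ (ω.tend i)) / (m ⬝ᵥ y₀ (ω.tend i)), fun w y hy hya => ?_⟩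
    -- subtract the multiple of `y₀` that brings the end of `y` to the hyperplane
    set c := -(m ⬝ᵥ y (ω.tend i)) / (m ⬝ᵥ y₀ (ω.tend i)) with hcdef
    have hcm : c * (m ⬝ᵥ y₀ (ω.tend i)) = -(m ⬝ᵥ y (ω.tend i)) := div_mul_cancel₀ _ hyb₀
    have h1 := key (w + c • w₀) (y + c • y₀) (hy.add (hy₀.const_smul c)) (by simp [hya, hya₀])
      (by simp [dotProduct_add, dotProduct_smul, hcm])
    rw [hS.firstVariation_add hlt.le hI (hadm.continuous i) (hadm.memLp i) hy (hy₀.const_smul c),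
      Problem.firstVariation_const_smul, ← hD₀] at h1
    simp only [Pi.add_apply, Pi.smul_apply, dotProduct_add, dotProduct_smul, smul_eq_mul,
      add_dotProduct, smul_dotProduct] at h1 ⊢
    have h2 : -(D₀ + μ ⬝ᵥ y₀ (ω.tend i)) / (m ⬝ᵥ y₀ (ω.tend i)) * (m ⬝ᵥ y (ω.tend i)) =
        c * (D₀ + μ ⬝ᵥ y₀ (ω.tend i)) := by
      rw [hcdef]; ring
    rw [h2]
    linarith
  · left
    push Not at hcase
    intro p w y hy hya
    have h0 := hcase w y hy hya
    have := key w y hy hya h0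
    rw [add_dotProduct, smul_dotProduct, h0, smul_zero, add_zero, this]

/-- A segment of an optimal execution is an extremal. If the end value of the adjoint does not yet
account for the continuity of the Hamiltonian, the end can be moved freely: there is no contact, or
the control can move it across the switching manifold. -/
theorem IsOptimal.exists_isExtremalOn [Finite Q] (hS : S.Valid) (hopt : ω.IsOptimal)
    (hreg : ω.RegularEntry) {i : Fin (S.N + 1)} {μ : Fin (S.n (ω.q i)) → ℝ} {h : ℝ}
    (hc : ω.ContinuationBound i μ h) {m : Fin (S.n (ω.q i)) → ℝ}
    (hm : ∀ r, S.OnManifold (ω.q i) r (ω.xend i) → S.m (ω.q i) r = m) :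
    ∃ (p : ℝ) (x lam : ℝ → Fin (S.n (ω.q i)) → ℝ),
      S.IsExtremalOn (ω.q i) (Icc S.t₀ S.tf) x lam ∧
      EqOn x (ω.x i) (Icc (ω.tstart i) (ω.tend i)) ∧
      (∀ᵐ t ∂(volume.restrict (Icc (ω.tstart i) (ω.tend i))),
        ω.u i t = S.law (ω.q i) t (lam t)) ∧
      lam (ω.tend i) = ω.endWeight i *ᵥ (ω.xend i - S.d i (ω.q i)) + (μ + p • m) ∧
      (S.minHamiltonian (ω.q i) (ω.tend i) (ω.xend i) (lam (ω.tend i)) = h ∨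
        (∀ r, ¬ S.OnManifold (ω.q i) r (ω.xend i)) ∨
        ∃ w y, S.IsVariation (ω.q i) (ω.tstart i) (ω.tend i) w y ∧ y (ω.tstart i) = 0 ∧
          m ⬝ᵥ y (ω.tend i) ≠ 0) := by
  have hadm := hopt.1
  have hlt := hadm.tstart_lt_tend i
  have hI := hadm.Icc_subset i
  have hbe : ω.tend i ∈ Icc (ω.tstart i) (ω.tend i) := right_mem_Icc.2 hlt.le
  have main : ∀ p : ℝ, (∀ w y, S.IsVariation (ω.q i) (ω.tstart i) (ω.tend i) w y →
      y (ω.tstart i) = 0 →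
      S.firstVariation (ω.q i) (ω.endWeight i) (S.d i (ω.q i)) (ω.tstart i) (ω.tend i) (ω.u i)
        (ω.x i) w y + (μ + p • m) ⬝ᵥ y (ω.tend i) = 0) →
      ∃ x lam : ℝ → Fin (S.n (ω.q i)) → ℝ,
        S.IsExtremalOn (ω.q i) (Icc S.t₀ S.tf) x lam ∧
        EqOn x (ω.x i) (Icc (ω.tstart i) (ω.tend i)) ∧
        (∀ᵐ t ∂(volume.restrict (Icc (ω.tstart i) (ω.tend i))),
          ω.u i t = S.law (ω.q i) t (lam t)) ∧
        lam (ω.tend i) = ω.endWeight i *ᵥ (ω.xend i - S.d i (ω.q i)) + (μ + p • m) := by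
    intro p hp
    have hA : ContinuousOn (fun t => -(S.A (ω.q i) t)ᵀ) (Icc (ω.tstart i) (ω.tend i)) := by
      have := (hS.continuousOn_A (ω.q i)).mono hI
      fun_prop
    have hg : ContinuousOn (fun t => -(S.L (ω.q i) t *ᵥ (ω.x i t - S.r (ω.q i) t)))
        (Icc (ω.tstart i) (ω.tend i)) := by
      have h1 := (hS.continuousOn_L (ω.q i)).mono hI
      have h2 := (hS.continuous_r (ω.q i)).mono hI
      have h3 := hadm.continuous i
      fun_prop
    obtain ⟨l, hlb, hl⟩ := exists_solution_linear hbe (continuousOn_mulVecCLM hA) hg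
      (ω.endWeight i *ᵥ (ω.xend i - S.d i (ω.q i)) + (μ + p • m))
    have hl' : ∀ t ∈ Icc (ω.tstart i) (ω.tend i), HasDerivWithinAt l
        (-((S.A (ω.q i) t)ᵀ *ᵥ l t) - S.L (ω.q i) t *ᵥ (ω.x i t - S.r (ω.q i) t))
        (Icc (ω.tstart i) (ω.tend i)) t := fun t ht => by
      have := hl t ht
      rwa [mulVecCLM_apply, neg_mulVec, ← sub_eq_add_neg] at this
    have hlaw := hS.ae_eq_law hlt hI (hadm.continuous i) (hadm.memLp i) hl' hlb hp
    obtain ⟨x, lam, hext, hx, hlam⟩ := (hS.isExtremalOn hI (hadm.continuous i)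
      (hadm.dynamics i) hl' hlaw).exists_extension hS hlt.le hI
    refine ⟨x, lam, hext, hx, ?_, (hlam hbe).trans hlb⟩
    filter_upwards [hlaw, ae_restrict_mem measurableSet_Icc] with t ht hmem
    rw [ht, hlam hmem]
  rcases hopt.exists_multiplier hS hreg hc hm with hall | ⟨hvar, p, hp⟩
  · by_cases hcontact : ∃ r, S.OnManifold (ω.q i) r (ω.xend i)
    · obtain ⟨r, hr⟩ := hcontact
      obtain ⟨v, hv, hne⟩ := hadm.transversalAt i hr
      rw [hm r hr] at hne
      set f := S.field (ω.q i) (ω.tend i) (ω.xend i) v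
      set l₀ := ω.endWeight i *ᵥ (ω.xend i - S.d i (ω.q i)) + μ with hl₀
      -- the multiplier is chosen such that the Hamiltonian of the control limit `v` equals `h`
      set p := (h - S.runningCost (ω.q i) (ω.tend i) (ω.xend i) v - l₀ ⬝ᵥ f) / (m ⬝ᵥ f) with hp
      obtain ⟨x, lam, hext, hx, hlaw, hlb⟩ := main p (hall p)
      refine ⟨p, x, lam, hext, hx, hlaw, hlb, Or.inl ?_⟩
      have hvlaw : v = S.law (ω.q i) (ω.tend i) (lam (ω.tend i)) :=
        Problem.eq_of_tendsto_of_ae_eq hlt hbe nhdsWithin_Icc_inf_ae_le_left hv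
          ((hS.continuousOn_law Subset.rfl hext.continuousOn_adjoint).mono hI) hlaw
      rw [← hS.hamiltonian_law (hI hbe), ← hvlaw, Problem.hamiltonian, hlb, ← add_assoc, ← hl₀,
        add_dotProduct, smul_dotProduct, smul_eq_mul, hp, div_mul_cancel₀ _ hne]
      ring
    · push Not at hcontact
      obtain ⟨x, lam, hext, hx, hlaw, hlb⟩ := main 0 (hall 0)
      exact ⟨0, x, lam, hext, hx, hlaw, hlb, Or.inr (Or.inl hcontact)⟩
  · obtain ⟨x, lam, hext, hx, hlaw, hlb⟩ := main p hp
    exact ⟨p, x, lam, hext, hx, hlaw, hlb, Or.inr (Or.inr hvar)⟩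

end Execution

/-! ### Perturbations of extremals -/

theorem exists_quadratic_bound {n : ℕ} {M : ℝ → Matrix (Fin n) (Fin n) ℝ} {I : Set ℝ}
    (hI : IsCompact I) (hM : ContinuousOn M I) :
    ∃ C, 0 ≤ C ∧ ∀ t ∈ I, ∀ v, |v ⬝ᵥ (M t *ᵥ v)| ≤ C * ‖v‖ ^ 2 := by
  obtain ⟨C, hC⟩ := hI.exists_bound_of_continuousOn (continuousOn_mulVecCLM hM)
  refine ⟨n * |C|, by positivity, fun t ht v => (abs_dotProduct_le _ _).trans ?_⟩
  have h1 : ∑ i, |v i| ≤ n * ‖v‖ := by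
    calc ∑ i, |v i| ≤ ∑ _i : Fin n, ‖v‖ := Finset.sum_le_sum fun i _ => norm_le_pi_norm v i
      _ = _ := by simp
  have h2 : ‖M t *ᵥ v‖ ≤ |C| * ‖v‖ :=
    ((mulVecCLM (M t)).le_opNorm v).trans
      (mul_le_mul_of_nonneg_right ((hC t ht).trans (le_abs_self C)) (norm_nonneg v))
  calc _ ≤ n * ‖v‖ * (|C| * ‖v‖) := mul_le_mul h1 h2 (norm_nonneg _) (by positivity)
    _ = _ := by ring

/-- A function vanishing at `b` with a nonzero derivative there has, after a perturbation of size
`s`, a zero at a distance of order `s` from `b`. -/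
theorem exists_perturbed_zero {g : ℝ → ℝ} {T₀ T₁ b γ : ℝ} (hg : ContinuousOn g (Icc T₀ T₁))
    (hb : b ∈ Ioo T₀ T₁) (h0 : g b = 0) (hd : HasDerivWithinAt g γ (Icc T₀ T₁) b) (hγ : γ ≠ 0) :
    ∃ C > 0, ∃ δ > 0, ∀ s, 0 ≤ s → s < δ → ∀ z : ℝ → ℝ, ContinuousOn z (Icc T₀ T₁) →
      (∀ t ∈ Icc T₀ T₁, |t - b| ≤ C * s → |z t| ≤ s) →
      ∃ b' ∈ Icc T₀ T₁, |b' - b| ≤ C * s ∧ g b' + z b' = 0 := by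
  have hγ' : 0 < |γ| := abs_pos.2 hγ
  have hd' := (hasDerivWithinAt_iff_isLittleO.1 hd).bound (half_pos hγ')
  rw [nhdsWithin_eq_nhds.2 (Icc_mem_nhds hb.1 hb.2)] at hd'
  -- at the distance `2 s / |γ|` the linear part of `g` has size `2 s`, and the error at most `s`
  obtain ⟨δ, hδ, H⟩ := Metric.eventually_nhds_iff.1
    (hd'.and (Icc_mem_nhds hb.1 hb.2))
  refine ⟨2 / |γ|, by positivity, δ / (2 / |γ|), by positivity, fun s hs hsδ z hz hzs => ?_⟩
  set ρ := 2 / |γ| * s with hρ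
  have hρ0 : 0 ≤ ρ := by positivity
  have hρδ : ρ < δ := by rwa [lt_div_iff₀ (by positivity), mul_comm] at hsδ
  have hsρ : |γ| * ρ = 2 * s := by rw [hρ]; field_simp
  have hnear : ∀ t, |t - b| ≤ ρ → |g t - (t - b) * γ| ≤ |γ| / 2 * |t - b| ∧ t ∈ Icc T₀ T₁ := by
    intro t ht
    have := H (y := t) (by rw [Real.dist_eq]; exact ht.trans_lt hρδ)
    simpa [h0] using this
  have hp : |b + ρ - b| ≤ ρ := by rw [add_sub_cancel_left, abs_of_nonneg hρ0]
  have hm : |b - ρ - b| ≤ ρ := by rw [sub_sub_cancel_left, abs_neg, abs_of_nonneg hρ0]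
  obtain ⟨gp, mp⟩ := hnear _ hp
  obtain ⟨gm, mm⟩ := hnear _ hm
  have zp := hzs _ mp hp
  have zm := hzs _ mm hm
  rw [add_sub_cancel_left, abs_of_nonneg hρ0] at gp
  rw [sub_sub_cancel_left, abs_neg, abs_of_nonneg hρ0] at gm
  have hsub : uIcc (b - ρ) (b + ρ) ⊆ Icc T₀ T₁ := uIcc_subset_Icc mm mp
  have hivt := intermediate_value_uIcc ((hg.add hz).mono hsub)
  have hzero : (0 : ℝ) ∈ uIcc (g (b - ρ) + z (b - ρ)) (g (b + ρ) + z (b + ρ)) := by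
    rw [abs_le] at gp gm zp zm
    rw [mem_uIcc]
    rcases lt_or_gt_of_ne hγ with h | h
    · rw [abs_of_neg h] at hsρ gp gm
      right; constructor <;> linarith
    · rw [abs_of_pos h] at hsρ gp gm
      left; constructor <;> linarith
  obtain ⟨t, ht, ht0⟩ := hivt hzero
  refine ⟨t, hsub ht, ?_, ht0⟩
  rw [uIcc_of_le (by linarith)] at ht
  rw [abs_le]
  constructor <;> linarith [ht.1, ht.2]

namespace Problem

variable {Q E : Type*} {S : Problem Q E} {q : Q}

namespace IsExtremalOn

variable {X lam : ℝ → Fin (S.n q) → ℝ}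

theorem continuousOn_control (hS : S.Valid) (h : S.IsExtremalOn q (Icc S.t₀ S.tf) X lam) :
    ContinuousOn (fun t => S.law q t (lam t)) (Icc S.t₀ S.tf) :=
  hS.continuousOn_law Subset.rfl h.continuousOn_adjoint

theorem continuousOn_velocity (hS : S.Valid) (h : S.IsExtremalOn q (Icc S.t₀ S.tf) X lam) :
    ContinuousOn (fun t => S.field q t (X t) (S.law q t (lam t))) (Icc S.t₀ S.tf) :=
  hS.continuousOn_field Subset.rfl h.continuousOn_state (h.continuousOn_control hS)

theorem exists_lipschitz (hS : S.Valid) (h : S.IsExtremalOn q (Icc S.t₀ S.tf) X lam) :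
    ∃ C, 0 ≤ C ∧ ∀ s ∈ Icc S.t₀ S.tf, ∀ t ∈ Icc S.t₀ S.tf, ‖X t - X s‖ ≤ C * |t - s| := by
  obtain ⟨C, hC⟩ := isCompact_Icc.exists_bound_of_continuousOn (h.continuousOn_velocity hS)
  exact ⟨|C|, abs_nonneg C, fun s hs t ht =>
    (convex_Icc _ _).norm_image_sub_le_of_norm_hasDerivWithin_le h.state
      (fun t ht => (hC t ht).trans (le_abs_self C)) hs ht⟩

/-- Derivative of the cost plus the pairing of the state with a constant adjoint: this is the
minimized Hamiltonian. -/
theorem hasDerivWithinAt_cost_add_pairing (hS : S.Valid)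
    (h : S.IsExtremalOn q (Icc S.t₀ S.tf) X lam) {e : ℝ} (he : e ∈ Icc S.t₀ S.tf) :
    HasDerivWithinAt
      (fun t => lam e ⬝ᵥ X t + ∫ τ in e..t, S.runningCost q τ (X τ) (S.law q τ (lam τ)))
      (S.minHamiltonian q e (X e) (lam e)) (Icc S.t₀ S.tf) e := by
  rw [← hS.hamiltonian_law he, hamiltonian]
  have hc := hS.continuousOn_runningCost Subset.rfl h.continuousOn_state (h.continuousOn_control hS)
  have : Fact (e ∈ Icc S.t₀ S.tf) := ⟨he⟩
  refine ((dotCLM (lam e)).hasFDerivAt.comp_hasDerivWithinAt e (h.state e he)).add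
    (intervalIntegral.integral_hasDerivWithinAt_right (by simp)
      (s := Icc S.t₀ S.tf) (t := Icc S.t₀ S.tf)
      (hc.stronglyMeasurableAtFilter_nhdsWithin measurableSet_Icc e) (hc e he))

theorem hasDerivWithinAt_manifold (h : S.IsExtremalOn q (Icc S.t₀ S.tf) X lam) {e : ℝ}
    (he : e ∈ Icc S.t₀ S.tf) (r : Q) :
    HasDerivWithinAt (fun t => S.m q r ⬝ᵥ X t + S.c q r)
      (S.m q r ⬝ᵥ S.field q e (X e) (S.law q e (lam e))) (Icc S.t₀ S.tf) e :=
  ((dotCLM (S.m q r)).hasFDerivAt.comp_hasDerivWithinAt e (h.state e he)).add_const (S.c q r)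

theorem hasSlopeBoundAt (hS : S.Valid) (h : S.IsExtremalOn q (Icc S.t₀ S.tf) X lam) {e : ℝ}
    (he : e ∈ Icc S.t₀ S.tf) {r : Q}
    (hr : S.m q r ⬝ᵥ S.field q e (X e) (S.law q e (lam e)) ≠ 0) :
    HasSlopeBoundAt (fun t => S.m q r ⬝ᵥ X t + S.c q r) (Icc S.t₀ S.tf) e := by
  have hab : S.t₀ ≤ S.tf := he.1.trans he.2
  refine hS.hasSlopeBoundAt_of_tendsto (F := 𝓝[Icc S.t₀ S.tf] e ⊓ ae volume) Subset.rfl he le_rfl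
    h.continuousOn_state (memLp_top_of_continuousOn (h.continuousOn_control hS)) (fun t ht => ?_)
    ((h.continuousOn_control hS e he).mono_left inf_le_left) hr
  rw [integral_eq_sub_of_hasDerivWithinAt_Icc (left_mem_Icc.2 hab) ht ht.1 h.state
    (((h.continuousOn_velocity hS).mono
      (Icc_subset_Icc_right ht.2)).intervalIntegrable_of_Icc ht.1)]
  abel

end IsExtremalOn

theorem Valid.segmentOK_of_hasDerivWithinAt (hS : S.Valid) {a b : ℝ} (ha : a ∈ Icc S.t₀ S.tf)
    (hb : b ∈ Icc S.t₀ S.tf) (hab : a < b) {u : ℝ → Fin (S.k q) → ℝ} {x : ℝ → Fin (S.n q) → ℝ}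
    (hu : ContinuousOn u (Icc S.t₀ S.tf))
    (hx : ∀ t ∈ Icc S.t₀ S.tf, HasDerivWithinAt x (S.field q t (x t) (u t)) (Icc S.t₀ S.tf) t)
    (hcontact : ∀ t ∈ Ioo a b, ∀ r, ¬ S.OnManifold q r (x t)) : S.SegmentOK q a b u x := by
  have hsub : Icc a b ⊆ Icc S.t₀ S.tf := Icc_subset_Icc ha.1 hb.2
  have hxc : ContinuousOn x (Icc S.t₀ S.tf) := fun t ht => (hx t ht).continuousWithinAt
  refine ⟨hab, ?_, hxc.mono hsub, fun t ht => ?_, hcontact⟩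
  · rw [Measure.restrict_congr_set Ico_ae_eq_Icc]
    exact memLp_top_of_continuousOn (hu.mono hsub)
  · rw [integral_eq_sub_of_hasDerivWithinAt_Icc ha (hsub ht) ht.1 hx
      (((hS.continuousOn_field Subset.rfl hxc hu).mono
        ((Icc_subset_Icc_right ht.2).trans hsub)).intervalIntegrable_of_Icc ht.1)]
    abel

/-- Solutions of the linearized dynamics without variation of the control are bounded, forward in
time, by their initial value. -/
theorem Valid.exists_variation_zero (hS : S.Valid) (q : Q) :
    ∃ C > 0, ∀ a ∈ Icc S.t₀ S.tf, ∀ η : Fin (S.n q) → ℝ, ∃ y,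
      S.IsVariation q S.t₀ S.tf 0 y ∧ y a = η ∧ (∀ t ∈ Icc a S.tf, ‖y t‖ ≤ C * ‖η‖) ∧
      ∀ s ∈ Icc a S.tf, ∀ t ∈ Icc a S.tf, ‖y t - y s‖ ≤ C * ‖η‖ * |t - s| := by
  obtain ⟨M₀, hM₀⟩ := isCompact_Icc.exists_bound_of_continuousOn
    (continuousOn_mulVecCLM (hS.continuousOn_A q))
  set M := |M₀| + 1 with hMdef
  have hM : 0 < M := by positivity
  have hA : ∀ t ∈ Icc S.t₀ S.tf, ∀ v : Fin (S.n q) → ℝ, ‖S.A q t *ᵥ v‖ ≤ M * ‖v‖ := fun t ht v =>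
    ((mulVecCLM (S.A q t)).le_opNorm v).trans (mul_le_mul_of_nonneg_right
      ((hM₀ t ht).trans (by linarith [le_abs_self M₀])) (norm_nonneg v))
  set Ex := Real.exp (M * (S.tf - S.t₀)) with hEx
  refine ⟨(M + 1) * Ex, by positivity, fun a ha η => ?_⟩
  obtain ⟨y, hya, hy⟩ := IsVariation.exists_solution hS Subset.rfl ha
    (w := 0) continuous_zero η
  have hsub : Icc a S.tf ⊆ Icc S.t₀ S.tf := Icc_subset_Icc_left ha.1
  have hd : ∀ t ∈ Icc a S.tf, HasDerivWithinAt y (S.A q t *ᵥ y t) (Icc a S.tf) t := fun t ht => by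
    simpa using (hy.deriv t (hsub ht)).mono hsub
  have hbound : ∀ t ∈ Icc a S.tf, ‖y t‖ ≤ Ex * ‖η‖ := by
    intro t ht
    have hsubt : Icc a t ⊆ Icc a S.tf := Icc_subset_Icc_right ht.2
    have h1 := norm_le_of_linear_growth hM (fun s hs => (hd s (hsubt hs)).mono hsubt)
      (fun s hs => hA s (hsub (hsubt hs)) (y s)) t (right_mem_Icc.2 ht.1)
    rw [hya] at h1
    refine h1.trans (mul_le_mul_of_nonneg_right (Real.exp_le_exp.2 ?_) (norm_nonneg _))
    exact mul_le_mul_of_nonneg_left (by linarith [ht.2, ha.1]) hM.le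
  have hE0 : 0 < Ex := Real.exp_pos _
  refine ⟨y, hy, hya, fun t ht => (hbound t ht).trans ?_, fun s hs t ht => ?_⟩
  · exact mul_le_mul_of_nonneg_right (by nlinarith) (norm_nonneg _)
  · refine (convex_Icc _ _).norm_image_sub_le_of_norm_hasDerivWithin_le hd (fun t ht => ?_) hs ht
    calc ‖S.A q t *ᵥ y t‖ ≤ M * ‖y t‖ := hA t (hsub ht) _
      _ ≤ M * (Ex * ‖η‖) := mul_le_mul_of_nonneg_left (hbound t ht) hM.le
      _ ≤ (M + 1) * Ex * ‖η‖ := by nlinarith [mul_nonneg hE0.le (norm_nonneg η)]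

end Problem

theorem eventually_forall_abs_sub_le {I : Set ℝ} {e : ℝ} {P : ℝ → Prop} (h : ∀ᶠ t in 𝓝[I] e, P t) :
    ∀ᶠ s in 𝓝[≥] (0 : ℝ), ∀ t ∈ I, |t - e| ≤ s → P t := by
  obtain ⟨δ, hδ, H⟩ := Metric.eventually_nhds_iff.1 (eventually_nhdsWithin_iff.1 h)
  filter_upwards [nhdsWithin_le_nhds (gt_mem_nhds hδ)] with s hs t ht hts
  exact H (by rw [Real.dist_eq]; exact hts.trans_lt hs) ht

theorem eventually_mul_le {C η : ℝ} (hη : 0 < η) : ∀ᶠ s in 𝓝[≥] (0 : ℝ), C * s ≤ η := by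
  have hcont : Continuous fun e : ℝ => C * e := by fun_prop
  exact nhdsWithin_le_nhds ((hcont.continuousAt.eventually_lt continuousAt_const
    (by simpa using hη)).mono fun _ h => h.le)

theorem eventually_abs_dotProduct_sub_le {n : ℕ} {lam : ℝ → Fin n → ℝ} {I : Set ℝ} {e ε : ℝ}
    (hl : ContinuousWithinAt lam I e) (hε : 0 < ε) :
    ∀ᶠ s in 𝓝[≥] (0 : ℝ), ∀ t ∈ I, |t - e| ≤ s → ∀ v : Fin n → ℝ, ‖v‖ ≤ s →
      |(lam t - lam e) ⬝ᵥ v| ≤ ε * s := by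
  have h1 : ContinuousWithinAt (fun t => ∑ i, |(lam t - lam e) i|) I e := by
    have : ContinuousWithinAt (fun t => lam t - lam e) I e := hl.sub continuousWithinAt_const
    exact (continuous_finsetSum _ fun i _ =>
      (continuous_apply i).abs).continuousAt.comp_continuousWithinAt this
  have h2 : ∀ᶠ t in 𝓝[I] e, ∑ i, |(lam t - lam e) i| ≤ ε :=
    (h1.eventually_lt continuousWithinAt_const (by simpa using hε)).mono fun _ h => h.le
  filter_upwards [eventually_forall_abs_sub_le h2] with s hs t ht hts v hv
  exact (abs_dotProduct_le _ _).trans (mul_le_mul (hs t ht hts) hv (norm_nonneg v) hε.le)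

namespace Problem

variable {Q E : Type*} {S : Problem Q E} {q : Q} {X lam : ℝ → Fin (S.n q) → ℝ}

/-- Excess cost of a perturbed extremal to first order, in terms of the perturbations of the time
and the state at both ends. -/
theorem IsExtremalOn.eventually_segmentCost_le (hS : S.Valid)
    (h : S.IsExtremalOn q (Icc S.t₀ S.tf) X lam) {a b : ℝ} (ha : a ∈ Icc S.t₀ S.tf)
    (hb : b ∈ Icc S.t₀ S.tf) {W : Matrix (Fin (S.n q)) (Fin (S.n q)) ℝ} (hW : W.IsHermitian)
    (d : Fin (S.n q) → ℝ) {ε : ℝ} (hε : 0 < ε) :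
    ∀ᶠ s in 𝓝[≥] (0 : ℝ), ∀ a' ∈ Icc S.t₀ S.tf, ∀ b' ∈ Icc S.t₀ S.tf, a' ≤ b' →
      |a' - a| ≤ s → |b' - b| ≤ s → ∀ w y, S.IsVariation q S.t₀ S.tf w y →
      (∀ t ∈ Icc a' b', ‖y t‖ ≤ s) → (∀ t ∈ Icc a' b', ‖w t‖ ≤ s) →
      S.segmentCost q W d a' b' ((fun t => S.law q t (lam t)) + w) (X + y)
        - S.segmentCost q W d a b (fun t => S.law q t (lam t)) X ≤
      lam a ⬝ᵥ (X a' + y a' - X a) - S.minHamiltonian q a (X a) (lam a) * (a' - a)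
      + S.minHamiltonian q b (X b) (lam b) * (b' - b)
      - (lam b - W *ᵥ (X b - d)) ⬝ᵥ (X b' + y b' - X b) + ε * s := by
  -- the error consists of six terms: those of the time and of the pairing at each end, and the
  -- quadratic terms of the running cost and of the end cost
  have h6 : 0 < ε / 6 := by positivity
  obtain ⟨C₁, hC₁, H₁⟩ := exists_quadratic_bound isCompact_Icc (hS.continuousOn_L q)
  obtain ⟨C₂, hC₂, H₂⟩ := exists_quadratic_bound isCompact_Icc (hS.continuousOn_R q)
  obtain ⟨C₃, hC₃, H₃⟩ := exists_quadratic_bound (isCompact_Icc (a := S.t₀) (b := S.tf))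
    (continuousOn_const (c := W))
  obtain ⟨Λ, hΛ, hlip⟩ := h.exists_lipschitz hS
  have ga := (hasDerivWithinAt_iff_isLittleO.1
    (h.hasDerivWithinAt_cost_add_pairing hS ha)).bound h6
  have gb := (hasDerivWithinAt_iff_isLittleO.1
    (h.hasDerivWithinAt_cost_add_pairing hS hb)).bound h6
  filter_upwards [self_mem_nhdsWithin, eventually_forall_abs_sub_le ga,
    eventually_forall_abs_sub_le gb,
    eventually_abs_dotProduct_sub_le (h.continuousOn_adjoint a ha) h6,
    eventually_abs_dotProduct_sub_le (h.continuousOn_adjoint b hb) h6,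
    eventually_mul_le (C := (C₁ + C₂) * (S.tf - S.t₀)) h6,
    eventually_mul_le (C := C₃ * (Λ + 1) ^ 2) h6]
    with s hs hga hgb hla hlb hs1 hs2 a' ha' b' hb' hab' haa hbb w y hy hys hws
  have hs0 : 0 ≤ s := hs
  have haI : a' ∈ Icc a' b' := left_mem_Icc.2 hab'
  have hbI : b' ∈ Icc a' b' := right_mem_Icc.2 hab'
  have hsub : Icc a' b' ⊆ Icc S.t₀ S.tf := Icc_subset_Icc ha'.1 hb'.2
  have hcc := hS.continuousOn_runningCost Subset.rfl h.continuousOn_state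
    (h.continuousOn_control hS)
  have hint : ∀ t₁ ∈ Icc S.t₀ S.tf, ∀ t₂ ∈ Icc S.t₀ S.tf, IntervalIntegrable
      (fun t => S.runningCost q t (X t) (S.law q t (lam t))) volume t₁ t₂ := fun t₁ h1 t₂ h2 =>
    (hcc.mono (uIcc_subset_Icc h1 h2)).intervalIntegrable
  have hcost := h.integral_runningCost_add hS hy.continuous.continuousOn hy.deriv ha' hb' hab'
  have hsplit : ∫ t in a'..b', S.runningCost q t (X t) (S.law q t (lam t)) =
      (∫ t in a..b, S.runningCost q t (X t) (S.law q t (lam t)))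
      + (∫ t in b..b', S.runningCost q t (X t) (S.law q t (lam t)))
      - ∫ t in a..a', S.runningCost q t (X t) (S.law q t (lam t)) := by
    rw [intervalIntegral.integral_add_adjacent_intervals (hint a ha b hb) (hint b hb b' hb'),
      intervalIntegral.integral_interval_sub_left (hint a ha b' hb') (hint a ha a' ha')]
  have hquad : ∫ t in a'..b', (1 / 2 * (y t ⬝ᵥ (S.L q t *ᵥ y t))
      + 1 / 2 * (w t ⬝ᵥ (S.R q t *ᵥ w t))) ≤ ε / 6 * s := by
    have h1 : ∀ t ∈ uIoc a' b', ‖1 / 2 * (y t ⬝ᵥ (S.L q t *ᵥ y t))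
        + 1 / 2 * (w t ⬝ᵥ (S.R q t *ᵥ w t))‖ ≤ (C₁ + C₂) * s ^ 2 := by
      intro t ht
      rw [uIoc_of_le hab'] at ht
      have htI : t ∈ Icc a' b' := ⟨ht.1.le, ht.2⟩
      have e1 := (H₁ t (hsub htI) (y t)).trans (mul_le_mul_of_nonneg_left
        (pow_le_pow_left₀ (norm_nonneg _) (hys t htI) 2) hC₁)
      have e2 := (H₂ t (hsub htI) (w t)).trans (mul_le_mul_of_nonneg_left
        (pow_le_pow_left₀ (norm_nonneg _) (hws t htI) 2) hC₂)
      rw [Real.norm_eq_abs]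
      rw [abs_le] at e1 e2 ⊢
      constructor <;> nlinarith [mul_nonneg hC₁ (sq_nonneg s), mul_nonneg hC₂ (sq_nonneg s)]
    refine (le_abs_self _).trans ((intervalIntegral.norm_integral_le_of_norm_le_const h1).trans ?_)
    rw [abs_of_nonneg (sub_nonneg.2 hab')]
    have h2 : b' - a' ≤ S.tf - S.t₀ := by linarith [ha'.1, hb'.2]
    calc (C₁ + C₂) * s ^ 2 * (b' - a') ≤ (C₁ + C₂) * s ^ 2 * (S.tf - S.t₀) :=
          mul_le_mul_of_nonneg_left h2 (by positivity)
      _ = (C₁ + C₂) * (S.tf - S.t₀) * s * s := by ring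
      _ ≤ ε / 6 * s := mul_le_mul_of_nonneg_right hs1 hs0
  set Δ := X b' + y b' - X b with hΔ
  have hΔs : ‖Δ‖ ≤ (Λ + 1) * s := by
    calc ‖Δ‖ = ‖(X b' - X b) + y b'‖ := by rw [hΔ]; congr 1; abel
      _ ≤ ‖X b' - X b‖ + ‖y b'‖ := norm_add_le _ _
      _ ≤ Λ * |b' - b| + s := add_le_add (hlip b hb b' hb') (hys b' hbI)
      _ ≤ Λ * s + s := by linarith [mul_le_mul_of_nonneg_left hbb hΛ]
      _ = _ := by ring
  have hWΔ : 1 / 2 * (Δ ⬝ᵥ (W *ᵥ Δ)) ≤ ε / 6 * s := by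
    have e1 := (le_abs_self _).trans ((H₃ b hb Δ).trans (mul_le_mul_of_nonneg_left
      (pow_le_pow_left₀ (norm_nonneg _) hΔs 2) hC₃))
    have e2 := mul_le_mul_of_nonneg_right hs2 hs0
    have e3 : 0 ≤ C₃ * ((Λ + 1) * s) ^ 2 := by positivity
    have e4 : C₃ * (Λ + 1) ^ 2 * s * s = C₃ * ((Λ + 1) * s) ^ 2 := by ring
    linarith
  have hend : (X b' + y b' - d) ⬝ᵥ (W *ᵥ (X b' + y b' - d)) =
      (X b - d) ⬝ᵥ (W *ᵥ (X b - d)) + 2 * ((W *ᵥ (X b - d)) ⬝ᵥ Δ) + Δ ⬝ᵥ (W *ᵥ Δ) := by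
    rw [← quadratic_expansion hW, hΔ, show X b - d + (X b' + y b' - X b) = X b' + y b' - d by abel]
  have hga' := hga a' ha' haa
  have hgb' := hgb b' hb' hbb
  simp only [intervalIntegral.integral_same, add_zero, smul_eq_mul, Real.norm_eq_abs] at hga' hgb'
  have hla' := hla a' ha' haa (y a') (hys a' haI)
  have hlb' := hlb b' hb' hbb (y b') (hys b' hbI)
  have hga2 := (abs_le.1 hga').1
  have hgb2 := (abs_le.1 hgb').2
  have hla2 := (abs_le.1 hla').2
  have hlb2 := (abs_le.1 hlb').1
  have haa2 := mul_le_mul_of_nonneg_left haa h6.le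
  have hbb2 := mul_le_mul_of_nonneg_left hbb h6.le
  unfold segmentCost
  simp only [Pi.add_apply]
  rw [hcost, hsplit, hend, sub_dotProduct (lam b)]
  have e1 : lam a ⬝ᵥ (X a' + y a' - X a) = lam a ⬝ᵥ X a' + lam a ⬝ᵥ y a' - lam a ⬝ᵥ X a := by
    rw [dotProduct_sub, dotProduct_add]
  have e2 : lam b ⬝ᵥ Δ = lam b ⬝ᵥ X b' + lam b ⬝ᵥ y b' - lam b ⬝ᵥ X b := by
    rw [hΔ, dotProduct_sub, dotProduct_add]
  rw [sub_dotProduct] at hla2 hlb2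
  rw [e1, e2]
  linarith

/-- A transversal contact of an extremal stays transversal under small perturbations. -/
theorem IsExtremalOn.eventually_transversalAt (hS : S.Valid)
    (h : S.IsExtremalOn q (Icc S.t₀ S.tf) X lam) {b : ℝ} (hb : b ∈ Ioc S.t₀ S.tf) {r : Q}
    (hr : S.m q r ⬝ᵥ S.field q b (X b) (S.law q b (lam b)) ≠ 0) :
    ∀ᶠ s in 𝓝[≥] (0 : ℝ), ∀ b' ∈ Icc S.t₀ S.tf, |b' - b| ≤ s → ∀ w : ℝ → Fin (S.k q) → ℝ,
      Continuous w → ‖w b'‖ ≤ s → ∀ η : Fin (S.n q) → ℝ, ‖η‖ ≤ s →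
      S.TransversalAt q ((fun t => S.law q t (lam t)) + w) b' (X b' + η) r := by
  have hbI : b ∈ Icc S.t₀ S.tf := Ioc_subset_Icc_self hb
  set Φ : ℝ × (Fin (S.n q) → ℝ) × (Fin (S.k q) → ℝ) → ℝ := fun z =>
    S.m q r ⬝ᵥ S.field q z.1 (X z.1 + z.2.1) (S.law q z.1 (lam z.1) + z.2.2) with hΦ
  have hΦc : ContinuousWithinAt Φ (Icc S.t₀ S.tf ×ˢ univ) (b, 0, 0) := by
    have hmaps : MapsTo Prod.fst
        (Icc S.t₀ S.tf ×ˢ (univ : Set ((Fin (S.n q) → ℝ) × (Fin (S.k q) → ℝ)))) (Icc S.t₀ S.tf) :=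
      fun z hz => hz.1
    have h1 := (hS.continuousOn_A q).comp continuousOn_fst hmaps
    have h2 := (hS.continuousOn_B q).comp continuousOn_fst hmaps
    have h3 := (hS.continuousOn_F q).comp continuousOn_fst hmaps
    have h4 := h.continuousOn_state.comp continuousOn_fst hmaps
    have h5 := (h.continuousOn_control hS).comp continuousOn_fst hmaps
    simp only [Function.comp_def] at h1 h2 h3 h4 h5
    have h6 := h4.add (continuous_snd.fst.continuousOn (s := Icc S.t₀ S.tf ×ˢ
      (univ : Set ((Fin (S.n q) → ℝ) × (Fin (S.k q) → ℝ)))))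
    have h7 := h5.add (continuous_snd.snd.continuousOn (s := Icc S.t₀ S.tf ×ˢ
      (univ : Set ((Fin (S.n q) → ℝ) × (Fin (S.k q) → ℝ)))))
    have hcont : Continuous fun z : Matrix (Fin (S.n q)) (Fin (S.n q)) ℝ ×
        Matrix (Fin (S.n q)) (Fin (S.k q)) ℝ × (Fin (S.n q) → ℝ) × (Fin (S.n q) → ℝ) ×
          (Fin (S.k q) → ℝ) =>
        S.m q r ⬝ᵥ (z.1 *ᵥ z.2.2.2.1 + z.2.1 *ᵥ z.2.2.2.2 + z.2.2.1) := by fun_prop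
    exact hcont.comp_continuousOn (h1.prodMk (h2.prodMk (h3.prodMk (h6.prodMk h7)))) _
      ⟨hbI, mem_univ _⟩
  have hne : ∀ᶠ z in 𝓝[Icc S.t₀ S.tf ×ˢ univ] (b, 0, 0), Φ z ≠ 0 :=
    hΦc.eventually_ne (by simpa [hΦ] using hr)
  obtain ⟨δ, hδ, H⟩ := Metric.eventually_nhds_iff.1 (eventually_nhdsWithin_iff.1 hne)
  have hpos : ∀ᶠ s in 𝓝[≥] (0 : ℝ), s < b - S.t₀ :=
    nhdsWithin_le_nhds (gt_mem_nhds (sub_pos.2 hb.1))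
  filter_upwards [nhdsWithin_le_nhds (gt_mem_nhds hδ), hpos]
    with s hs hst b' hb' hbb w hw hws η hη
  refine ⟨S.law q b' (lam b') + w b', ?_, ?_⟩
  · have hlt : S.t₀ < b' := by linarith [(abs_le.1 hbb).1]
    have hmem : Icc S.t₀ S.tf ∈ 𝓝[<] b' :=
      mem_of_superset (Ioo_mem_nhdsLT hlt) fun t ht => ⟨ht.1.le, ht.2.le.trans hb'.2⟩
    exact (((h.continuousOn_control hS b' hb').mono_left
      (nhdsWithin_le_iff.2 hmem)).mono_left inf_le_left).add
      ((hw.tendsto b').mono_left (inf_le_left.trans nhdsWithin_le_nhds))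
  · refine H (y := (b', η, w b')) ?_ ⟨hb', mem_univ _⟩
    rw [Prod.dist_eq, Prod.dist_eq, dist_zero_right, dist_zero_right, Real.dist_eq]
    exact max_lt (hbb.trans_lt hs) (max_lt (hη.trans_lt hs) (hws.trans_lt hs))

end Problem

/-! ### Extremal segments and the continuity of the Hamiltonian -/

namespace Execution

variable {Q E : Type*} {S : Problem Q E} {ω : Execution S}

theorem Admissible.tstart_mem (hadm : ω.Admissible) (i : Fin (S.N + 1)) :
    ω.tstart i ∈ Icc S.t₀ S.tf :=
  hadm.Icc_subset i (left_mem_Icc.2 (hadm.tstart_lt_tend i).le)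

theorem Admissible.tend_mem (hadm : ω.Admissible) (i : Fin (S.N + 1)) : ω.tend i ∈ Ioc S.t₀ S.tf :=
  ⟨(hadm.tstart_mem i).1.trans_lt (hadm.tstart_lt_tend i),
    (hadm.Icc_subset i (right_mem_Icc.2 (hadm.tstart_lt_tend i).le)).2⟩

theorem Admissible.tend_lt (hadm : ω.Admissible) {i : Fin (S.N + 1)} (hi : i ≠ Fin.last S.N) :
    ω.tend i < S.tf := by
  rw [← hadm.finish]
  refine hadm.strictMono ?_
  rw [← Fin.succ_last, Fin.succ_lt_succ_iff]
  exact lt_of_le_of_ne (Fin.le_last i) hi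

theorem Admissible.lt_tstart (hadm : ω.Admissible) {i : Fin (S.N + 1)} (hi : i ≠ 0) :
    S.t₀ < ω.tstart i := by
  rw [← hadm.start]
  exact hadm.strictMono (Fin.castSucc_pos_iff.2 (Fin.pos_iff_ne_zero.2 hi))

variable (ω) in
/-- The `i`-th segment of `ω` is part of an extremal `(X, lam)` on the whole time interval, whose
adjoint takes at the end of the segment the value given by the cost at the end, by the first order
bound `μ`, `-h` for the cost after it, and by a covector `ν` that vanishes on the perturbations of
the end along the switching manifold. -/
structure ExtremalSegment (i : Fin (S.N + 1)) (μ : Fin (S.n (ω.q i)) → ℝ) (h : ℝ)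
    (X lam : ℝ → Fin (S.n (ω.q i)) → ℝ) (ν : Fin (S.n (ω.q i)) → ℝ) : Prop where
  bound : ω.ContinuationBound i μ h
  extremal : S.IsExtremalOn (ω.q i) (Icc S.t₀ S.tf) X lam
  eqOn : EqOn X (ω.x i) (Icc (ω.tstart i) (ω.tend i))
  law : ∀ᵐ t ∂(volume.restrict (Icc (ω.tstart i) (ω.tend i))),
    ω.u i t = S.law (ω.q i) t (lam t)
  lam_end : lam (ω.tend i) = ω.endWeight i *ᵥ (ω.xend i - S.d i (ω.q i)) + (μ + ν)
  orthogonal : ∀ ζ, (∀ r, S.OnManifold (ω.q i) r (ω.xend i) → S.OnManifold (ω.q i) r ζ) →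
    ν ⬝ᵥ (ζ - ω.xend i) = 0

namespace ExtremalSegment

variable {i : Fin (S.N + 1)} {μ ν : Fin (S.n (ω.q i)) → ℝ} {h : ℝ}
  {X lam : ℝ → Fin (S.n (ω.q i)) → ℝ}

theorem apply_tstart (hadm : ω.Admissible) (hx : ω.ExtremalSegment i μ h X lam ν) :
    X (ω.tstart i) = ω.xstart i :=
  hx.eqOn (left_mem_Icc.2 (hadm.tstart_lt_tend i).le)

theorem apply_tend (hadm : ω.Admissible) (hx : ω.ExtremalSegment i μ h X lam ν) :
    X (ω.tend i) = ω.xend i :=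
  hx.eqOn (right_mem_Icc.2 (hadm.tstart_lt_tend i).le)

theorem transversal_start (hS : S.Valid) (hadm : ω.Admissible) (hreg : ω.RegularEntry)
    (hx : ω.ExtremalSegment i μ h X lam ν) {r : Q} (hr : S.OnManifold (ω.q i) r (ω.xstart i)) :
    S.m (ω.q i) r ⬝ᵥ S.field (ω.q i) (ω.tstart i) (X (ω.tstart i))
      (S.law (ω.q i) (ω.tstart i) (lam (ω.tstart i))) ≠ 0 := by
  obtain ⟨v, hv, hne⟩ := hadm.transversalStart hS hreg i hr
  rwa [Problem.eq_of_tendsto_of_ae_eq (hadm.tstart_lt_tend i)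
    (left_mem_Icc.2 (hadm.tstart_lt_tend i).le) nhdsWithin_Icc_inf_ae_le_right hv
    ((hx.extremal.continuousOn_control hS).mono (hadm.Icc_subset i)) hx.law,
    ← hx.apply_tstart hadm] at hne

theorem transversal_end (hS : S.Valid) (hadm : ω.Admissible)
    (hx : ω.ExtremalSegment i μ h X lam ν) {r : Q} (hr : S.OnManifold (ω.q i) r (ω.xend i)) :
    S.m (ω.q i) r ⬝ᵥ S.field (ω.q i) (ω.tend i) (X (ω.tend i))
      (S.law (ω.q i) (ω.tend i) (lam (ω.tend i))) ≠ 0 := by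
  obtain ⟨v, hv, hne⟩ := hadm.transversalAt i hr
  rwa [Problem.eq_of_tendsto_of_ae_eq (hadm.tstart_lt_tend i)
    (right_mem_Icc.2 (hadm.tstart_lt_tend i).le) nhdsWithin_Icc_inf_ae_le_left hv
    ((hx.extremal.continuousOn_control hS).mono (hadm.Icc_subset i)) hx.law,
    ← hx.apply_tend hadm] at hne

theorem segCost_eq (hadm : ω.Admissible) (hx : ω.ExtremalSegment i μ h X lam ν) :
    ω.segCost i = S.segmentCost (ω.q i) (ω.endWeight i) (S.d i (ω.q i)) (ω.tstart i) (ω.tend i)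
      (fun t => S.law (ω.q i) t (lam t)) X := by
  have hle := (hadm.tstart_lt_tend i).le
  unfold segCost Problem.segmentCost
  rw [hx.eqOn (right_mem_Icc.2 hle)]
  congr 1
  refine intervalIntegral.integral_congr_ae ?_
  filter_upwards [(ae_restrict_iff' measurableSet_Icc).1 hx.law] with t ht hmem
  rw [uIoc_of_le hle] at hmem
  have hmem' : t ∈ Icc (ω.tstart i) (ω.tend i) := Ioc_subset_Icc_self hmem
  rw [ht hmem', hx.eqOn hmem']

/-- Small perturbations of an extremal segment that preserve the contacts with switching manifolds
at both ends are the start of an admissible tail, at a cost known to first order. -/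
theorem eventually_hasTail [Finite Q] (hS : S.Valid) (hadm : ω.Admissible) (hreg : ω.RegularEntry)
    (hx : ω.ExtremalSegment i μ h X lam ν) {ε : ℝ} (hε : 0 < ε) :
    ∀ᶠ s in 𝓝[≥] (0 : ℝ), ∀ a' ∈ Icc S.t₀ S.tf, ∀ b' ∈ Icc S.t₀ S.tf,
      |a' - ω.tstart i| ≤ s → |b' - ω.tend i| ≤ s →
      ∀ w y, S.IsVariation (ω.q i) S.t₀ S.tf w y →
      (∀ t ∈ Icc a' b', ‖y t‖ ≤ s) → (∀ t ∈ Icc a' b', ‖w t‖ ≤ s) →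
      (∀ t₁ ∈ Icc a' b', ∀ t₂ ∈ Icc a' b', ‖y t₂ - y t₁‖ ≤ s * |t₂ - t₁|) →
      (∀ r, S.OnManifold (ω.q i) r (ω.xstart i) → S.OnManifold (ω.q i) r (X a' + y a')) →
      (∀ r, S.OnManifold (ω.q i) r (ω.xend i) → S.OnManifold (ω.q i) r (X b' + y b')) →
      (i = Fin.last S.N → b' = S.tf) →
      ω.HasTail i a' (X a' + y a')
        (lam (ω.tstart i) ⬝ᵥ (X a' + y a' - ω.xstart i)
          - S.minHamiltonian (ω.q i) (ω.tstart i) (ω.xstart i) (lam (ω.tstart i))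
            * (a' - ω.tstart i)
          + (S.minHamiltonian (ω.q i) (ω.tend i) (ω.xend i) (lam (ω.tend i)) - h)
            * (b' - ω.tend i) + ε * s) := by
  have ha := hadm.tstart_mem i
  have hbo := hadm.tend_mem i
  have hb := Ioc_subset_Icc_self hbo
  have hlt := hadm.tstart_lt_tend i
  have hXa := hx.apply_tstart hadm
  have hXb := hx.apply_tend hadm
  obtain ⟨Λ, hΛ, hlip⟩ := hx.extremal.exists_lipschitz hS
  obtain ⟨δ₁, hδ₁, H₁⟩ := hx.bound (ε / (2 * (Λ + 2))) (by positivity)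
  obtain ⟨δ₂, hδ₂, H₂⟩ := Problem.exists_forall_perturbed_no_contact
    hx.extremal.continuousOn_state ha hb
    (fun t ht r => by
      rw [hx.eqOn (Ioo_subset_Icc_self ht)]
      exact hadm.no_contact i t ht r)
    (fun r hr => hx.extremal.hasSlopeBoundAt hS ha
      (hx.transversal_start hS hadm hreg (hXa ▸ hr)))
    (fun r hr => hx.extremal.hasSlopeBoundAt hS hb (hx.transversal_end hS hadm (hXb ▸ hr)))
  have htrans : ∀ᶠ s in 𝓝[≥] (0 : ℝ), ∀ r, S.OnManifold (ω.q i) r (ω.xend i) →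
      ∀ b' ∈ Icc S.t₀ S.tf, |b' - ω.tend i| ≤ s → ∀ w : ℝ → Fin (S.k (ω.q i)) → ℝ,
      Continuous w → ‖w b'‖ ≤ s → ∀ η : Fin (S.n (ω.q i)) → ℝ, ‖η‖ ≤ s →
      S.TransversalAt (ω.q i) ((fun t => S.law (ω.q i) t (lam t)) + w) b' (X b' + η) r :=
    eventually_all.2 fun r => by
      by_cases hr : S.OnManifold (ω.q i) r (ω.xend i)
      · filter_upwards [hx.extremal.eventually_transversalAt hS hbo
          (hx.transversal_end hS hadm hr)] with s hs _ using hs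
      · exact Eventually.of_forall fun s h => absurd h hr
  have hcost := hx.extremal.eventually_segmentCost_le hS ha hb
    (ω.endWeight_posSemidef hS i).isHermitian (S.d i (ω.q i)) (half_pos hε)
  filter_upwards [self_mem_nhdsWithin, htrans, hcost, eventually_mul_le (C := 1) (half_pos hδ₂),
    eventually_mul_le (C := Λ + 2) (half_pos hδ₁),
    eventually_mul_le (C := 3) (sub_pos.2 hlt)]
    with s hs hT hC hs2 hs1 hs3 a' ha' b' hb' haa hbb w y hy hys hws hyl hma hmb hlast
  have hs0 : 0 ≤ s := hs
  rw [one_mul] at hs2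
  have hab' : a' < b' := by
    rcases hs0.eq_or_lt with rfl | hspos
    · have h1 := abs_nonpos_iff.1 haa
      have h2 := abs_nonpos_iff.1 hbb
      linarith
    · linarith [(abs_le.1 haa).2, (abs_le.1 hbb).1]
  have hbI : b' ∈ Icc a' b' := right_mem_Icc.2 hab'.le
  have hΔs : ‖X b' + y b' - ω.xend i‖ ≤ (Λ + 1) * s := by
    calc ‖X b' + y b' - ω.xend i‖ = ‖(X b' - X (ω.tend i)) + y b'‖ := by
          rw [hXb]; congr 1; abel
      _ ≤ ‖X b' - X (ω.tend i)‖ + ‖y b'‖ := norm_add_le _ _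
      _ ≤ Λ * |b' - ω.tend i| + s := add_le_add (hlip _ hb b' hb') (hys b' hbI)
      _ ≤ Λ * s + s := by linarith [mul_le_mul_of_nonneg_left hbb hΛ]
      _ = _ := by ring
  have hΛs := mul_nonneg hΛ hs0
  have hseg : S.SegmentOK (ω.q i) a' b' ((fun t => S.law (ω.q i) t (lam t)) + w) (X + y) := by
    refine hS.segmentOK_of_hasDerivWithinAt ha' hb' hab'
      ((hx.extremal.continuousOn_control hS).add hy.continuous.continuousOn) (fun t ht => ?_) ?_
    · have := (hx.extremal.state t ht).add (hy.deriv t ht)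
      rwa [← Problem.field_add] at this
    · exact H₂ a' b' y ha' hb' (by linarith) (by linarith) (fun t ht => by linarith [hys t ht])
        (fun t₁ h1 t₂ h2 => (hyl t₁ h1 t₂ h2).trans
          (mul_le_mul_of_nonneg_right (by linarith) (abs_nonneg _)))
        (fun r hr => hma r (hXa ▸ hr)) (fun r hr => hmb r (hXb ▸ hr))
  have hcont := H₁ b' (X b' + y b') ((fun t => S.law (ω.q i) t (lam t)) + w)
    (by nlinarith) (by nlinarith) hlast
    (fun r hr => ⟨hmb r hr, hT r hr b' hb' hbb w hy.continuous (hws b' hbI) (y b') (hys b' hbI)⟩)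
  refine (HasContinuation.hasTail (x := X + y) hseg hcont).mono ?_
  have hc := hC a' ha' b' hb' hab'.le haa hbb w y hy hys hws
  rw [hx.segCost_eq hadm]
  have horth := hx.orthogonal _ hmb
  rw [hXb, hXa, hx.lam_end, add_sub_cancel_left, add_dotProduct, horth, add_zero,
    ← hx.lam_end] at hc
  have hcε : ε / (2 * (Λ + 2)) * (|b' - ω.tend i| + ‖X b' + y b' - ω.xend i‖) ≤ ε / 2 * s := by
    calc _ ≤ ε / (2 * (Λ + 2)) * ((Λ + 2) * s) :=
          mul_le_mul_of_nonneg_left (by linarith) (by positivity)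
      _ = _ := by field_simp
  linarith

/-- Continuity of the Hamiltonian, if shifts of the end in time, to both sides, can be compensated
by multiples of a fixed variation of the control. -/
theorem minHamiltonian_tend_eq [Finite Q] (hS : S.Valid) (hopt : ω.IsOptimal)
    (hreg : ω.RegularEntry) (hx : ω.ExtremalSegment i μ h X lam ν) (hi : i ≠ Fin.last S.N)
    {w : ℝ → Fin (S.k (ω.q i)) → ℝ} {y : ℝ → Fin (S.n (ω.q i)) → ℝ}
    (hy : S.IsVariation (ω.q i) S.t₀ S.tf w y) (hya : y (ω.tstart i) = 0) {C : ℝ}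
    (hmove : ∀ᶠ τ in 𝓝 (0 : ℝ), ∃ e, |e| ≤ C * |τ| ∧ ∀ r, S.OnManifold (ω.q i) r (ω.xend i) →
      S.OnManifold (ω.q i) r (X (ω.tend i + τ) + e • y (ω.tend i + τ))) :
    S.minHamiltonian (ω.q i) (ω.tend i) (ω.xend i) (lam (ω.tend i)) = h := by
  have hadm := hopt.1
  have ha := hadm.tstart_mem i
  have hb : ω.tend i ∈ Ioo S.t₀ S.tf := ⟨(hadm.tend_mem i).1, hadm.tend_lt hi⟩
  obtain ⟨Y, hY, hyY, hyL⟩ := hy.exists_bound hS Subset.rfl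
  obtain ⟨Y', hY'⟩ := isCompact_Icc.exists_bound_of_continuousOn
    (hy.continuous.continuousOn (s := Icc S.t₀ S.tf))
  set Z := max Y |Y'| with hZ
  have hZ0 : 0 < Z := lt_max_of_lt_left hY
  -- a shift `τ` of the end and the variation that compensates it have size at most `D * |τ|`
  set D := 1 + |C| * Z with hD
  have hD0 : 0 < D := by positivity
  refine sub_eq_zero.1 (eq_zero_of_forall_eventually_nonneg fun ε hε => ?_)
  have hev := hx.eventually_hasTail hS hadm hreg (div_pos hε hD0)
  have hs : Tendsto (fun τ : ℝ => D * |τ|) (𝓝 0) (𝓝[≥] 0) := by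
    refine tendsto_nhdsWithin_iff.2 ⟨?_, Eventually.of_forall fun τ => ?_⟩
    · have : Continuous fun τ : ℝ => D * |τ| := by fun_prop
      simpa using this.tendsto 0
    · exact mul_nonneg hD0.le (abs_nonneg τ)
  have hbmem : ∀ᶠ τ in 𝓝 (0 : ℝ), ω.tend i + τ ∈ Icc S.t₀ S.tf := by
    have : Tendsto (fun τ => ω.tend i + τ) (𝓝 0) (𝓝 (ω.tend i)) := by
      have : Continuous fun τ : ℝ => ω.tend i + τ := by fun_prop
      simpa using this.tendsto 0
    exact this.eventually (Icc_mem_nhds hb.1 hb.2)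
  filter_upwards [hmove, hs.eventually hev, hbmem] with τ hτ htail hbτ
  obtain ⟨e, heC, hman⟩ := hτ
  have hτ0 := abs_nonneg τ
  have heZ : |e| * Z ≤ D * |τ| := by
    calc |e| * Z ≤ |C| * |τ| * Z := mul_le_mul_of_nonneg_right
          (heC.trans (mul_le_mul_of_nonneg_right (le_abs_self C) hτ0)) hZ0.le
      _ ≤ D * |τ| := by rw [hD]; linarith
  have hDτ : |τ| ≤ D * |τ| := by
    have : 0 ≤ |C| * Z * |τ| := by positivity
    rw [hD]; linarith
  have hsub : Icc (ω.tstart i) (ω.tend i + τ) ⊆ Icc S.t₀ S.tf := Icc_subset_Icc ha.1 hbτ.2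
  have h1 := htail (ω.tstart i) ha (ω.tend i + τ) hbτ (by rw [sub_self, abs_zero]; positivity)
    (by rwa [add_sub_cancel_left]) (e • w) (e • y) (hy.const_smul e)
    (fun t ht => by
      rw [Pi.smul_apply, norm_smul, Real.norm_eq_abs]
      exact (mul_le_mul_of_nonneg_left ((hyY t (hsub ht)).trans (le_max_left _ _))
        (abs_nonneg e)).trans heZ)
    (fun t ht => by
      rw [Pi.smul_apply, norm_smul, Real.norm_eq_abs]
      exact (mul_le_mul_of_nonneg_left (((hY' t (hsub ht)).trans (le_abs_self _)).trans
        (le_max_right _ _)) (abs_nonneg e)).trans heZ)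
    (fun t₁ ht₁ t₂ ht₂ => by
      rw [Pi.smul_apply, Pi.smul_apply, ← smul_sub, norm_smul, Real.norm_eq_abs]
      calc |e| * ‖y t₂ - y t₁‖ ≤ |e| * (Z * |t₂ - t₁|) := mul_le_mul_of_nonneg_left
            ((hyL t₁ (hsub ht₁) t₂ (hsub ht₂)).trans
              (mul_le_mul_of_nonneg_right (le_max_left _ _) (abs_nonneg _))) (abs_nonneg e)
        _ = |e| * Z * |t₂ - t₁| := by ring
        _ ≤ _ := mul_le_mul_of_nonneg_right heZ (abs_nonneg _))
    (fun r hr => by simpa [hya, hx.apply_tstart hadm] using hr) hman (fun h => absurd h hi)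
  have h2 : X (ω.tstart i) + (e • y) (ω.tstart i) = ω.xstart i := by
    simp [hya, hx.apply_tstart hadm]
  rw [h2] at h1
  have h3 := h1.nonneg hopt
  rw [sub_self, dotProduct_zero, sub_self, mul_zero, sub_zero, zero_add, add_sub_cancel_left,
    ← mul_assoc, div_mul_cancel₀ _ hD0.ne'] at h3
  linarith

end ExtremalSegment

end Execution

/-! ### Perturbation of the start of a segment -/

theorem exists_pos_of_eventually_nhdsGE {P : ℝ → Prop} (h : ∀ᶠ s in 𝓝[≥] (0 : ℝ), P s) :
    ∃ δ > 0, ∀ s, 0 ≤ s → s < δ → P s := by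
  obtain ⟨δ, hδ, H⟩ := Metric.eventually_nhds_iff.1 (eventually_nhdsWithin_iff.1 h)
  exact ⟨δ, hδ, fun s hs hsδ => H (by rwa [Real.dist_eq, sub_zero, abs_of_nonneg hs]) hs⟩

namespace Execution

variable {Q E : Type*} {S : Problem Q E} {ω : Execution S}

namespace ExtremalSegment

variable {i : Fin (S.N + 1)} {μ ν : Fin (S.n (ω.q i)) → ℝ} {h : ℝ}
  {X lam : ℝ → Fin (S.n (ω.q i)) → ℝ}

theorem minHamiltonian_tend_eq_of_no_contact [Finite Q] (hS : S.Valid) (hopt : ω.IsOptimal)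
    (hreg : ω.RegularEntry) (hx : ω.ExtremalSegment i μ h X lam ν) (hi : i ≠ Fin.last S.N)
    (hno : ∀ r, ¬ S.OnManifold (ω.q i) r (ω.xend i)) :
    S.minHamiltonian (ω.q i) (ω.tend i) (ω.xend i) (lam (ω.tend i)) = h :=
  hx.minHamiltonian_tend_eq hS hopt hreg hi (w := 0) (y := 0) (C := 0)
    .zero rfl
    (Eventually.of_forall fun _ => ⟨0, by simp, fun r hr => absurd hr (hno r)⟩)

/-- If a variation of the control moves the end off the switching manifold, then a suitable multiple
of it compensates a shift of the end in time. -/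
theorem minHamiltonian_tend_eq_of_variation [Finite Q] (hS : S.Valid) (hopt : ω.IsOptimal)
    (hreg : ω.RegularEntry) (hx : ω.ExtremalSegment i μ h X lam ν) (hi : i ≠ Fin.last S.N)
    {r : Q} (hr : S.OnManifold (ω.q i) r (ω.xend i))
    {w : ℝ → Fin (S.k (ω.q i)) → ℝ} {y : ℝ → Fin (S.n (ω.q i)) → ℝ}
    (hy : S.IsVariation (ω.q i) (ω.tstart i) (ω.tend i) w y) (hya : y (ω.tstart i) = 0)
    (hyb : S.m (ω.q i) r ⬝ᵥ y (ω.tend i) ≠ 0) :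
    S.minHamiltonian (ω.q i) (ω.tend i) (ω.xend i) (lam (ω.tend i)) = h := by
  have hadm := hopt.1
  have hlt := hadm.tstart_lt_tend i
  have hI := hadm.Icc_subset i
  have hbo := hadm.tend_mem i
  have hb := Ioc_subset_Icc_self hbo
  have hbn : Icc S.t₀ S.tf ∈ 𝓝 (ω.tend i) := Icc_mem_nhds hbo.1 (hadm.tend_lt hi)
  obtain ⟨Y, hYb, hY⟩ := Problem.IsVariation.exists_solution hS Subset.rfl hb hy.continuous
    (y (ω.tend i))
  have hYy : EqOn Y y (Icc (ω.tstart i) (ω.tend i)) :=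
    eqOn_of_linear_of_eq_right ((continuousOn_mulVecCLM (hS.continuousOn_A (ω.q i))).mono hI)
      (g := fun t => S.B (ω.q i) t *ᵥ w t)
      (fun t ht => (hY.deriv t (hI ht)).mono hI) (fun t ht => hy.deriv t ht) hYb
  have hYa : Y (ω.tstart i) = 0 := (hYy (left_mem_Icc.2 hlt.le)).trans hya
  obtain ⟨Λ, hΛ, hlip⟩ := hx.extremal.exists_lipschitz hS
  set m := S.m (ω.q i) r with hm
  set M := ∑ k, |m k|
  have hM : 0 ≤ M := Finset.sum_nonneg fun _ _ => abs_nonneg _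
  set κ := |m ⬝ᵥ y (ω.tend i)| with hκ
  have hκ0 : 0 < κ := abs_pos.2 hyb
  have hYc : ContinuousAt (fun t => |m ⬝ᵥ Y t|) (ω.tend i) := by
    have h1 : ContinuousAt Y (ω.tend i) := (hY.continuousOn _ hb).continuousAt hbn
    have h2 : Continuous fun v : Fin (S.n (ω.q i)) → ℝ => |m ⬝ᵥ v| := by fun_prop
    exact h2.continuousAt.comp h1
  have hshift : Tendsto (fun τ => ω.tend i + τ) (𝓝 0) (𝓝 (ω.tend i)) := by
    have : Continuous fun τ : ℝ => ω.tend i + τ := by fun_prop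
    simpa using this.tendsto 0
  have hlow : ∀ᶠ t in 𝓝 (ω.tend i), κ / 2 < |m ⬝ᵥ Y t| :=
    continuousAt_const.eventually_lt hYc (by rw [hYb, ← hκ]; linarith)
  refine hx.minHamiltonian_tend_eq hS hopt hreg hi hY hYa (C := M * Λ * (2 / κ)) ?_
  filter_upwards [hshift.eventually hlow, hshift.eventually hbn] with τ hτ hbτ
  have hne : m ⬝ᵥ Y (ω.tend i + τ) ≠ 0 := abs_pos.1 (by linarith)
  have hg : |m ⬝ᵥ X (ω.tend i + τ) + S.c (ω.q i) r| ≤ M * Λ * |τ| := by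
    have h1 : m ⬝ᵥ X (ω.tend i + τ) + S.c (ω.q i) r =
        m ⬝ᵥ (X (ω.tend i + τ) - X (ω.tend i)) := by
      have h2 : m ⬝ᵥ ω.xend i + S.c (ω.q i) r = 0 := hr
      rw [dotProduct_sub, hx.apply_tend hadm]
      linarith
    rw [h1, mul_assoc]
    refine (abs_dotProduct_le _ _).trans (mul_le_mul_of_nonneg_left ?_ hM)
    simpa using hlip _ hb _ hbτ
  refine ⟨-(m ⬝ᵥ X (ω.tend i + τ) + S.c (ω.q i) r) / (m ⬝ᵥ Y (ω.tend i + τ)), ?_, ?_⟩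
  · rw [abs_div, abs_neg, div_le_iff₀ (abs_pos.2 hne)]
    calc _ ≤ M * Λ * |τ| := hg
      _ = M * Λ * (2 / κ) * |τ| * (κ / 2) := by field_simp
      _ ≤ _ := mul_le_mul_of_nonneg_left hτ.le (by positivity)
  · intro r' hr'
    obtain rfl : r' = r := by
      by_contra hne'
      exact hS.manifold_disjoint _ _ _ hne' _ ⟨hr', hr⟩
    unfold Problem.OnManifold
    rw [dotProduct_add, dotProduct_smul, smul_eq_mul, ← hm, div_mul_cancel₀ _ hne]
    ring

/-- After a perturbation of an extremal segment, its end can be moved in time such that it returns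
to the switching manifold. -/
theorem exists_tend_perturbed (hS : S.Valid) (hadm : ω.Admissible)
    (hx : ω.ExtremalSegment i μ h X lam ν) :
    ∃ C, 0 ≤ C ∧ ∀ᶠ s in 𝓝[≥] (0 : ℝ), ∀ y : ℝ → Fin (S.n (ω.q i)) → ℝ,
      ContinuousOn y (Icc S.t₀ S.tf) →
      (∀ t ∈ Icc S.t₀ S.tf, |t - ω.tend i| ≤ C * s → ‖y t‖ ≤ s) →
      ∃ b' ∈ Icc S.t₀ S.tf, |b' - ω.tend i| ≤ C * s ∧ (i = Fin.last S.N → b' = ω.tend i) ∧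
        ∀ r, S.OnManifold (ω.q i) r (ω.xend i) → S.OnManifold (ω.q i) r (X b' + y b') := by
  have hbo := hadm.tend_mem i
  have hb := Ioc_subset_Icc_self hbo
  by_cases hcontact : ∃ r, S.OnManifold (ω.q i) r (ω.xend i)
  · obtain ⟨r, hr⟩ := hcontact
    have hi : i ≠ Fin.last S.N := by
      rintro rfl
      exact hadm.no_contact_final r hr
    have hg0 : S.m (ω.q i) r ⬝ᵥ X (ω.tend i) + S.c (ω.q i) r = 0 := by
      rw [hx.apply_tend hadm]; exact hr
    have hgc : ContinuousOn (fun t => S.m (ω.q i) r ⬝ᵥ X t + S.c (ω.q i) r) (Icc S.t₀ S.tf) := by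
      have := hx.extremal.continuousOn_state
      fun_prop
    obtain ⟨C₀, hC₀, δ, hδ, H⟩ := exists_perturbed_zero hgc ⟨hbo.1, hadm.tend_lt hi⟩ hg0
      (hx.extremal.hasDerivWithinAt_manifold hb r) (hx.transversal_end hS hadm hr)
    set M := ∑ k, |S.m (ω.q i) r k|
    have hM : 0 ≤ M := Finset.sum_nonneg fun _ _ => abs_nonneg _
    refine ⟨C₀ * (M + 1), by positivity, ?_⟩
    filter_upwards [self_mem_nhdsWithin, eventually_mul_le (C := M + 1) (half_pos hδ)]
      with s hs hsδ y hy hys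
    have hs0 : 0 ≤ s := hs
    have hyc : ContinuousOn (fun t => S.m (ω.q i) r ⬝ᵥ y t) (Icc S.t₀ S.tf) := by fun_prop
    obtain ⟨b', hb', hbb, hzero⟩ := H ((M + 1) * s) (by positivity) (by linarith) _ hyc
      (fun t ht hts => (abs_dotProduct_le _ _).trans (mul_le_mul (by linarith)
        (hys t ht (by rwa [mul_assoc])) (norm_nonneg _) (by linarith)))
    refine ⟨b', hb', by rwa [mul_assoc], fun h => absurd h hi, fun r' hr' => ?_⟩
    obtain rfl : r' = r := by
      by_contra hne'
      exact hS.manifold_disjoint _ _ _ hne' _ ⟨hr', hr⟩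
    unfold Problem.OnManifold
    rw [dotProduct_add, add_right_comm, hzero]
  · push Not at hcontact
    exact ⟨0, le_rfl, Eventually.of_forall fun s y _ _ =>
      ⟨ω.tend i, hb, by simp, fun _ => rfl, fun r hr => absurd hr (hcontact r)⟩⟩

/-- The adjoint and the Hamiltonian at the start of an extremal segment are the first order bound
for the tails that start with this segment. -/
theorem entryBound [Finite Q] (hS : S.Valid) (hadm : ω.Admissible) (hreg : ω.RegularEntry)
    (hx : ω.ExtremalSegment i μ h X lam ν) (hi : i ≠ 0)
    (hh : i ≠ Fin.last S.N →
      S.minHamiltonian (ω.q i) (ω.tend i) (ω.xend i) (lam (ω.tend i)) = h) :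
    ω.EntryBound i (lam (ω.tstart i))
      (S.minHamiltonian (ω.q i) (ω.tstart i) (ω.xstart i) (lam (ω.tstart i))) := by
  intro ε hε
  have ha := hadm.tstart_mem i
  have hlt := hadm.tstart_lt_tend i
  have hb := Ioc_subset_Icc_self (hadm.tend_mem i)
  have han : Icc S.t₀ S.tf ∈ 𝓝 (ω.tstart i) :=
    Icc_mem_nhds (hadm.lt_tstart hi) (hlt.trans_le hb.2)
  obtain ⟨δ₀, hδ₀, H₀⟩ := Metric.mem_nhds_iff.1 han
  obtain ⟨Λ, hΛ, hlip⟩ := hx.extremal.exists_lipschitz hS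
  obtain ⟨C, hC, HC⟩ := hS.exists_variation_zero (ω.q i)
  obtain ⟨C', hC', HC'⟩ := hx.exists_tend_perturbed hS hadm
  -- a shift of the start of size `ρ` perturbs the state by at most `D * ρ`, and then moves the end
  -- by at most `C' * (D * ρ)`; `K * ρ` bounds all of them
  set D := C * (1 + Λ) with hD
  have hD0 : 0 < D := by positivity
  set K := 1 + D * (1 + C') with hK
  have hK0 : 0 < K := by positivity
  obtain ⟨δ₁, hδ₁, H₁⟩ := exists_pos_of_eventually_nhdsGE HC'
  obtain ⟨δ₂, hδ₂, H₂⟩ := exists_pos_of_eventually_nhdsGE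
    (hx.eventually_hasTail hS hadm hreg (div_pos hε hK0))
  obtain ⟨δ, hδ, Hδ⟩ := exists_pos_of_eventually_nhdsGE
    ((eventually_mul_le (C := D) (half_pos hδ₁)).and
      ((eventually_mul_le (C := K) (half_pos hδ₂)).and
        ((eventually_mul_le (C := K) (half_pos (sub_pos.2 hlt))).and
          (eventually_mul_le (C := 1) (half_pos hδ₀)))))
  refine ⟨δ / 2, half_pos hδ, fun a' ξ haδ hξδ hman => ?_⟩
  set ρ := |a' - ω.tstart i| + ‖ξ - ω.xstart i‖ with hρ
  have hρ0 : 0 ≤ ρ := by positivity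
  have hξ0 := norm_nonneg (ξ - ω.xstart i)
  have haρ : |a' - ω.tstart i| ≤ ρ := by linarith
  obtain ⟨h1, h2, h3, h4⟩ := Hδ ρ hρ0 (by linarith)
  rw [one_mul] at h4
  have ha' : a' ∈ Icc S.t₀ S.tf := H₀ (by rw [Metric.mem_ball, Real.dist_eq]; linarith)
  have hDρ : 0 ≤ D * ρ := by positivity
  have hKρ : K * ρ = ρ + D * ρ + C' * (D * ρ) := by rw [hK]; ring
  have hCDρ : 0 ≤ C' * (D * ρ) := by positivity
  obtain ⟨y, hy, hya, hys, hyl⟩ := HC a' ha' (ξ - X a')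
  have hη : C * ‖ξ - X a'‖ ≤ D * ρ := by
    have e1 : ‖ξ - X a'‖ ≤ ‖ξ - ω.xstart i‖ + Λ * |a' - ω.tstart i| := by
      calc ‖ξ - X a'‖ = ‖(ξ - ω.xstart i) - (X a' - X (ω.tstart i))‖ := by
            rw [hx.apply_tstart hadm]; congr 1; abel
        _ ≤ _ := (norm_sub_le _ _).trans (by linarith [hlip _ ha _ ha'])
    rw [hD, mul_assoc]
    refine mul_le_mul_of_nonneg_left (e1.trans ?_) hC.le
    rw [hρ]
    nlinarith [abs_nonneg (a' - ω.tstart i), mul_nonneg hΛ hξ0]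
  have hleft : a' ≤ ω.tend i - C' * (D * ρ) := by
    linarith [(abs_le.1 haρ).2]
  obtain ⟨b', hb', hbb, hlast, hmanb⟩ := H₁ (D * ρ) hDρ (by linarith) y hy.continuousOn
    (fun t ht hts => (hys t ⟨by linarith [(abs_le.1 hts).1], ht.2⟩).trans hη)
  have hsub : Icc a' b' ⊆ Icc a' S.tf := Icc_subset_Icc_right hb'.2
  have hξ : X a' + y a' = ξ := by rw [hya]; abel
  have htail := H₂ (K * ρ) (by positivity) (by linarith) a' ha' b' hb' (by linarith) (by linarith)
    0 y hy (fun t ht => by linarith [hys t (hsub ht)])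
    (fun t _ => by rw [Pi.zero_apply, norm_zero]; positivity)
    (fun t₁ ht₁ t₂ ht₂ => (hyl t₁ (hsub ht₁) t₂ (hsub ht₂)).trans
      (mul_le_mul_of_nonneg_right (by linarith) (abs_nonneg _)))
    (fun r hr => by rw [hξ]; exact hman r hr) hmanb
    (fun hi' => by rw [hlast hi', hi']; exact hadm.finish)
  rw [hξ] at htail
  refine htail.mono ?_
  have hz : (S.minHamiltonian (ω.q i) (ω.tend i) (ω.xend i) (lam (ω.tend i)) - h)
      * (b' - ω.tend i) = 0 := by
    by_cases hi' : i = Fin.last S.N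
    · rw [hlast hi', sub_self, mul_zero]
    · rw [hh hi', sub_self, zero_mul]
  rw [hz, add_zero, ← mul_assoc, div_mul_cancel₀ _ hK0.ne']

end ExtremalSegment

/-- A segment of an optimal execution, when the cost after it is known to first order, is an
extremal with the transversality conditions at its end, and the cost of the tails from its start is
again known to first order. -/
theorem IsOptimal.exists_extremalSegment [Finite Q] (hS : S.Valid) (hopt : ω.IsOptimal)
    (hreg : ω.RegularEntry) {i : Fin (S.N + 1)} {μ : Fin (S.n (ω.q i)) → ℝ} {h : ℝ}
    (hc : ω.ContinuationBound i μ h) {m : Fin (S.n (ω.q i)) → ℝ}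
    (hm : ∀ r, S.OnManifold (ω.q i) r (ω.xend i) → S.m (ω.q i) r = m)
    (hm0 : (∀ r, ¬ S.OnManifold (ω.q i) r (ω.xend i)) → m = 0) :
    ∃ (p : ℝ) (X lam : ℝ → Fin (S.n (ω.q i)) → ℝ),
      ω.ExtremalSegment i μ h X lam (p • m) ∧
      (i ≠ Fin.last S.N →
        S.minHamiltonian (ω.q i) (ω.tend i) (ω.xend i) (lam (ω.tend i)) = h) ∧
      (i ≠ 0 → ω.EntryBound i (lam (ω.tstart i))
        (S.minHamiltonian (ω.q i) (ω.tstart i) (ω.xstart i) (lam (ω.tstart i)))) := by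
  obtain ⟨p, X, lam, hext, hX, hlaw, hlb, hcase⟩ := hopt.exists_isExtremalOn hS hreg hc hm
  have horth : ∀ ζ, (∀ r, S.OnManifold (ω.q i) r (ω.xend i) → S.OnManifold (ω.q i) r ζ) →
      (p • m) ⬝ᵥ (ζ - ω.xend i) = 0 := by
    intro ζ hζ
    by_cases hcontact : ∃ r, S.OnManifold (ω.q i) r (ω.xend i)
    · obtain ⟨r, hr⟩ := hcontact
      have h1 : S.m (ω.q i) r ⬝ᵥ ω.xend i + S.c (ω.q i) r = 0 := hr
      have h2 : S.m (ω.q i) r ⬝ᵥ ζ + S.c (ω.q i) r = 0 := hζ r hr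
      rw [smul_dotProduct, ← hm r hr, dotProduct_sub, smul_eq_mul]
      rw [show S.m (ω.q i) r ⬝ᵥ ζ - S.m (ω.q i) r ⬝ᵥ ω.xend i = 0 by linarith, mul_zero]
    · push Not at hcontact
      rw [hm0 hcontact, smul_zero, zero_dotProduct]
  have hx : ω.ExtremalSegment i μ h X lam (p • m) := ⟨hc, hext, hX, hlaw, hlb, horth⟩
  have hh : i ≠ Fin.last S.N →
      S.minHamiltonian (ω.q i) (ω.tend i) (ω.xend i) (lam (ω.tend i)) = h := by
    intro hi
    rcases hcase with hH | hno | ⟨w, y, hy, hya, hyb⟩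
    · exact hH
    · exact hx.minHamiltonian_tend_eq_of_no_contact hS hopt hreg hi hno
    · by_cases hcontact : ∃ r, S.OnManifold (ω.q i) r (ω.xend i)
      · obtain ⟨r, hr⟩ := hcontact
        rw [← hm r hr] at hyb
        exact hx.minHamiltonian_tend_eq_of_variation hS hopt hreg hi hr hy hya hyb
      · push Not at hcontact
        exact hx.minHamiltonian_tend_eq_of_no_contact hS hopt hreg hi hcontact
  exact ⟨p, X, lam, hx, hh, fun hi => hx.entryBound hS hopt.1 hreg hi hh⟩

end Execution

/-! ### The feedback law -/

namespace Problem

variable {Q E : Type*} {S : Problem Q E} {q : Q}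

/-- Along an extremal the adjoint is `K x + s`, where `K` solves the Riccati equation and `s` a
linear differential equation driven by `K`. -/
theorem IsExtremalOn.exists_riccati (hS : S.Valid) {X lam : ℝ → Fin (S.n q) → ℝ} {a b : ℝ}
    (hab : a < b) (hI : Icc a b ⊆ Icc S.t₀ S.tf) (h : S.IsExtremalOn q (Icc S.t₀ S.tf) X lam)
    {Γ : Matrix (Fin (S.n q)) (Fin (S.n q)) ℝ} (hΓ : ∀ v, 0 ≤ v ⬝ᵥ (Γ *ᵥ v)) :
    ∃ (K : ℝ → Matrix (Fin (S.n q)) (Fin (S.n q)) ℝ) (s : ℝ → Fin (S.n q) → ℝ),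
      K b = Γ ∧ (∀ v, 0 ≤ v ⬝ᵥ (K a *ᵥ v)) ∧ (∀ t, lam t = K t *ᵥ X t + s t) ∧
      (∀ t ∈ Icc a b, ∀ i j, HasDerivWithinAt (fun τ => K τ i j)
        ((- S.L q t - K t * S.A q t - (S.A q t)ᵀ * K t
          + K t * S.B q t * (S.R q t)⁻¹ * (S.B q t)ᵀ * K t) i j) (Icc a b) t) ∧
      ∀ t ∈ Icc a b, HasDerivWithinAt s
        (- (((S.A q t)ᵀ - K t * S.B q t * (S.R q t)⁻¹ * (S.B q t)ᵀ) *ᵥ s t)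
          - K t *ᵥ S.F q t + S.L q t *ᵥ S.r q t) (Icc a b) t := by
  obtain ⟨K, hKb, hKa, hK⟩ := HybridLQ.exists_riccati hab ((hS.continuousOn_A q).mono hI)
    ((hS.continuousOn_gain q).mono hI) ((hS.continuousOn_L q).mono hI)
    (fun t ht => hS.posSemidef_gain (hI ht)) (fun t ht => hS.posSemidef_L q t (hI ht)) hΓ
  refine ⟨K, fun t => lam t - K t *ᵥ X t, hKb, hKa, fun t => (add_sub_cancel _ _).symm,
    fun t ht i j => ?_, fun t ht => ?_⟩
  · have := hK t ht i j
    simpa only [Matrix.mul_assoc] using this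
  · have h1 := ((h.adjoint t (hI ht)).mono hI).sub
      (hasDerivWithinAt_mulVec (hK t ht) ((h.state t (hI ht)).mono hI))
    refine h1.congr_deriv ?_
    rw [field_law]
    simp only [Matrix.mul_assoc, mulVec_sub, mulVec_add, sub_mulVec, add_mulVec, neg_mulVec,
      ← mulVec_mulVec]
    abel

end Problem

namespace Execution

variable {Q E : Type*} {S : Problem Q E} {ω : Execution S}

variable (ω) in
/-- The pair `(K, s)` has the properties that are required on the `i`-th segment, and those that
carry the induction to the preceding segment. -/
structure FeedbackOn (i : Fin (S.N + 1)) (K : ℝ → Matrix (Fin (S.n (ω.q i))) (Fin (S.n (ω.q i))) ℝ)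
    (s : ℝ → Fin (S.n (ω.q i)) → ℝ) : Prop where
  control : ∀ᵐ t ∂(volume.restrict (Ico (ω.tstart i) (ω.tend i))),
    ω.u i t = - (((S.R (ω.q i) t)⁻¹ * (S.B (ω.q i) t)ᵀ * K t) *ᵥ ω.x i t)
      - ((S.R (ω.q i) t)⁻¹ * (S.B (ω.q i) t)ᵀ) *ᵥ s t
  riccati : ∀ t ∈ Icc (ω.tstart i) (ω.tend i), ∀ a b, HasDerivWithinAt (fun τ => K τ a b)
    ((- S.L (ω.q i) t - K t * S.A (ω.q i) t - (S.A (ω.q i) t)ᵀ * K t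
      + K t * S.B (ω.q i) t * (S.R (ω.q i) t)⁻¹ * (S.B (ω.q i) t)ᵀ * K t) a b)
    (Icc (ω.tstart i) (ω.tend i)) t
  offset : ∀ t ∈ Icc (ω.tstart i) (ω.tend i), HasDerivWithinAt s
    (- (((S.A (ω.q i) t)ᵀ - K t * S.B (ω.q i) t * (S.R (ω.q i) t)⁻¹ * (S.B (ω.q i) t)ᵀ) *ᵥ s t)
      - K t *ᵥ S.F (ω.q i) t + S.L (ω.q i) t *ᵥ S.r (ω.q i) t)
    (Icc (ω.tstart i) (ω.tend i)) t
  nonneg : ∀ v, 0 ≤ v ⬝ᵥ (K (ω.tstart i) *ᵥ v)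
  entry : i ≠ 0 → ω.EntryBound i (K (ω.tstart i) *ᵥ ω.xstart i + s (ω.tstart i))
    (S.minHamiltonian (ω.q i) (ω.tstart i) (ω.xstart i)
      (K (ω.tstart i) *ᵥ ω.xstart i + s (ω.tstart i)))

/-- A feedback pair on a segment, with prescribed end value of `K`. -/
theorem IsOptimal.exists_feedbackOn [Finite Q] (hS : S.Valid) (hopt : ω.IsOptimal)
    (hreg : ω.RegularEntry) {i : Fin (S.N + 1)} {μ : Fin (S.n (ω.q i)) → ℝ} {h : ℝ}
    (hc : ω.ContinuationBound i μ h) {m : Fin (S.n (ω.q i)) → ℝ}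
    (hm : ∀ r, S.OnManifold (ω.q i) r (ω.xend i) → S.m (ω.q i) r = m)
    (hm0 : (∀ r, ¬ S.OnManifold (ω.q i) r (ω.xend i)) → m = 0)
    {Γ : Matrix (Fin (S.n (ω.q i))) (Fin (S.n (ω.q i))) ℝ} (hΓ : ∀ v, 0 ≤ v ⬝ᵥ (Γ *ᵥ v)) :
    ∃ (p : ℝ) (K : ℝ → Matrix (Fin (S.n (ω.q i))) (Fin (S.n (ω.q i))) ℝ)
      (s : ℝ → Fin (S.n (ω.q i)) → ℝ),
      ω.FeedbackOn i K s ∧ K (ω.tend i) = Γ ∧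
      s (ω.tend i) = ω.endWeight i *ᵥ (ω.xend i - S.d i (ω.q i)) + (μ + p • m) - Γ *ᵥ ω.xend i ∧
      (i ≠ Fin.last S.N → S.minHamiltonian (ω.q i) (ω.tend i) (ω.xend i)
        (K (ω.tend i) *ᵥ ω.xend i + s (ω.tend i)) = h) := by
  have hadm := hopt.1
  have hlt := hadm.tstart_lt_tend i
  obtain ⟨p, X, lam, hx, hh, hentry⟩ := hopt.exists_extremalSegment hS hreg hc hm hm0
  obtain ⟨K, s, hKb, hKa, hlam, hK, hs⟩ :=
    hx.extremal.exists_riccati hS hlt (hadm.Icc_subset i) hΓ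
  have hla : lam (ω.tstart i) = K (ω.tstart i) *ᵥ ω.xstart i + s (ω.tstart i) := by
    rw [hlam, hx.apply_tstart hadm]
  have hlb : lam (ω.tend i) = K (ω.tend i) *ᵥ ω.xend i + s (ω.tend i) := by
    rw [hlam, hx.apply_tend hadm]
  refine ⟨p, K, s, ⟨?_, hK, hs, hKa, fun hi => ?_⟩, hKb, ?_, fun hi => ?_⟩
  · rw [Measure.restrict_congr_set Ico_ae_eq_Icc]
    filter_upwards [hx.law, ae_restrict_mem measurableSet_Icc] with t ht hmem
    rw [ht, Problem.law, hlam, hx.eqOn hmem, mulVec_add, mulVec_mulVec, neg_add, sub_eq_add_neg]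
  · rw [← hla]; exact hentry hi
  · rw [← hx.lam_end, hlb, hKb, add_sub_cancel_left]
  · rw [← hlb]; exact hh hi

theorem IsOptimal.exists_feedbackOn_last [Finite Q] (hS : S.Valid) (hopt : ω.IsOptimal)
    (hreg : ω.RegularEntry) :
    ∃ (K : ℝ → Matrix (Fin (S.n (ω.q (Fin.last S.N)))) (Fin (S.n (ω.q (Fin.last S.N)))) ℝ)
      (s : ℝ → Fin (S.n (ω.q (Fin.last S.N))) → ℝ),
      ω.FeedbackOn (Fin.last S.N) K s ∧ K S.tf = S.G (ω.q (Fin.last S.N)) ∧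
      s S.tf = - (S.G (ω.q (Fin.last S.N)) *ᵥ S.d (Fin.last S.N) (ω.q (Fin.last S.N))) := by
  have hadm := hopt.1
  have htf : ω.tend (Fin.last S.N) = S.tf := hadm.finish
  obtain ⟨p, K, s, hF, hK, hs, -⟩ := hopt.exists_feedbackOn hS hreg hadm.continuationBound_last
    (m := 0) (fun r hr => absurd hr (hadm.no_contact_final r)) (fun _ => rfl)
    (dotProduct_mulVec_self_nonneg (hS.posSemidef_G (ω.q (Fin.last S.N))))
  refine ⟨K, s, hF, htf ▸ hK, ?_⟩
  rw [← htf, hs, endWeight_last, mulVec_sub, smul_zero, add_zero, add_zero]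
  abel

/-- From the feedback pair after a switching to the one before it. -/
theorem IsOptimal.exists_feedbackOn_castSucc [Finite Q] (hS : S.Valid) (hopt : ω.IsOptimal)
    (hreg : ω.RegularEntry) (j : Fin S.N)
    {K' : ℝ → Matrix (Fin (S.n (ω.q j.succ))) (Fin (S.n (ω.q j.succ))) ℝ}
    {s' : ℝ → Fin (S.n (ω.q j.succ)) → ℝ} (hF' : ω.FeedbackOn j.succ K' s') :
    ∃ (p : ℝ) (K : ℝ → Matrix (Fin (S.n (ω.q j.castSucc))) (Fin (S.n (ω.q j.castSucc))) ℝ)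
      (s : ℝ → Fin (S.n (ω.q j.castSucc)) → ℝ),
      ω.FeedbackOn j.castSucc K s ∧
      K (ω.tend j.castSucc) =
        (S.P (ω.q j.castSucc) (ω.q j.succ) (ω.σ j))ᵀ * K' (ω.tstart j.succ)
            * S.P (ω.q j.castSucc) (ω.q j.succ) (ω.σ j)
          + S.C (ω.q j.castSucc) (ω.σ j) ∧
      s (ω.tend j.castSucc) =
        (S.P (ω.q j.castSucc) (ω.q j.succ) (ω.σ j))ᵀ *ᵥ s' (ω.tstart j.succ)
          + p • S.m (ω.q j.castSucc) (ω.q j.succ)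
          - S.C (ω.q j.castSucc) (ω.σ j) *ᵥ S.d j.castSucc (ω.q j.castSucc)
          + ((S.P (ω.q j.castSucc) (ω.q j.succ) (ω.σ j))ᵀ * K' (ω.tstart j.succ)) *ᵥ
              S.J (ω.q j.castSucc) (ω.q j.succ) (ω.σ j) ∧
      (¬ ω.Autonomous j → p = 0) ∧
      S.minHamiltonian (ω.q j.castSucc) (ω.tend j.castSucc) (ω.xend j.castSucc)
          (K (ω.tend j.castSucc) *ᵥ ω.xend j.castSucc + s (ω.tend j.castSucc)) =
        S.minHamiltonian (ω.q j.succ) (ω.tstart j.succ)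
          (S.jump (ω.q j.castSucc) (ω.q j.succ) (ω.σ j) (ω.xend j.castSucc))
          (K' (ω.tstart j.succ) *ᵥ
              S.jump (ω.q j.castSucc) (ω.q j.succ) (ω.σ j) (ω.xend j.castSucc)
            + s' (ω.tstart j.succ)) := by
  have hadm := hopt.1
  set P := S.P (ω.q j.castSucc) (ω.q j.succ) (ω.σ j) with hP
  set C := S.C (ω.q j.castSucc) (ω.σ j) with hC
  have hΓ : ∀ v, 0 ≤ v ⬝ᵥ ((Pᵀ * K' (ω.tstart j.succ) * P + C) *ᵥ v) := by
    intro v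
    rw [add_mulVec, dotProduct_add, ← mulVec_mulVec, ← mulVec_mulVec, dotProduct_comm,
      dotProduct_mulVec_transpose, dotProduct_comm]
    exact add_nonneg (hF'.nonneg _) (dotProduct_mulVec_self_nonneg (hS.posSemidef_C _ _) v)
  have hbound := (hF'.entry (Fin.succ_ne_zero j)).continuationBound hadm hreg
  have hcast : j.castSucc ≠ Fin.last S.N := Fin.castSucc_ne_last j
  -- the multiplier acts along the normal of the manifold only if the switching is autonomous
  have main : ∀ m : Fin (S.n (ω.q j.castSucc)) → ℝ,
      (∀ r, S.OnManifold (ω.q j.castSucc) r (ω.xend j.castSucc) → S.m (ω.q j.castSucc) r = m) →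
      ((∀ r, ¬ S.OnManifold (ω.q j.castSucc) r (ω.xend j.castSucc)) → m = 0) → _ := fun m h1 h2 =>
    hopt.exists_feedbackOn hS hreg hbound h1 h2 hΓ
  have hs : ∀ η : Fin (S.n (ω.q j.castSucc)) → ℝ,
      C *ᵥ (ω.xend j.castSucc - S.d j.castSucc (ω.q j.castSucc))
        + (Pᵀ *ᵥ (K' (ω.tstart j.succ) *ᵥ ω.xstart j.succ + s' (ω.tstart j.succ)) + η)
        - (Pᵀ * K' (ω.tstart j.succ) * P + C) *ᵥ ω.xend j.castSucc =
      Pᵀ *ᵥ s' (ω.tstart j.succ) + η - C *ᵥ S.d j.castSucc (ω.q j.castSucc)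
        + (Pᵀ * K' (ω.tstart j.succ)) *ᵥ S.J (ω.q j.castSucc) (ω.q j.succ) (ω.σ j) := by
    intro η
    rw [hadm.jump j, Problem.jump, ← hP]
    simp only [mulVec_sub, mulVec_add, add_mulVec, ← mulVec_mulVec]
    abel
  rw [← hadm.jump j]
  by_cases haut : ω.Autonomous j
  · obtain ⟨p, K, s, hF, hK, hsb, hH⟩ := main (S.m (ω.q j.castSucc) (ω.q j.succ))
      (fun r hr => by rw [(hadm.contact j r hr).1]) (fun h => absurd haut (h _))
    refine ⟨p, K, s, hF, hK, ?_, fun h => absurd haut h, hH hcast⟩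
    rw [hsb, endWeight_castSucc, hs]
  · have hno : ∀ r, ¬ S.OnManifold (ω.q j.castSucc) r (ω.xend j.castSucc) := fun r hr => by
      obtain rfl := (hadm.contact j r hr).1
      exact haut hr
    obtain ⟨p, K, s, hF, hK, hsb, hH⟩ := main 0 (fun r hr => absurd hr (hno r)) (fun _ => rfl)
    refine ⟨0, K, s, hF, hK, ?_, fun _ => rfl, hH hcast⟩
    rw [hsb, endWeight_castSucc, hs, smul_zero, zero_smul]

end Execution

end HybridLQ

theorem mainTheorem5 {Q E : Type*} [Finite Q] [Finite E] (S : HybridLQ.Problem Q E)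
    (hS : S.Valid) (ω : HybridLQ.Execution S) (hopt : ω.IsOptimal) (hreg : ω.RegularEntry) :
    ∃ (K : (i : Fin (S.N + 1)) → ℝ → Matrix (Fin (S.n (ω.q i))) (Fin (S.n (ω.q i))) ℝ)
      (s : (i : Fin (S.N + 1)) → ℝ → Fin (S.n (ω.q i)) → ℝ)
      (p : Fin S.N → ℝ),
      -- the optimal control law
      (∀ i, ∀ᵐ t ∂(volume.restrict (Ico (ω.tstart i) (ω.tend i))),
        ω.u i t =
          - (((S.R (ω.q i) t)⁻¹ * (S.B (ω.q i) t)ᵀ * K i t) *ᵥ ω.x i t)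
          - ((S.R (ω.q i) t)⁻¹ * (S.B (ω.q i) t)ᵀ) *ᵥ s i t) ∧
      -- the Riccati equation for `K`
      (∀ i, ∀ t ∈ Icc (ω.tstart i) (ω.tend i), ∀ a b,
        HasDerivWithinAt (fun τ => K i τ a b)
          ((- S.L (ω.q i) t - K i t * S.A (ω.q i) t - (S.A (ω.q i) t)ᵀ * K i t
            + K i t * S.B (ω.q i) t * (S.R (ω.q i) t)⁻¹ * (S.B (ω.q i) t)ᵀ * K i t) a b)
          (Icc (ω.tstart i) (ω.tend i)) t) ∧
      -- the equation for `s`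
      (∀ i, ∀ t ∈ Icc (ω.tstart i) (ω.tend i),
        HasDerivWithinAt (s i)
          (- (((S.A (ω.q i) t)ᵀ
                - K i t * S.B (ω.q i) t * (S.R (ω.q i) t)⁻¹ * (S.B (ω.q i) t)ᵀ) *ᵥ s i t)
            - K i t *ᵥ S.F (ω.q i) t + S.L (ω.q i) t *ᵥ S.r (ω.q i) t)
          (Icc (ω.tstart i) (ω.tend i)) t) ∧
      -- the terminal conditions
      K (Fin.last S.N) S.tf = S.G (ω.q (Fin.last S.N)) ∧
      s (Fin.last S.N) S.tf =
        - (S.G (ω.q (Fin.last S.N)) *ᵥ S.d (Fin.last S.N) (ω.q (Fin.last S.N))) ∧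
      -- the boundary conditions at the switching times
      (∀ j : Fin S.N,
        K j.castSucc (ω.tend j.castSucc) =
          (S.P (ω.q j.castSucc) (ω.q j.succ) (ω.σ j))ᵀ * K j.succ (ω.tstart j.succ)
              * S.P (ω.q j.castSucc) (ω.q j.succ) (ω.σ j)
            + S.C (ω.q j.castSucc) (ω.σ j)) ∧
      (∀ j : Fin S.N,
        s j.castSucc (ω.tend j.castSucc) =
          (S.P (ω.q j.castSucc) (ω.q j.succ) (ω.σ j))ᵀ *ᵥ s j.succ (ω.tstart j.succ)
            + p j • S.m (ω.q j.castSucc) (ω.q j.succ)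
            - S.C (ω.q j.castSucc) (ω.σ j) *ᵥ S.d j.castSucc (ω.q j.castSucc)
            + ((S.P (ω.q j.castSucc) (ω.q j.succ) (ω.σ j))ᵀ * K j.succ (ω.tstart j.succ)) *ᵥ
                S.J (ω.q j.castSucc) (ω.q j.succ) (ω.σ j)) ∧
      (∀ j : Fin S.N, ¬ ω.Autonomous j → p j = 0) ∧
      -- the closed form below is the minimum of the Hamiltonian over the controls
      (∀ i, ∀ t ∈ Icc (ω.tstart i) (ω.tend i), ∀ y : Fin (S.n (ω.q i)) → ℝ,
        IsLeast (Set.range fun v => S.hamiltonian (ω.q i) t y (K i t *ᵥ y + s i t) v)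
          (S.minHamiltonian (ω.q i) t y (K i t *ᵥ y + s i t))) ∧
      -- continuity of the minimized Hamiltonians at the switching times
      (∀ j : Fin S.N,
        S.minHamiltonian (ω.q j.castSucc) (ω.tend j.castSucc) (ω.xend j.castSucc)
            (K j.castSucc (ω.tend j.castSucc) *ᵥ ω.xend j.castSucc
              + s j.castSucc (ω.tend j.castSucc)) =
          S.minHamiltonian (ω.q j.succ) (ω.tstart j.succ)
            (S.jump (ω.q j.castSucc) (ω.q j.succ) (ω.σ j) (ω.xend j.castSucc))
            (K j.succ (ω.tstart j.succ) *ᵥ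
                S.jump (ω.q j.castSucc) (ω.q j.succ) (ω.σ j) (ω.xend j.castSucc)
              + s j.succ (ω.tstart j.succ))) := by
  obtain ⟨f, hf, hlink⟩ := HybridLQ.exists_backward_chain
    (D := fun i : Fin (S.N + 1) => (ℝ → Matrix (Fin (S.n (ω.q i))) (Fin (S.n (ω.q i))) ℝ) ×
      (ℝ → Fin (S.n (ω.q i)) → ℝ))
    (Good := fun i d => ω.FeedbackOn i d.1 d.2 ∧ ∀ h : i = Fin.last S.N,
      d.1 S.tf = S.G (ω.q i) ∧ d.2 S.tf = - (S.G (ω.q i) *ᵥ S.d i (ω.q i)))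
    (Link := fun j d d' => ∃ p : ℝ,
      d.1 (ω.tend j.castSucc) =
        (S.P (ω.q j.castSucc) (ω.q j.succ) (ω.σ j))ᵀ * d'.1 (ω.tstart j.succ)
            * S.P (ω.q j.castSucc) (ω.q j.succ) (ω.σ j)
          + S.C (ω.q j.castSucc) (ω.σ j) ∧
      d.2 (ω.tend j.castSucc) =
        (S.P (ω.q j.castSucc) (ω.q j.succ) (ω.σ j))ᵀ *ᵥ d'.2 (ω.tstart j.succ)
          + p • S.m (ω.q j.castSucc) (ω.q j.succ)
          - S.C (ω.q j.castSucc) (ω.σ j) *ᵥ S.d j.castSucc (ω.q j.castSucc)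
          + ((S.P (ω.q j.castSucc) (ω.q j.succ) (ω.σ j))ᵀ * d'.1 (ω.tstart j.succ)) *ᵥ
              S.J (ω.q j.castSucc) (ω.q j.succ) (ω.σ j) ∧
      (¬ ω.Autonomous j → p = 0) ∧
      S.minHamiltonian (ω.q j.castSucc) (ω.tend j.castSucc) (ω.xend j.castSucc)
          (d.1 (ω.tend j.castSucc) *ᵥ ω.xend j.castSucc + d.2 (ω.tend j.castSucc)) =
        S.minHamiltonian (ω.q j.succ) (ω.tstart j.succ)
          (S.jump (ω.q j.castSucc) (ω.q j.succ) (ω.σ j) (ω.xend j.castSucc))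
          (d'.1 (ω.tstart j.succ) *ᵥ
              S.jump (ω.q j.castSucc) (ω.q j.succ) (ω.σ j) (ω.xend j.castSucc)
            + d'.2 (ω.tstart j.succ)))
    (by
      obtain ⟨K, s, hF, hK, hs⟩ := hopt.exists_feedbackOn_last hS hreg
      exact ⟨(K, s), hF, fun _ => ⟨hK, hs⟩⟩)
    (fun j d hd => by
      obtain ⟨p, K, s, hF, hrest⟩ := hopt.exists_feedbackOn_castSucc hS hreg j hd.1
      exact ⟨(K, s), ⟨hF, fun h => absurd h (Fin.castSucc_ne_last j)⟩, p, hrest⟩)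
  choose p hK hs hp hH using hlink
  exact ⟨fun i => (f i).1, fun i => (f i).2, p, fun i => (hf i).1.control,
    fun i => (hf i).1.riccati, fun i => (hf i).1.offset, ((hf _).2 rfl).1, ((hf _).2 rfl).2,
    hK, hs, hp, fun i t ht y => hS.isLeast_hamiltonian (hopt.1.Icc_subset i ht) _ _, hH⟩
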